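/- A real plane curve of degree $d\ge 1$ is a nonzero real form of degree $d$ in three variables up to multiplication by a nonzero real constant; such curves form a real projective space $\mathcal C_d$. For a curve $A$, let $\mathbb{C}A\subset\mathbb{C}P^2$ and $\mathbb{R}A\subset\mathbb{R}P^2$ be its sets of complex and real points; non-singularity and transversality refer to all complex points. A *simple nodal deformation* is a smooth path $A_t$, $t\in[0,1]$, in $\mathcal C_d$ which meets the discriminant hypersurface (the set of singular curves) transversally and only at its non-singular points. That is, for suitable forms $\varphi_t$ defining $A_t$ and depending smoothly on $t$: each singular $A_t$ has exactly one singular point $v\in\mathbb{C}P^2$, which is real and an ordinary double point, and $\frac{d}{ds}\varphi_s(v)|_{s=t}\neq 0$. A *simultaneous nodal deformation* is a family $A_t=B_t\cup C_t$, $t\in[0,1]$, where $B_t$ and $C_t$ are simple nodal deformations such that, for every $t$, none of $\mathbb{C}B_t$, $\mathbb{C}C_t$ passes through a singular point of the other, and $\mathbb{C}B_t$, $\mathbb{C}C_t$ meet transversally at every common point, except possibly at real points where they have a simple (quadratic) tangency. Let $\deg A_t=2k$ and let $f_0$ be a form defining $A_0$. Fix $W_0$ to be one of the two regions $\{f_0\ge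 0\}$, $\{f_0\le 0\}$ of $\mathbb{R}P^2$. Replacing $f_0$ by $-f_0$ if necessary, assume $W_0=\{f_0\ge0\}$, and extend $f_0$ to a continuous family of forms $f_t$ defining $A_t$. The deformation is *nice* with respect to $W_0$ if for no $t\in[0,1]$ does the real part of the double plane $\{w^2=f_t(x,y,z)\}$ have a dot-like node, that is, a real ordinary double point with definite quadratic part, like $\{x^2+y^2+z^2=0\}$. **Lemma 3.4.2.** Let $A_0$ and $A_1$ be real plane curves of degree $2k$, $k\ge1$, with $\mathbb{R}A_0\ne\varnothing$ and $\mathbb{R}A_1\neq\varnothing$, which split as $A_0=B_0\cup C_0$ and $A_1=B_1\cup C_1$, where $B_i$, $C_i$ are non-singular real plane curves of positive degree, $B_i$ is transverse to $C_i$ ($i=0,1$), and $\deg B_0=\deg B_1$. Then for each of the two choices of $W_0$ there is a simultaneous nodal deformation $A_t=B_t\cup C_t$, $t\in[0,1]$, from $A_0=B_0\cup C_0$ to $A_1=B_1\cup C_1$ which is nice with respect to $W_0$. -/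

import Mathlib

open MvPolynomial Set
open scoped ContDiff LinearAlgebra.Projectivization

noncomputable section

/-! ### Polynomials: gradient, Hessian, dot-like nodes -/

/-- The gradient of a polynomial at a point. -/
def grad {σ R : Type*} [CommRing R] (f : MvPolynomial σ R) (v : σ → R) : σ → R :=
  fun i => eval v (pderiv i f)

/-- The Hessian matrix of a polynomial at a point. -/
def hessian {σ R : Type*} [CommRing R] (f : MvPolynomial σ R) (v : σ → R) : Matrix σ σ R :=
  Matrix.of fun i j => eval v (pderiv i (pderiv j f))

/-- `p` is a dot-like node of the real affine hypersurface `{g = 0}`: an ordinary double point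
at which the quadratic part of `g` is definite, as for `{x² + y² + z² = 0}` at the origin. -/
def IsDotLikeNode {σ : Type*} [Fintype σ] (g : MvPolynomial σ ℝ) (p : σ → ℝ) : Prop :=
  eval p g = 0 ∧ grad g p = 0 ∧ ((hessian g p).PosDef ∨ (-hessian g p).PosDef)

/-! ### Real plane curves -/

/-- The real projective plane. -/
abbrev RealPlane : Type := ℙ ℝ (Fin 3 → ℝ)

/-- Real ternary forms of degree `d`. -/
abbrev RealForm (d : ℕ) : Type := homogeneousSubmodule (Fin 3) ℝ d

/-- The projective space of real plane curves of degree `d`: nonzero real ternary forms of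
degree `d` up to multiplication by nonzero real constants. -/
abbrev PlaneCurve (d : ℕ) : Type := ℙ ℝ (RealForm d)

/-- A real form defining the curve (well defined up to a nonzero constant). -/
def curveForm {d : ℕ} (A : PlaneCurve d) : MvPolynomial (Fin 3) ℝ := (A.rep : RealForm d)

/-- The same form, considered over the complex numbers. -/
def complexForm {d : ℕ} (A : PlaneCurve d) : MvPolynomial (Fin 3) ℂ :=
  map (algebraMap ℝ ℂ) (curveForm A)

/-- The set of real points of a real plane curve. -/
def realPoints {d : ℕ} (A : PlaneCurve d) : Set RealPlane :=
  {p | eval p.rep (curveForm A) = 0}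

/-- The union of two real plane curves, given by the product of their forms. -/
def curveUnion {m n : ℕ} (B : PlaneCurve m) (C : PlaneCurve n) : PlaneCurve (m + n) :=
  Projectivization.mk ℝ
    (⟨curveForm B * curveForm C, IsHomogeneous.mul B.rep.2 C.rep.2⟩ : RealForm (m + n))
    (fun h => mul_ne_zero
      (fun hB => B.rep_nonzero (Subtype.ext hB)) (fun hC => C.rep_nonzero (Subtype.ext hC))
      (congrArg Subtype.val h))

/-- Homogeneous coordinates `u` represent a singular point of the complex point set of `A`. -/
def IsSingularPoint {d : ℕ} (A : PlaneCurve d) (u : Fin 3 → ℂ) : Prop :=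
  u ≠ 0 ∧ eval u (complexForm A) = 0 ∧ grad (complexForm A) u = 0

/-- The curve is non-singular (at all its complex points). -/
def IsNonsingularCurve {d : ℕ} (A : PlaneCurve d) : Prop :=
  ∀ u, ¬ IsSingularPoint A u

/-- `u` represents a common complex point of the curves `B` and `C`. -/
def IsCommonPoint {m n : ℕ} (B : PlaneCurve m) (C : PlaneCurve n) (u : Fin 3 → ℂ) : Prop :=
  u ≠ 0 ∧ eval u (complexForm B) = 0 ∧ eval u (complexForm C) = 0

/-- The curves `B` and `C` are both smooth at their common complex point `u`
and have distinct tangent lines there. -/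
def MeetTransversallyAt {m n : ℕ} (B : PlaneCurve m) (C : PlaneCurve n) (u : Fin 3 → ℂ) : Prop :=
  LinearIndependent ℂ ![grad (complexForm B) u, grad (complexForm C) u]

/-- Two plane curves are transverse: they meet transversally at every common complex point. -/
def AreTransverse {m n : ℕ} (B : PlaneCurve m) (C : PlaneCurve n) : Prop :=
  ∀ u, IsCommonPoint B C u → MeetTransversallyAt B C u

/-- The real curves `B = {f = 0}` and `C = {g = 0}` have a simple (quadratic) tangency at the real
point `v`: both are smooth at `v`, they have the same tangent line there (`∇f = c ∇g`), and the
second order parts of the two branches differ. Here `f - c g` vanishes to first order at `v`, and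
its second derivative along the common tangent line is nonzero. This does not depend on the choice
of the tangent vector `w` (a vector of `ℝ³` in the plane of the tangent line, independent of `v`),
because `f`, `g` are homogeneous and vanish at `v`. -/
def HasSimpleTangencyAt {m n : ℕ} (B : PlaneCurve m) (C : PlaneCurve n) (v : Fin 3 → ℝ) : Prop :=
  v ≠ 0 ∧ eval v (curveForm B) = 0 ∧ eval v (curveForm C) = 0 ∧
  grad (curveForm B) v ≠ 0 ∧ grad (curveForm C) v ≠ 0 ∧
  ∃ c : ℝ, grad (curveForm B) v = c • grad (curveForm C) v ∧
    ∀ w : Fin 3 → ℝ, grad (curveForm C) v ⬝ᵥ w = 0 → w ∉ Submodule.span ℝ {v} →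
      w ⬝ᵥ Matrix.mulVec (hessian (curveForm B) v - c • hessian (curveForm C) v) w ≠ 0

/-! ### Nodal deformations -/

/-- The family of forms `φ t`, `0 ≤ t ≤ 1`, defines the family of curves `A t`. -/
def Represents {d : ℕ} (φ : ℝ → RealForm d) (A : ℝ → PlaneCurve d) : Prop :=
  ∀ t ∈ Icc (0 : ℝ) 1, ∃ h : φ t ≠ 0, A t = Projectivization.mk ℝ (φ t) h

/-- A simple nodal deformation `A t`, `0 ≤ t ≤ 1`: a smooth path in the projective space of real
curves of degree `d` (given by a smooth path `φ` of forms) which meets the discriminant hypersurface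
transversally and only at its non-singular points. The latter are the curves whose only singular
point is an ordinary double point (necessarily real, the Hessian of the form having rank two there);
the tangent hyperplane to the discriminant at such a curve consists of the forms which vanish at the
node `v`, so that transversality means that the velocity of `φ` does not vanish at `v`. -/
def IsSimpleNodalDeformation {d : ℕ} (A : ℝ → PlaneCurve d) : Prop :=
  ∃ φ : ℝ → RealForm d, Represents φ A ∧
    (∀ e : Fin 3 →₀ ℕ,
      ContDiffOn ℝ ∞ (fun t => coeff e (φ t : MvPolynomial (Fin 3) ℝ)) (Icc 0 1)) ∧
    ∀ t ∈ Icc (0 : ℝ) 1, ¬ IsNonsingularCurve (A t) →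
      ∃ v : Fin 3 → ℝ, IsSingularPoint (A t) (fun i => (v i : ℂ)) ∧
        (∀ u, IsSingularPoint (A t) u → ∃ z : ℂ, u = z • fun i => (v i : ℂ)) ∧
        (hessian (curveForm (A t)) v).rank = 2 ∧
        derivWithin (fun s => eval v (φ s : MvPolynomial (Fin 3) ℝ)) (Icc 0 1) t ≠ 0

/-- A simultaneous nodal deformation `A t = B t ∪ C t`, `0 ≤ t ≤ 1`: both `B t` and `C t` are simple
nodal deformations, none of the curves `B t`, `C t` passes through a singular point of the other,
and at each common point they meet transversally, unless the point is real and is a point of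
simple tangency. -/
def IsSimultaneousNodalDeformation {m n : ℕ} (B : ℝ → PlaneCurve m) (C : ℝ → PlaneCurve n) : Prop :=
  IsSimpleNodalDeformation B ∧ IsSimpleNodalDeformation C ∧
    ∀ t ∈ Icc (0 : ℝ) 1, ∀ u, IsCommonPoint (B t) (C t) u →
      ¬ IsSingularPoint (B t) u ∧ ¬ IsSingularPoint (C t) u ∧
      (MeetTransversallyAt (B t) (C t) u ∨
        ∃ (z : ℂ) (v : Fin 3 → ℝ), (u = z • fun i => (v i : ℂ)) ∧
          HasSimpleTangencyAt (B t) (C t) v)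

/-! ### Double planes -/

/-- The region of the real projective plane where a form of even degree is nonnegative. -/
def region (f : MvPolynomial (Fin 3) ℝ) : Set RealPlane := {p | 0 ≤ eval p.rep f}

/-- `W` is one of the two regions into which the curve `A` of even degree divides the real
projective plane. -/
def IsRegionOf {d : ℕ} (A : PlaneCurve d) (W : Set RealPlane) : Prop :=
  W = region (curveForm A) ∨ W = region (-curveForm A)

/-- The affine equation `w² - f = 0` of the double plane `{w² = f(x₀, x₁, x₂)}` (a surface in the
weighted projective space with weights `1, 1, 1, k`, where `deg f = 2k`) in the chart `xᵢ = 1`.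
The variable `none` is `w` and the variables `some j` are the two other coordinates. The three
charts cover the double plane, and its real points are the points with real coordinates. -/
def doublePlaneChart (f : MvPolynomial (Fin 3) ℝ) (i : Fin 3) : MvPolynomial (Option (Fin 2)) ℝ :=
  X none ^ 2 -
    aeval (Fin.insertNth (α := fun _ => MvPolynomial (Option (Fin 2)) ℝ) i 1
      (fun j => X (some j))) f

/-- The real part of the double plane `{w² = f}` has a dot-like node. -/
def DoublePlaneHasDotLikeNode (f : MvPolynomial (Fin 3) ℝ) : Prop :=
  ∃ (i : Fin 3) (p : Option (Fin 2) → ℝ), IsDotLikeNode (doublePlaneChart f i) p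

/-- The deformation `A t`, `0 ≤ t ≤ 1`, of curves of even degree is nice with respect to the choice
`W₀` of one of the two regions of `A 0`: no dot-like nodes appear in the real parts of the
continuous family of double planes `{w² = f t}` branched along `A t` which is determined by
`W₀ = {f 0 ≥ 0}`. (The family `f` is unique up to a continuous positive factor.) -/
def IsNiceFor {d : ℕ} (A : ℝ → PlaneCurve d) (W₀ : Set RealPlane) : Prop :=
  ∃ f : ℝ → RealForm d, Represents f A ∧
    (∀ e : Fin 3 →₀ ℕ,
      ContinuousOn (fun t => coeff e (f t : MvPolynomial (Fin 3) ℝ)) (Icc 0 1)) ∧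
    region (f 0 : MvPolynomial (Fin 3) ℝ) = W₀ ∧
    ∀ t ∈ Icc (0 : ℝ) 1, ¬ DoublePlaneHasDotLikeNode (f t : MvPolynomial (Fin 3) ℝ)

end

/-! Lift the two curves to a path of pairs of forms (F_t, G_t), so that f_t = F_t G_t. At a real
singular point v of F the second differential of w² - FG is 2 dw² - G(v) Hess F(v), so a direction
in which G(v) Hess F(v) is positive prevents a dot-like node there. This condition, together with
the one obtained by exchanging F and G, defines safe pairs. It is open, by compactness of the
sphere, and it implies niceness (`not_doublePlaneHasDotLikeNode`): at a common zero of F and G the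
Hessian of FG is a symmetrized product of two covectors, which is not definite on an affine chart.

The heart of the proof is that the two given pairs lie in one path component of the safe pairs
(`joinedIn_safePairs`). Fix a real nonsingular G with a real zero; it takes both signs. Along a
generic path of forms F, real singular points occur only at isolated times, and then as a single
node. If the sign of G at the node is wrong, a linear substitution h connected to the identity moves
the node to a point where the sign is right. The forms just before and just after the node are
joined to their images under h through real nonsingular forms, and these images are joined to each
other across the node, which is now safe. Hence any two real nonsingular F are joined while G stays
fixed. Moving F and G in turn, and always keeping fixed a factor that has real zeros, joins the
given pairs; the hypothesis that the unions have real points provides such a factor at either end.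

A path in an open set can then be made smooth and put in general position without leaving the set
and without moving its ends. The perturbation γ(t) + t(1 - t)(p + tq) changes value and velocity
independently at interior times. Each degeneration to be avoided is a surjective linear system on
(value, velocity) with more equations than parameters, time included, so the bad (p, q) have less
than full Hausdorff dimension (`isAvoidable_of_linear`). In low degrees some of these systems fail
to be surjective; there linear algebra reduces the degeneration to the other ones. -/

/-! ### Transversality for families of affine systems -/

section Transversality

open Topology Module

variable {E P T : Type*} [NormedAddCommGroup E] [NormedSpace ℝ E] [FiniteDimensional ℝ E]
  [NormedAddCommGroup P] [NormedSpace ℝ P] [FiniteDimensional ℝ P]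
  [NormedAddCommGroup T] [NormedSpace ℝ T] [FiniteDimensional ℝ T]

/-- Locally in `e`, the solutions of a family of surjective affine systems form a set of the
expected dimension. -/
theorem exists_nhds_dimH_solutions_le {A : E → P →L[ℝ] T} {b : E → T} (hA : ContDiff ℝ 1 A)
    (hb : ContDiff ℝ 1 b) (e₀ : E) (hs : Function.Surjective (A e₀)) :
    ∃ N ∈ 𝓝 e₀, dimH {p | ∃ e ∈ N, A e p = b e} ≤
      ((finrank ℝ E + (finrank ℝ P - finrank ℝ T) : ℕ) : ENNReal) := by
  obtain ⟨R₀, hR₀⟩ := (A e₀ : P →ₗ[ℝ] T).exists_rightInverse_of_surjective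
    (LinearMap.range_eq_top.2 hs)
  let R : T →L[ℝ] P := LinearMap.toContinuousLinearMap R₀
  have hR : ∀ τ, A e₀ (R τ) = τ := fun τ => LinearMap.congr_fun hR₀ τ
  let K := LinearMap.ker (A e₀ : P →ₗ[ℝ] T)
  have hK : finrank ℝ K = finrank ℝ P - finrank ℝ T := by
    have := LinearMap.finrank_range_add_finrank_ker (A e₀ : P →ₗ[ℝ] T)
    rw [LinearMap.range_eq_top.2 hs, finrank_top] at this
    simp only [K]; omega
  let B : E → (T →L[ℝ] T) := fun e => (A e).comp R
  have hB : ContDiff ℝ 1 B := hA.clm_comp contDiff_const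
  have hB₀ : B e₀ = 1 := by ext τ; simp [B, hR]
  have hopen : {e | IsUnit (B e)} ∈ 𝓝 e₀ := by
    have : IsOpen {e | IsUnit (B e)} := Units.isOpen.preimage hB.continuous
    exact this.mem_nhds (by simp [hB₀])
  obtain ⟨r, hr, hball⟩ := Metric.mem_nhds_iff.1 hopen
  -- With p = κ + R τ and κ in the kernel of `A e₀`, the equation `A e p = b e` determines τ,
  -- because `B e` is invertible near `e₀`. The solutions are thus a C¹ image of a set of pairs (e,
  -- κ).
  let Θ : E × K → P := fun x => x.2 + R (Ring.inverse (B x.1) (b x.1 - A x.1 x.2))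
  have hΘ : ContDiffOn ℝ 1 Θ (Metric.ball e₀ r ×ˢ univ) := by
    intro x hx
    refine ContDiffAt.contDiffWithinAt ?_
    obtain ⟨w, hw⟩ := hball hx.1
    have h1 : ContDiffAt ℝ 1 (fun x : E × K => Ring.inverse (B x.1)) x := by
      have h2 : ContDiffAt ℝ 1 Ring.inverse (B x.1) := hw ▸ contDiffAt_ringInverse ℝ w
      exact h2.comp x (hB.contDiffAt.comp x contDiffAt_fst)
    have h3 : ContDiff ℝ 1 (fun x : E × K => ((x.2 : K) : P)) :=
      (K.subtypeL.contDiff).comp contDiff_snd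
    have h4 : ContDiff ℝ 1 (fun x : E × K => b x.1 - A x.1 x.2) :=
      (hb.comp contDiff_fst).sub ((hA.comp contDiff_fst).clm_apply h3)
    exact h3.contDiffAt.add (R.contDiff.contDiffAt.comp x (h1.clm_apply h4.contDiffAt))
  refine ⟨Metric.ball e₀ r, Metric.ball_mem_nhds _ hr, ?_⟩
  have hsub : {p | ∃ e ∈ Metric.ball e₀ r, A e p = b e} ⊆ Θ '' (Metric.ball e₀ r ×ˢ univ) := by
    rintro p ⟨e, he, hep⟩
    refine ⟨(e, ⟨p - R (A e₀ p), ?_⟩), ⟨he, mem_univ _⟩, ?_⟩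
    · simp [K, hR]
    · simp only [Θ]
      have h1 : b e - A e (p - R (A e₀ p)) = B e (A e₀ p) := by simp [B, ← hep]
      have h2 : Ring.inverse (B e) * B e = 1 := Ring.inverse_mul_cancel _ (hball he)
      have h3 : Ring.inverse (B e) (B e (A e₀ p)) = A e₀ p := by
        simpa using congrArg (fun f : T →L[ℝ] T => f (A e₀ p)) h2
      rw [h1, h3]; simp
  calc _ ≤ dimH (Θ '' (Metric.ball e₀ r ×ˢ univ)) := dimH_mono hsub
    _ ≤ dimH (Metric.ball e₀ r ×ˢ (univ : Set K)) :=
        hΘ.dimH_image_le ((convex_ball _ _).prod convex_univ) subset_rfl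
    _ ≤ dimH (univ : Set (E × K)) := dimH_mono (subset_univ _)
    _ = _ := by rw [Real.dimH_univ_eq_finrank, finrank_prod, hK]

/-- A family of affine systems with more equations than parameters has no solution for a generic
value of the unknown. -/
theorem dimH_solutions_lt [Nontrivial P] {A : E → P →L[ℝ] T} {b : E → T} (hA : ContDiff ℝ 1 A)
    (hb : ContDiff ℝ 1 b) (S : Set E) (hs : ∀ e ∈ S, Function.Surjective (A e))
    (hd : finrank ℝ E < finrank ℝ T) :
    dimH {p | ∃ e ∈ S, A e p = b e} < finrank ℝ P := by
  rcases S.eq_empty_or_nonempty with rfl | ⟨e₁, he₁⟩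
  · simpa using finrank_pos (R := ℝ) (M := P)
  -- Ensures that the subtraction `finrank P - finrank T` in the dimension bound is not truncated.
  have hle : finrank ℝ T ≤ finrank ℝ P :=
    (A e₁ : P →ₗ[ℝ] T).finrank_le_finrank_of_surjective (hs e₁ he₁)
  choose! N hN hdim using fun e he => exists_nhds_dimH_solutions_le hA hb e (hs e he)
  obtain ⟨t, htS, htc, hcov⟩ :=
    TopologicalSpace.countable_cover_nhdsWithin (fun e he => mem_nhdsWithin_of_mem_nhds (hN e he))
  have hsub : {p | ∃ e ∈ S, A e p = b e} ⊆ ⋃ e₀ ∈ t, {p | ∃ e ∈ N e₀, A e p = b e} := by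
    rintro p ⟨e, he, hp⟩
    obtain ⟨e₀, h₀, h₁⟩ := mem_iUnion₂.1 (hcov he)
    exact mem_iUnion₂.2 ⟨e₀, h₀, e, h₁, hp⟩
  calc _ ≤ _ := dimH_mono hsub
    _ = ⨆ e₀ ∈ t, dimH {p | ∃ e ∈ N e₀, A e p = b e} := dimH_bUnion htc _
    _ ≤ ((finrank ℝ E + (finrank ℝ P - finrank ℝ T) : ℕ) : ENNReal) :=
        iSup₂_le fun e he => hdim e (htS he)
    _ < _ := by exact_mod_cast (by omega)

variable {W : Type*} [NormedAddCommGroup W] [NormedSpace ℝ W]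

/-- The path `γ`, perturbed between its end points `γ 0` and `γ 1` by means of the parameter `p`. -/
noncomputable def perturb (γ : ℝ → W) (p : W × W) (t : ℝ) : W :=
  γ t + (t * (1 - t)) • (p.1 + t • p.2)

theorem hasDerivAt_perturb {γ : ℝ → W} (hγ : Differentiable ℝ γ) (p : W × W) (t : ℝ) :
    HasDerivAt (perturb γ p)
      (deriv γ t + ((1 - 2 * t) • (p.1 + t • p.2) + (t * (1 - t)) • p.2)) t := by
  have h1 : HasDerivAt (fun t : ℝ => t * (1 - t)) (1 - 2 * t) t := by
    exact ((hasDerivAt_id' t).fun_mul ((hasDerivAt_const t (1 : ℝ)).fun_sub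
      (hasDerivAt_id' t))).congr_deriv (by ring)
  have h2 : HasDerivAt (fun t : ℝ => p.1 + t • p.2) p.2 t := by
    simpa using ((hasDerivAt_id' t).smul_const p.2).const_add p.1
  exact ((hγ t).hasDerivAt.fun_add (h1.fun_smul h2)).congr_deriv (by rw [add_comm (_ • p.2)])

theorem contDiff_perturb {γ : ℝ → W} {n : WithTop ℕ∞} (hγ : ContDiff ℝ n γ) (p : W × W) :
    ContDiff ℝ n (perturb γ p) := by
  unfold perturb; fun_prop

@[simp] theorem perturb_zero (γ : ℝ → W) (p : W × W) : perturb γ p 0 = γ 0 := by simp [perturb]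

@[simp] theorem perturb_one (γ : ℝ → W) (p : W × W) : perturb γ p 1 = γ 1 := by simp [perturb]

theorem dist_perturb_le (γ : ℝ → W) (p : W × W) {t : ℝ} (ht : t ∈ Icc (0 : ℝ) 1) :
    dist (perturb γ p t) (γ t) ≤ 2 * ‖p‖ := by
  have h1 : ‖p.1 + t • p.2‖ ≤ 2 * ‖p‖ := by
    calc ‖p.1 + t • p.2‖ ≤ ‖p.1‖ + ‖t • p.2‖ := norm_add_le _ _
      _ ≤ ‖p‖ + 1 * ‖p‖ := by
        rw [norm_smul, Real.norm_of_nonneg ht.1]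
        gcongr
        · exact norm_fst_le p
        · exact ht.2
        · exact norm_snd_le p
      _ = _ := by ring
  have h2 : |t * (1 - t)| ≤ 1 := by
    rw [abs_le]; constructor <;> nlinarith [ht.1, ht.2]
  rw [dist_eq_norm, perturb, add_sub_cancel_left, norm_smul, Real.norm_eq_abs]
  nlinarith [norm_nonneg (p.1 + t • p.2), abs_nonneg (t * (1 - t))]

/-- The property `Q` of a vector and a velocity is avoided by generic perturbations of `γ`. -/
def IsAvoidable (γ : ℝ → W) (Q : W → W → Prop) : Prop :=
  dimH {p | ∃ t ∈ Ioo (0 : ℝ) 1, Q (perturb γ p t) (deriv (perturb γ p) t)} < finrank ℝ (W × W)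

theorem IsAvoidable.mono {γ : ℝ → W} {Q Q' : W → W → Prop} (h : IsAvoidable γ Q)
    (hQ : ∀ x y, Q' x y → Q x y) : IsAvoidable γ Q' :=
  lt_of_le_of_lt (dimH_mono fun _ hp => hp.imp fun _ ht => ⟨ht.1, hQ _ _ ht.2⟩) h

theorem IsAvoidable.or {γ : ℝ → W} {Q Q' : W → W → Prop} (h : IsAvoidable γ Q)
    (h' : IsAvoidable γ Q') : IsAvoidable γ (fun x y => Q x y ∨ Q' x y) := by
  have := max_lt h h'
  rw [← dimH_union] at this
  refine lt_of_le_of_lt (dimH_mono fun p hp => ?_) this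
  obtain ⟨t, ht, hp | hp⟩ := hp
  exacts [Or.inl ⟨t, ht, hp⟩, Or.inr ⟨t, ht, hp⟩]

theorem isAvoidable_false [Nontrivial W] [FiniteDimensional ℝ W] (γ : ℝ → W) :
    IsAvoidable γ (fun _ _ => False) := by
  simpa [IsAvoidable] using finrank_pos (R := ℝ) (M := W)

theorem IsAvoidable.exists {ι : Type*} [Finite ι] [Nontrivial W] [FiniteDimensional ℝ W]
    {γ : ℝ → W} {Q : ι → W → W → Prop} (h : ∀ i, IsAvoidable γ (Q i)) :
    IsAvoidable γ (fun x y => ∃ i, Q i x y) := by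
  have := Fintype.ofFinite ι
  classical
  suffices ∀ s : Finset ι, IsAvoidable γ (fun x y => ∃ i ∈ s, Q i x y) by
    simpa using this Finset.univ
  intro s
  induction s using Finset.induction_on with
  | empty => simpa using isAvoidable_false γ
  | insert i s _ ih =>
    refine ((h i).or ih).mono fun x y => ?_
    simp

theorem IsAvoidable.exists_perturb [FiniteDimensional ℝ W] {γ : ℝ → W} {Q : W → W → Prop}
    (h : IsAvoidable γ Q) {ε : ℝ} (hε : 0 < ε) :
    ∃ p : W × W, (∀ t ∈ Icc (0 : ℝ) 1, dist (perturb γ p t) (γ t) < ε) ∧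
      ∀ t ∈ Ioo (0 : ℝ) 1, ¬ Q (perturb γ p t) (deriv (perturb γ p) t) := by
  obtain ⟨p, hp, hpε⟩ := (dense_compl_of_dimH_lt_finrank h).exists_dist_lt 0 (half_pos hε)
  refine ⟨p, fun t ht => (dist_perturb_le γ p ht).trans_lt ?_, fun t ht hQ => hp ⟨t, ht, hQ⟩⟩
  rw [dist_zero_left] at hpε
  linarith

/-- A property given by a surjective linear system on the vector and the velocity, with more
equations than parameters (including the time), is avoidable. -/
theorem isAvoidable_of_linear [Nontrivial W] [FiniteDimensional ℝ W] {γ : ℝ → W}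
    (hγ : ContDiff ℝ 2 γ) (ℓ : E → W → W → T)
    (hlin : ∀ e, IsLinearMap ℝ (fun x : W × W => ℓ e x.1 x.2))
    (hsm : ∀ x y, ContDiff ℝ 1 (fun e => ℓ e x y)) (S : Set E)
    (hs : ∀ e ∈ S, ∀ τ, ∃ x y, ℓ e x y = τ) (hd : finrank ℝ E + 1 < finrank ℝ T) :
    IsAvoidable γ (fun x y => ∃ e ∈ S, ℓ e x y = 0) := by
  let L : E → (W × W →L[ℝ] T) := fun e => ((hlin e).mk' _).toContinuousLinearMap
  have hL : ∀ e x y, L e (x, y) = ℓ e x y := fun e x y => rfl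
  have hLs : ContDiff ℝ 1 L := contDiff_clm_apply_iff.2 fun x => hsm x.1 x.2
  -- The effect of `p` on value and velocity at time `t`. In the variables `p.1 + t • p.2` and `p.2`
  -- it is triangular with diagonal entries t(1 - t), hence bijective at interior times.
  let M₀ : ℝ → (W × W →ₗ[ℝ] W × W) := fun t =>
    LinearMap.prod ((t * (1 - t)) • (LinearMap.fst ℝ W W + t • LinearMap.snd ℝ W W))
      ((1 - 2 * t) • (LinearMap.fst ℝ W W + t • LinearMap.snd ℝ W W)
        + (t * (1 - t)) • LinearMap.snd ℝ W W)
  let M : ℝ → (W × W →L[ℝ] W × W) := fun t => (M₀ t).toContinuousLinearMap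
  have hM : ∀ t p, M t p = ((t * (1 - t)) • (p.1 + t • p.2),
    (1 - 2 * t) • (p.1 + t • p.2) + (t * (1 - t)) • p.2) := fun t p => rfl
  have hMs : ContDiff ℝ 1 M := contDiff_clm_apply_iff.2 fun p => by
    simp only [hM]; fun_prop
  have hγ' : ContDiff ℝ 1 (deriv γ) := by
    have : ContDiff ℝ (1 + 1) γ := by simpa [one_add_one_eq_two] using hγ
    exact (contDiff_succ_iff_deriv.1 this).2.2
  have key := dimH_solutions_lt (E := ℝ × E) (P := W × W)
    (A := fun e => (L e.2).comp (M e.1)) (b := fun e => - L e.2 (γ e.1, deriv γ e.1))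
    ((hLs.comp contDiff_snd).clm_comp (hMs.comp contDiff_fst))
    (((hLs.comp contDiff_snd).clm_apply
      (((hγ.of_le one_le_two).comp contDiff_fst).prodMk (hγ'.comp contDiff_fst))).neg)
    (Ioo 0 1 ×ˢ S) ?_ (by rw [finrank_prod, finrank_self]; omega)
  · refine (dimH_mono ?_).trans_lt key
    rintro p ⟨t, ht, e, he, hp⟩
    refine ⟨(t, e), ⟨ht, he⟩, ?_⟩
    rw [(hasDerivAt_perturb (hγ.differentiable two_ne_zero) p t).deriv, ← hL] at hp
    rw [eq_neg_iff_add_eq_zero, ContinuousLinearMap.comp_apply, ← map_add, hM, ← hp, perturb]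
    simp only [Prod.mk_add_mk]
    rw [add_comm (γ t), add_comm (deriv γ t)]
  · rintro ⟨t, e⟩ ⟨ht, he⟩ τ
    obtain ⟨x, y, hxy⟩ := hs e he τ
    have ht0 : t * (1 - t) ≠ 0 := (mul_pos ht.1 (by linarith [ht.2])).ne'
    let a := (t * (1 - t))⁻¹ • x
    let z := (t * (1 - t))⁻¹ • (y - (1 - 2 * t) • a)
    refine ⟨(a - t • z, z), ?_⟩
    rw [ContinuousLinearMap.comp_apply, hM, ← hxy, ← hL]
    simp only [sub_add_cancel]
    congr 2
    · simp only [a, smul_smul, mul_inv_cancel₀ ht0, one_smul]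
    · simp only [z, smul_smul, mul_inv_cancel₀ ht0, one_smul, add_sub_cancel]

end Transversality

/-! ### Gradients and Hessians of forms -/

section Forms

variable {𝕜 : Type*} [Field 𝕜] [Algebra ℝ 𝕜]

/-- The gradient of a real polynomial at a point with coordinates in a field extension. -/
noncomputable def gradAt {σ : Type*} (P : MvPolynomial σ ℝ) (u : σ → 𝕜) : σ → 𝕜 :=
  fun i => aeval u (pderiv i P)

theorem gradAt_eq_grad {σ : Type*} (P : MvPolynomial σ ℝ) (v : σ → ℝ) : gradAt P v = grad P v := by
  ext i; simp [gradAt, grad, aeval_eq_eval]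

theorem grad_map_eq_gradAt (P : MvPolynomial (Fin 3) ℝ) (u : Fin 3 → ℂ) :
    grad (map (algebraMap ℝ ℂ) P) u = gradAt P u := by
  ext i; simp [gradAt, grad, pderiv_map, eval_map, aeval_def]

theorem eval_map_eq_aeval (P : MvPolynomial (Fin 3) ℝ) (u : Fin 3 → ℂ) :
    eval u (map (algebraMap ℝ ℂ) P) = aeval u P := by
  simp [eval_map, aeval_def]

/-- The second differential of a real polynomial. -/
noncomputable def hessForm {σ : Type*} [Fintype σ] (P : MvPolynomial σ ℝ) (v x y : σ → ℝ) : ℝ :=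
  x ⬝ᵥ Matrix.mulVec (hessian P v) y

section Linearity

variable {σ : Type*} (P Q : MvPolynomial σ ℝ) (u : σ → 𝕜) (c : ℝ)

@[simp] theorem gradAt_add : gradAt (P + Q) u = gradAt P u + gradAt Q u := by
  ext i; simp [gradAt]

@[simp] theorem gradAt_smul : gradAt (c • P) u = c • gradAt P u := by
  ext i; simp [gradAt]

@[simp] theorem gradAt_zero : gradAt (0 : MvPolynomial σ ℝ) u = 0 := by
  ext i; simp [gradAt]

theorem gradAt_mul : gradAt (P * Q) u = aeval u P • gradAt Q u + aeval u Q • gradAt P u := by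
  ext i; simp [gradAt]

theorem gradAt_pow (n : ℕ) :
    gradAt (P ^ n) u = ((n : 𝕜) * aeval u P ^ (n - 1)) • gradAt P u := by
  ext i; simp [gradAt, Derivation.leibniz_pow]; ring

theorem hessian_add (v : σ → ℝ) : hessian (P + Q) v = hessian P v + hessian Q v := by
  ext i j; simp [hessian]

theorem hessian_smul (v : σ → ℝ) : hessian (c • P) v = c • hessian P v := by
  ext i j; simp [hessian, smul_eval]

theorem hessian_mul (v : σ → ℝ) : hessian (P * Q) v = eval v P • hessian Q v +
    eval v Q • hessian P v + Matrix.vecMulVec (gradAt P v) (gradAt Q v) +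
    Matrix.vecMulVec (gradAt Q v) (gradAt P v) := by
  ext i j; simp [hessian, gradAt, Matrix.vecMulVec_apply, aeval_eq_eval]; ring

variable [Fintype σ] (v x y : σ → ℝ)

@[simp] theorem hessForm_add : hessForm (P + Q) v x y = hessForm P v x y + hessForm Q v x y := by
  simp [hessForm, hessian_add, Matrix.add_mulVec]

@[simp] theorem hessForm_smul : hessForm (c • P) v x y = c * hessForm P v x y := by
  simp [hessForm, hessian_smul, Matrix.smul_mulVec]

theorem hessForm_mul : hessForm (P * Q) v x y = eval v P * hessForm Q v x y +
    eval v Q * hessForm P v x y + (x ⬝ᵥ gradAt P v) * (gradAt Q v ⬝ᵥ y) +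
    (x ⬝ᵥ gradAt Q v) * (gradAt P v ⬝ᵥ y) := by
  simp only [hessForm, hessian_mul, Matrix.add_mulVec, Matrix.smul_mulVec, dotProduct_add,
    dotProduct_smul, smul_eq_mul, Matrix.vecMulVec_mulVec]
  simp [mul_comm]

end Linearity

theorem pderiv_pderiv_comm {σ : Type*} (i j : σ) (P : MvPolynomial σ ℝ) :
    pderiv i (pderiv j P) = pderiv j (pderiv i P) := by
  classical
  induction P using MvPolynomial.induction_on with
  | C a => simp
  | add p q hp hq => simp [hp, hq]
  | mul_X p k hp =>
    simp only [pderiv_mul, pderiv_X, map_add, hp, Pi.single_apply]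
    split_ifs <;> simp <;> ring

theorem hessian_transpose {σ : Type*} (P : MvPolynomial σ ℝ) (v : σ → ℝ) :
    (hessian P v).transpose = hessian P v := by
  ext i j; simp [hessian, pderiv_pderiv_comm i j]

theorem hessForm_comm {σ : Type*} [Fintype σ] (P : MvPolynomial σ ℝ) (v x y : σ → ℝ) :
    hessForm P v x y = hessForm P v y x := by
  rw [hessForm, hessForm, Matrix.dotProduct_mulVec, ← Matrix.mulVec_transpose, hessian_transpose,
    dotProduct_comm]

section Homogeneous

variable {d : ℕ} {P : MvPolynomial (Fin 3) ℝ} (hP : P.IsHomogeneous d)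
include hP

theorem gradAt_dotProduct_self (u : Fin 3 → 𝕜) : gradAt P u ⬝ᵥ u = d * aeval u P := by
  have h := congrArg (aeval u) hP.sum_X_mul_pderiv
  simp only [map_sum, map_mul, aeval_X, nsmul_eq_mul, map_natCast] at h
  rw [← h]
  simp [dotProduct, gradAt, mul_comm]

theorem hessian_mulVec_self (v : Fin 3 → ℝ) :
    (hessian P v).mulVec v = ((d - 1 : ℕ) : ℝ) • gradAt P v := by
  ext i
  have h := gradAt_dotProduct_self (hP.pderiv (i := i)) v
  simp only [Matrix.mulVec, dotProduct, gradAt, aeval_eq_eval, hessian, Matrix.of_apply,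
    Pi.smul_apply, smul_eq_mul] at h ⊢
  rw [← h]
  simp [pderiv_pderiv_comm i]

theorem aeval_smul_of_isHomogeneous (c : 𝕜) (u : Fin 3 → 𝕜) :
    aeval (c • u) P = c ^ d * aeval u P := by
  simp only [aeval_def, eval₂_eq', Finset.mul_sum]
  refine Finset.sum_congr rfl fun e he => ?_
  have hd : e.degree = d := by
    by_contra h
    exact (mem_support_iff.1 he) (hP.coeff_eq_zero h)
  simp only [Pi.smul_apply, smul_eq_mul, mul_pow, Finset.prod_mul_distrib, Finset.prod_pow_eq_pow_sum]
  rw [← hd, Finsupp.degree_eq_sum]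
  ring

theorem gradAt_smul_point (c : 𝕜) (u : Fin 3 → 𝕜) :
    gradAt P (c • u) = c ^ (d - 1) • gradAt P u := by
  ext i
  simp [gradAt, aeval_smul_of_isHomogeneous hP.pderiv c u]

theorem hessian_smul_point (c : ℝ) (v : Fin 3 → ℝ) :
    hessian P (c • v) = c ^ (d - 1 - 1) • hessian P v := by
  ext i j
  simpa [hessian, aeval_eq_eval] using aeval_smul_of_isHomogeneous hP.pderiv.pderiv c v

end Homogeneous

/-- The linear form with given coefficients. -/
noncomputable def linForm (c : Fin 3 → ℝ) : MvPolynomial (Fin 3) ℝ := ∑ i, C (c i) * X i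

theorem linForm_isHomogeneous (c : Fin 3 → ℝ) : (linForm c).IsHomogeneous 1 :=
  IsHomogeneous.sum _ _ _ fun i _ => by
    simpa using (isHomogeneous_C _ (c i)).mul (isHomogeneous_X ℝ i)

theorem aeval_linForm (c : Fin 3 → ℝ) (u : Fin 3 → 𝕜) :
    aeval u (linForm c) = (fun i => algebraMap ℝ 𝕜 (c i)) ⬝ᵥ u := by
  simp [linForm, dotProduct]

@[simp] theorem eval_linForm (c v : Fin 3 → ℝ) : eval v (linForm c) = c ⬝ᵥ v := by
  simp [linForm, dotProduct]

@[simp] theorem gradAt_linForm (c : Fin 3 → ℝ) (u : Fin 3 → 𝕜) :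
    gradAt (linForm c) u = fun i => algebraMap ℝ 𝕜 (c i) := by
  ext i
  simp [gradAt, linForm, pderiv_X, Pi.single_apply]

@[simp] theorem hessForm_linForm (c v x y : Fin 3 → ℝ) : hessForm (linForm c) v x y = 0 := by
  have : hessian (linForm c) v = 0 := by
    ext i j
    simp [hessian, linForm, pderiv_X, Pi.single_apply, apply_ite]
  simp [hessForm, this]

/-! ### Forms with prescribed jets -/

theorem exists_form_of_isHomogeneous {d e : ℕ} {P : MvPolynomial (Fin 3) ℝ}
    (hP : P.IsHomogeneous e) (h : e = d) : ∃ F : RealForm d, (F : MvPolynomial (Fin 3) ℝ) = P :=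
  ⟨⟨P, h ▸ hP⟩, rfl⟩

/-- A real form with prescribed gradient at `v`, and vanishing to second order along the line `c`
not passing through `v`. -/
theorem exists_form_gradAt {d : ℕ} (hd : 1 ≤ d) {c v : Fin 3 → ℝ} (hc : c ⬝ᵥ v = 1)
    (ξ : Fin 3 → ℝ) : ∃ F : RealForm d, gradAt (F : MvPolynomial (Fin 3) ℝ) v = ξ ∧
      (3 ≤ d → ∀ w : Fin 3 → ℝ, c ⬝ᵥ w = 0 → gradAt (F : MvPolynomial (Fin 3) ℝ) w = 0) := by
  -- The gradient of (ξ - kc)·x (c·x)^(d-1) at v is ξ - kc + (d-1)(ξ·v - k)c; this `k` cancels the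
  -- multiples of c. For d ≥ 3 the power of c·x is at least the second, which gives the vanishing
  -- along the line.
  set k : ℝ := (d - 1) * (ξ ⬝ᵥ v) / d with hk
  obtain ⟨F, hF⟩ := exists_form_of_isHomogeneous (d := d)
    ((linForm_isHomogeneous (ξ - k • c)).mul ((linForm_isHomogeneous c).pow (d - 1))) (by omega)
  have hd0 : (d : ℝ) ≠ 0 := by positivity
  refine ⟨F, ?_, fun h3 w hw => ?_⟩
  · rw [hF, gradAt_mul, gradAt_pow]
    simp only [map_pow, aeval_eq_eval, eval_linForm, hc, one_pow, gradAt_linForm,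
      Algebra.algebraMap_self, RingHom.id_apply, sub_dotProduct, smul_dotProduct]
    ext i
    simp only [Pi.add_apply, Pi.smul_apply, Pi.sub_apply, smul_eq_mul, hk]
    rw [Nat.cast_sub hd]
    field_simp
    push_cast
    ring
  · rw [hF, gradAt_mul, gradAt_pow]
    simp only [map_pow, aeval_eq_eval, eval_linForm, hw]
    rw [zero_pow (by omega), zero_pow (by omega)]
    simp

theorem exists_dotProduct_eq_one {v : Fin 3 → ℝ} (hv : v ≠ 0) : ∃ c : Fin 3 → ℝ, c ⬝ᵥ v = 1 := by
  refine ⟨(v ⬝ᵥ v)⁻¹ • v, ?_⟩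
  rw [smul_dotProduct, smul_eq_mul, inv_mul_cancel₀]
  simpa using hv

/-- A real form with prescribed gradient at `v`, and with two prescribed second derivatives. -/
theorem exists_form_hessForm {d : ℕ} (hd : 2 ≤ d) {cv cw ce v w e : Fin 3 → ℝ}
    (hvv : cv ⬝ᵥ v = 1) (hwv : cw ⬝ᵥ v = 0) (hev : ce ⬝ᵥ v = 0) (hww : cw ⬝ᵥ w = 1)
    (hwe : cw ⬝ᵥ e = 0) (hew : ce ⬝ᵥ w = 0) (hee : ce ⬝ᵥ e = 1) (ξ : Fin 3 → ℝ) (α β : ℝ) :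
    ∃ F : RealForm d, gradAt (F : MvPolynomial (Fin 3) ℝ) v = ξ ∧
      hessForm (F : MvPolynomial (Fin 3) ℝ) v w w = α ∧
      hessForm (F : MvPolynomial (Fin 3) ℝ) v w e = β := by
  obtain ⟨F₁, h₁, -⟩ := exists_form_gradAt (d := d) (by omega) hvv ξ
  obtain ⟨F₂, h₂⟩ := exists_form_of_isHomogeneous (d := d)
    (((linForm_isHomogeneous cw).mul (linForm_isHomogeneous cw)).mul
      ((linForm_isHomogeneous cv).pow (d - 2))) (by omega)
  obtain ⟨F₃, h₃⟩ := exists_form_of_isHomogeneous (d := d)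
    (((linForm_isHomogeneous cw).mul (linForm_isHomogeneous ce)).mul
      ((linForm_isHomogeneous cv).pow (d - 2))) (by omega)
  have h1 : ∀ a b : Fin 3 → ℝ, (fun i => a i) ⬝ᵥ b = a ⬝ᵥ b := fun a b => rfl
  -- The two corrections have zero gradient at v, since cw and ce vanish there. The second
  -- differential of the first is 2 on (w, w), hence the division by two, and 0 on (w, e); that of
  -- the second is 0 on (w, w) and 1 on (w, e).
  refine ⟨F₁ + ((α - hessForm F₁ v w w) / 2) • F₂ + (β - hessForm F₁ v w e) • F₃, ?_, ?_, ?_⟩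
  · simp only [Submodule.coe_add, Submodule.coe_smul, h₂, h₃, gradAt_add, gradAt_smul, h₁,
      gradAt_mul, aeval_eq_eval, map_mul, eval_linForm, hwv, hev]
    simp
  all_goals
    simp only [Submodule.coe_add, Submodule.coe_smul, h₂, h₃, hessForm_add, hessForm_smul,
      hessForm_mul, gradAt_mul, aeval_eq_eval, map_mul, eval_linForm, hwv, hev, map_pow, hvv,
      hessForm_linForm, gradAt_linForm, Algebra.algebraMap_self, RingHom.id_apply]
    simp [h1, hww, hwe, hew, hee, dotProduct_comm w]
  ring

/-- A basis completing two independent vectors, with its dual basis. -/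
theorem exists_dual_basis {a b : Fin 3 → ℝ} (h : LinearIndependent ℝ ![a, b]) :
    ∃ e ca cb ce : Fin 3 → ℝ, ca ⬝ᵥ a = 1 ∧ ca ⬝ᵥ b = 0 ∧ ca ⬝ᵥ e = 0 ∧
      cb ⬝ᵥ a = 0 ∧ cb ⬝ᵥ b = 1 ∧ cb ⬝ᵥ e = 0 ∧ ce ⬝ᵥ a = 0 ∧ ce ⬝ᵥ b = 0 ∧ ce ⬝ᵥ e = 1 ∧
      ∀ i j, ca i * a j + cb i * b j + ce i * e j = if i = j then 1 else 0 := by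
  let e := crossProduct a b
  let M : Matrix (Fin 3) (Fin 3) ℝ := Matrix.of ![a, b, e]
  have hM : IsUnit M.det := by
    have h1 : e ⬝ᵥ e = M.det := by
      rw [triple_product_permutation]
      exact triple_product_eq_det a b e
    rw [← h1, isUnit_iff_ne_zero]
    simpa using crossProduct_ne_zero_iff_linearIndependent.2 h
  have h1 := Matrix.mul_nonsing_inv M hM
  have h2 := Matrix.nonsing_inv_mul M hM
  have h3 : ∀ i j, M i ⬝ᵥ (fun k => M⁻¹ k j) = if i = j then 1 else 0 := fun i j => by
    rw [← Matrix.one_apply, ← h1]; rfl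
  refine ⟨e, fun k => M⁻¹ k 0, fun k => M⁻¹ k 1, fun k => M⁻¹ k 2, ?_, ?_, ?_, ?_, ?_, ?_, ?_, ?_,
    ?_, fun i j => ?_⟩
  · rw [dotProduct_comm]; exact h3 0 0
  · rw [dotProduct_comm]; exact h3 1 0
  · rw [dotProduct_comm]; exact h3 2 0
  · rw [dotProduct_comm]; exact h3 0 1
  · rw [dotProduct_comm]; exact h3 1 1
  · rw [dotProduct_comm]; exact h3 2 1
  · rw [dotProduct_comm]; exact h3 0 2
  · rw [dotProduct_comm]; exact h3 1 2
  · rw [dotProduct_comm]; exact h3 2 2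
  have := congrFun (congrFun h2 i) j
  rw [Matrix.mul_apply, Fin.sum_univ_three, Matrix.one_apply] at this
  exact this

end Forms

/-! ### Real forms with prescribed jets at nonreal points -/

section ComplexJets

/-- A complex vector which is not proportional to a real one. -/
def IsNonreal (u : Fin 3 → ℂ) : Prop :=
  LinearIndependent ℝ ![fun i => (u i).re, fun i => (u i).im]

/-- The covectors annihilating u = a + ib form a complex plane. If ca, cb, ce are dual to a basis
beginning with a, b, this plane contains ce, and also ca + i cb because 1 + i² = 0. -/
theorem IsNonreal.exists_dual_basis {u : Fin 3 → ℂ} (h : IsNonreal u) :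
    ∃ ca cb ce : Fin 3 → ℝ, aeval u (linForm ca) = 1 ∧
      aeval u (linForm cb) = Complex.I ∧ aeval u (linForm ce) = 0 ∧
      ∀ ξ : Fin 3 → ℂ, ξ ⬝ᵥ u = 0 → ∃ α β : ℂ,
        ξ = α • (fun i => (ce i : ℂ)) + β • fun i => (ca i : ℂ) + Complex.I * cb i := by
  obtain ⟨e, ca, cb, ce, haa, hab, -, hba, hbb, -, hea, heb, -, H⟩ := _root_.exists_dual_basis h
  have key : ∀ c : Fin 3 → ℝ, aeval u (linForm c) = ((c ⬝ᵥ fun i => (u i).re : ℝ) : ℂ) +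
      ((c ⬝ᵥ fun i => (u i).im : ℝ) : ℂ) * Complex.I := fun c => by
    rw [aeval_linForm]
    apply Complex.ext <;> simp [dotProduct]
  refine ⟨ca, cb, ce, ?_, ?_, ?_, fun ξ hξ => ⟨ξ ⬝ᵥ fun i => (e i : ℂ),
    ξ ⬝ᵥ fun i => ((u i).re : ℂ), ?_⟩⟩
  · simp [key, haa, hab]
  · simp [key, hba, hbb]
  · simp [key, hea, heb]
  · have h1 : (ξ ⬝ᵥ fun i => ((u i).im : ℂ)) = Complex.I * ξ ⬝ᵥ fun i => ((u i).re : ℂ) := by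
      have h2 : ξ ⬝ᵥ u = (ξ ⬝ᵥ fun i => ((u i).re : ℂ)) +
          Complex.I * ξ ⬝ᵥ fun i => ((u i).im : ℂ) := by
        simp only [dotProduct, Finset.mul_sum, ← Finset.sum_add_distrib]
        refine Finset.sum_congr rfl fun i _ => ?_
        conv_lhs => rw [← Complex.re_add_im (u i)]
        ring
      rw [hξ] at h2
      linear_combination Complex.I * h2 + (ξ ⬝ᵥ fun i => ((u i).im : ℂ)) * Complex.I_mul_I
    ext i
    have h3 : ξ i = ∑ j, ξ j * (ca i * (u j).re + cb i * (u j).im + ce i * e j : ℂ) := by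
      have : ∀ j, (ca i * (u j).re + cb i * (u j).im + ce i * e j : ℂ) =
          if i = j then 1 else 0 := fun j => by
        have := H i j
        split_ifs at this ⊢ <;> exact_mod_cast this
      simp [this]
    have h4 : ξ i = ca i * (ξ ⬝ᵥ fun i => ((u i).re : ℂ)) + cb i * (ξ ⬝ᵥ fun i => ((u i).im : ℂ))
        + ce i * ξ ⬝ᵥ fun i => (e i : ℂ) := by
      conv_lhs => rw [h3]
      simp only [dotProduct, Fin.sum_univ_three]
      ring
    rw [h4, h1]
    simp only [Pi.add_apply, Pi.smul_apply, smul_eq_mul]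
    ring

/-- A real form with prescribed value at a nonreal point. -/
theorem exists_form_aeval_complex {d : ℕ} (hd : 1 ≤ d) {u : Fin 3 → ℂ} (h : IsNonreal u) (z : ℂ) :
    ∃ F : RealForm d, aeval u (F : MvPolynomial (Fin 3) ℝ) = z := by
  obtain ⟨ca, cb, -, h1, h2, -, -⟩ := h.exists_dual_basis
  obtain ⟨F₁, hF₁⟩ := exists_form_of_isHomogeneous (d := d)
    ((linForm_isHomogeneous ca).pow d) (by omega)
  obtain ⟨F₂, hF₂⟩ := exists_form_of_isHomogeneous (d := d)
    ((linForm_isHomogeneous cb).mul ((linForm_isHomogeneous ca).pow (d - 1))) (by omega)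
  refine ⟨z.re • F₁ + z.im • F₂, ?_⟩
  simp only [Submodule.coe_add, Submodule.coe_smul, map_add, map_smul, hF₁, hF₂, map_mul, map_pow,
    h1, h2]
  simp [Complex.re_add_im]

/-- A real form with prescribed gradient at a nonreal point. -/
theorem exists_form_gradAt_complex {d : ℕ} (hd : 3 ≤ d) {u : Fin 3 → ℂ} (h : IsNonreal u)
    (ξ : Fin 3 → ℂ) : ∃ F : RealForm d, gradAt (F : MvPolynomial (Fin 3) ℝ) u = ξ := by
  obtain ⟨F₀, h₀⟩ := exists_form_aeval_complex (d := d) (by omega) h ((ξ ⬝ᵥ u) / d)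
  obtain ⟨ca, cb, ce, h1, h2, h3, H⟩ := h.exists_dual_basis
  have hd0 : (d : ℂ) ≠ 0 := by exact_mod_cast (by omega : d ≠ 0)
  -- `F₀` has at u the value required by Euler's relation, so the missing part of the gradient
  -- annihilates u and equals α ce + β (ca + i cb). The first term is the gradient of ce R. The
  -- second is that of (ca² + cb²) R', because ca² + cb² vanishes at u. The factor R' must have
  -- positive degree, whence d ≥ 3.
  obtain ⟨α, β, hαβ⟩ := H (ξ - gradAt F₀ u) (by
    rw [sub_dotProduct, gradAt_dotProduct_self F₀.2, h₀]; field_simp; ring)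
  obtain ⟨R, hR⟩ := exists_form_aeval_complex (d := d - 1) (by omega) h α
  obtain ⟨R', hR'⟩ := exists_form_aeval_complex (d := d - 2) (by omega) h (β / 2)
  obtain ⟨F₁, hF₁⟩ := exists_form_of_isHomogeneous (d := d)
    ((linForm_isHomogeneous ce).mul R.2) (by omega)
  obtain ⟨F₂, hF₂⟩ := exists_form_of_isHomogeneous (d := d)
    ((((linForm_isHomogeneous ca).pow 2).add ((linForm_isHomogeneous cb).pow 2)).mul R'.2)
    (by omega)
  refine ⟨F₀ + F₁ + F₂, ?_⟩
  rw [sub_eq_iff_eq_add'.1 hαβ]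
  simp only [Submodule.coe_add, gradAt_add, hF₁, hF₂, gradAt_mul, hR, hR', map_add, map_pow, h1, h2,
    h3, gradAt_pow, gradAt_linForm]
  ext i
  simp
  ring_nf

end ComplexJets

/-! ### Coordinates in the space of forms -/

section Coordinates

open Module

instance realForm_finite (d : ℕ) : Module.Finite ℝ (RealForm d) :=
  Module.Finite.iff_fg.2 (homogeneousSubmodule_fg (σ := Fin 3) (R := ℝ) d)

instance realForm_nontrivial (d : ℕ) : Nontrivial (RealForm d) := by
  refine ⟨⟨⟨X 0 ^ d, by simpa using (isHomogeneous_X ℝ (0 : Fin 3)).pow d⟩, 0, fun h => ?_⟩⟩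
  have := congrArg Subtype.val h
  exact pow_ne_zero d (X_ne_zero (0 : Fin 3)) this

/-- The space of coordinates of forms of degree `d` in some basis. -/
abbrev FormSpace (d : ℕ) : Type := Fin (finrank ℝ (RealForm d)) → ℝ

/-- The form with given coordinates. -/
noncomputable def toForm (d : ℕ) : FormSpace d ≃ₗ[ℝ] RealForm d :=
  (finBasis ℝ (RealForm d)).equivFun.symm

instance formSpace_nontrivial (d : ℕ) : Nontrivial (FormSpace d) :=
  (toForm d).toEquiv.nontrivial

end Coordinates

/-! ### Smooth dependence of jets on the point -/

section Smoothness

variable {𝕜 : Type*} [NormedField 𝕜] [NormedAlgebra ℝ 𝕜]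
  {E : Type*} [NormedAddCommGroup E] [NormedSpace ℝ E] {n : WithTop ℕ∞}

theorem ContDiff.mvPolynomial_aeval {u : E → Fin 3 → 𝕜} (hu : ContDiff ℝ n u)
    (P : MvPolynomial (Fin 3) ℝ) : ContDiff ℝ n (fun e => aeval (u e) P) := by
  induction P using MvPolynomial.induction_on with
  | C a => simpa using contDiff_const
  | add p q hp hq => simpa using hp.add hq
  | mul_X p k hp => simpa using hp.mul (contDiff_pi.1 hu k)

theorem ContDiff.gradAt {u : E → Fin 3 → 𝕜} (hu : ContDiff ℝ n u)
    (P : MvPolynomial (Fin 3) ℝ) : ContDiff ℝ n (fun e => gradAt P (u e)) :=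
  contDiff_pi.2 fun i => hu.mvPolynomial_aeval (pderiv i P)

theorem ContDiff.hessForm {v x y : E → Fin 3 → ℝ} (hv : ContDiff ℝ n v) (hx : ContDiff ℝ n x)
    (hy : ContDiff ℝ n y) (P : MvPolynomial (Fin 3) ℝ) :
    ContDiff ℝ n (fun e => hessForm P (v e) (x e) (y e)) := by
  simp only [_root_.hessForm, dotProduct, Matrix.mulVec, hessian, Matrix.of_apply, ← aeval_eq_eval]
  refine ContDiff.sum fun i _ => (contDiff_pi.1 hx i).mul (ContDiff.sum fun j _ => ?_)
  exact (hv.mvPolynomial_aeval _).mul (contDiff_pi.1 hy j)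

end Smoothness

/-! ### Normalized coordinates of points and flags -/

section Charts

variable {𝕜 : Type*} [Field 𝕜]

/-- A point in one of the affine charts of the projective plane. -/
def chartPoint (σ : Equiv.Perm (Fin 3)) (a b : 𝕜) : Fin 3 → 𝕜 := fun i => ![1, a, b] (σ i)

/-- A direction in one of the affine charts of the projective plane. -/
def chartDir (σ : Equiv.Perm (Fin 3)) (s : 𝕜) : Fin 3 → 𝕜 := fun i => ![0, 1, s] (σ i)

theorem chartPoint_ne_zero (σ : Equiv.Perm (Fin 3)) (a b : 𝕜) : chartPoint σ a b ≠ 0 := fun h => by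
  simpa [chartPoint] using congrFun h (σ.symm 0)

/-- A flag has three parameters: rescaling v and replacing w by μw + νv do not change it.
Subtracting a multiple of v from w kills coordinate i, and a remaining nonzero coordinate j selects
the chart. -/
theorem exists_chartFlag_of_ne_zero {v w : Fin 3 → 𝕜} (h : LinearIndependent 𝕜 ![v, w]) {i : Fin 3}
    (hi : v i ≠ 0) : ∃ (σ : Equiv.Perm (Fin 3)) (a b s μ ν : 𝕜), μ ≠ 0 ∧
      v = v i • chartPoint σ a b ∧ w = μ • chartDir σ s + ν • chartPoint σ a b := by
  have hw : w - (w i / v i) • v ≠ 0 := fun h0 => by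
    have := LinearIndependent.pair_iff.1 h (-(w i / v i)) 1 (by rw [← h0]; module)
    exact one_ne_zero this.2
  obtain ⟨j, hj⟩ := Function.ne_iff.1 hw
  have hji : j ≠ i := by
    rintro rfl
    apply hj
    simp [hi]
  obtain ⟨σ, rfl, rfl⟩ : ∃ σ : Equiv.Perm (Fin 3), σ.symm 0 = i ∧ σ.symm 1 = j := by
    revert hji; clear hj hw hi; revert i j; decide
  simp only [Pi.sub_apply, Pi.smul_apply, smul_eq_mul, Pi.zero_apply] at hj
  refine ⟨σ, v (σ.symm 1) / v (σ.symm 0), v (σ.symm 2) / v (σ.symm 0),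
    (w (σ.symm 2) - w (σ.symm 0) / v (σ.symm 0) * v (σ.symm 2)) /
      (w (σ.symm 1) - w (σ.symm 0) / v (σ.symm 0) * v (σ.symm 1)),
    w (σ.symm 1) - w (σ.symm 0) / v (σ.symm 0) * v (σ.symm 1), w (σ.symm 0), hj, ?_, ?_⟩
  · ext l
    obtain ⟨l, rfl⟩ := σ.symm.surjective l
    fin_cases l <;> simp [chartPoint, mul_div_cancel₀, hi]
  · ext l
    obtain ⟨l, rfl⟩ := σ.symm.surjective l
    fin_cases l
    · simp [chartPoint, chartDir]
    · simp [chartPoint, chartDir]; ring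
    · simp [chartPoint, chartDir, mul_div_cancel₀, hj]; ring

theorem exists_chartFlag {v w : Fin 3 → 𝕜} (h : LinearIndependent 𝕜 ![v, w]) :
    ∃ (σ : Equiv.Perm (Fin 3)) (a b s c μ ν : 𝕜), c ≠ 0 ∧ μ ≠ 0 ∧ v = c • chartPoint σ a b ∧
      w = μ • chartDir σ s + ν • chartPoint σ a b := by
  obtain ⟨i, hi⟩ := Function.ne_iff.1 (h.ne_zero 0)
  obtain ⟨σ, a, b, s, μ, ν, H⟩ := exists_chartFlag_of_ne_zero h hi
  exact ⟨σ, a, b, s, v i, μ, ν, hi, H⟩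

theorem exists_chartPoint {u : Fin 3 → 𝕜} (hu : u ≠ 0) :
    ∃ (σ : Equiv.Perm (Fin 3)) (a b c : 𝕜), c ≠ 0 ∧ u = c • chartPoint σ a b := by
  obtain ⟨i, hi⟩ := Function.ne_iff.1 hu
  rw [Pi.zero_apply] at hi
  refine ⟨Equiv.swap i 0, u ((Equiv.swap i 0).symm 1) / u i, u ((Equiv.swap i 0).symm 2) / u i, u i,
    hi, ?_⟩
  ext l
  obtain ⟨l, rfl⟩ := (Equiv.swap i 0).symm.surjective l
  fin_cases l <;> simp [chartPoint, mul_div_cancel₀, hi]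

/-- The dual frame that `exists_form_hessForm` requires, at a flag in a chart. -/
theorem exists_chart_dual (σ : Equiv.Perm (Fin 3)) (a b s : ℝ) : ∃ e cv cw ce : Fin 3 → ℝ,
    e = (fun i => ![0, 0, 1] (σ i)) ∧
    cv ⬝ᵥ chartPoint σ a b = 1 ∧ cw ⬝ᵥ chartPoint σ a b = 0 ∧ ce ⬝ᵥ chartPoint σ a b = 0 ∧
    cw ⬝ᵥ chartDir σ s = 1 ∧ cw ⬝ᵥ e = 0 ∧ ce ⬝ᵥ chartDir σ s = 0 ∧ ce ⬝ᵥ e = 1 := by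
  have key : ∀ x y : Fin 3 → ℝ, (fun i => x (σ i)) ⬝ᵥ (fun i => y (σ i)) = x ⬝ᵥ y :=
    fun x y => Equiv.sum_comp σ fun i => x i * y i
  refine ⟨_, fun i => ![1, 0, 0] (σ i), fun i => ![-a, 1, 0] (σ i),
    fun i => ![a * s - b, -s, 1] (σ i), rfl, ?_⟩
  unfold chartPoint chartDir
  simp only [key, Matrix.vec3_dotProduct]
  simp
  ring

section
variable {𝕜 : Type*} [NormedField 𝕜] [NormedAlgebra ℝ 𝕜]
  {E : Type*} [NormedAddCommGroup E] [NormedSpace ℝ E] {n : WithTop ℕ∞}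

theorem ContDiff.chartPoint (σ : Equiv.Perm (Fin 3)) {a b : E → 𝕜} (ha : ContDiff ℝ n a)
    (hb : ContDiff ℝ n b) : ContDiff ℝ n (fun e => chartPoint σ (a e) (b e)) := by
  refine contDiff_pi.2 fun i => ?_
  simp only [_root_.chartPoint]
  generalize σ i = j
  fin_cases j
  exacts [contDiff_const, ha, hb]

theorem ContDiff.chartDir (σ : Equiv.Perm (Fin 3)) {s : E → 𝕜} (hs : ContDiff ℝ n s) :
    ContDiff ℝ n (fun e => chartDir σ (s e)) := by
  refine contDiff_pi.2 fun i => ?_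
  simp only [_root_.chartDir]
  generalize σ i = j
  fin_cases j
  exacts [contDiff_const, contDiff_const, hs]
end

end Charts

/-! ### Real points among the complex points -/

section Nonreal

theorem exists_real_of_not_isNonreal {u : Fin 3 → ℂ} (h : ¬ IsNonreal u) :
    ∃ (z : ℂ) (v : Fin 3 → ℝ), u = z • fun i => (v i : ℂ) := by
  rw [IsNonreal, LinearIndependent.pair_iff] at h
  push Not at h
  obtain ⟨s, t, hst, hne⟩ := h
  have hpos : s ^ 2 + t ^ 2 ≠ 0 := by
    intro h0
    have hs : s = 0 := by nlinarith [sq_nonneg s, sq_nonneg t]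
    exact hne hs (by nlinarith [sq_nonneg s, sq_nonneg t])
  -- If s Re u + t Im u = 0, then (s² + t²) u = (t - is)(t Re u - s Im u).
  refine ⟨⟨t / (s ^ 2 + t ^ 2), -s / (s ^ 2 + t ^ 2)⟩, fun i => t * (u i).re - s * (u i).im, ?_⟩
  ext i
  have hi : s * (u i).re + t * (u i).im = 0 := congrFun hst i
  apply Complex.ext
  · simp only [Pi.smul_apply, smul_eq_mul, Complex.re_mul_ofReal]
    field_simp
    linear_combination s * hi
  · simp only [Pi.smul_apply, smul_eq_mul, Complex.im_mul_ofReal]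
    field_simp
    linear_combination t * hi

theorem IsNonreal.of_smul {u : Fin 3 → ℂ} {c : ℂ} (h : IsNonreal (c • u)) : IsNonreal u := by
  by_contra hu
  obtain ⟨z, v, rfl⟩ := exists_real_of_not_isNonreal hu
  rw [smul_smul] at h
  have h1 := LinearIndependent.pair_iff.1 h (-(c * z).im) (c * z).re (by
    ext i; simp only [Pi.add_apply, Pi.smul_apply, smul_eq_mul, Complex.re_mul_ofReal,
      Complex.im_mul_ofReal, Pi.zero_apply]; ring)
  have h2 : c * z = 0 := Complex.ext h1.2 (neg_eq_zero.1 h1.1)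
  apply h.ne_zero 0
  ext i
  simp [h2]

end Nonreal

theorem finrank_complex_three : Module.finrank ℝ (Fin 3 → ℂ) = 6 := by
  rw [Module.finrank_pi_fintype]; simp [Complex.finrank_real_complex]

theorem linearIndependent_pair_of_smul {𝕜 : Type*} [Field 𝕜] {v w : Fin 3 → 𝕜} {c c' : 𝕜}
    (h : LinearIndependent 𝕜 ![c • v, c' • w]) : LinearIndependent 𝕜 ![v, w] := by
  have hc : c ≠ 0 := fun h0 => h.ne_zero 0 (by simp [h0])
  have hc' : c' ≠ 0 := fun h0 => h.ne_zero 1 (by simp [h0])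
  refine LinearIndependent.pair_iff.2 fun s t hst => ?_
  have := LinearIndependent.pair_iff.1 h (s / c) (t / c')
    (by rw [smul_smul, smul_smul, div_mul_cancel₀ _ hc, div_mul_cancel₀ _ hc', hst])
  simpa [hc, hc'] using this

/-! ### Forms of degree at most two, and prescribed values -/

section Constant

variable {𝕜 : Type*} [Field 𝕜] [Algebra ℝ 𝕜]

theorem aeval_eq_algebraMap_of_isHomogeneous_zero {P : MvPolynomial (Fin 3) ℝ}
    (hP : P.IsHomogeneous 0) (u : Fin 3 → 𝕜) (v : Fin 3 → ℝ) :
    aeval u P = algebraMap ℝ 𝕜 (eval v P) := by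
  rw [totalDegree_eq_zero_iff_eq_C.1 ((totalDegree_zero_iff_isHomogeneous _).2 hP)]
  simp

theorem gradAt_eq_of_isHomogeneous_one {P : MvPolynomial (Fin 3) ℝ}
    (hP : P.IsHomogeneous 1) (u : Fin 3 → 𝕜) (v : Fin 3 → ℝ) :
    gradAt P u = fun i => algebraMap ℝ 𝕜 (gradAt P v i) := by
  ext i
  rw [gradAt, gradAt, aeval_eq_eval]
  exact aeval_eq_algebraMap_of_isHomogeneous_zero hP.pderiv u v

theorem hessian_mulVec_of_isHomogeneous_two {P : MvPolynomial (Fin 3) ℝ}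
    (hP : P.IsHomogeneous 2) (v w : Fin 3 → ℝ) : (hessian P v).mulVec w = gradAt P w := by
  have h : hessian P v = hessian P w := by
    ext i j
    have := aeval_eq_algebraMap_of_isHomogeneous_zero ((hP.pderiv (i := j)).pderiv (i := i)) v w
    simpa [hessian, aeval_eq_eval] using this
  rw [h, hessian_mulVec_self hP]
  simp

/-- A real form with prescribed value at `v`. -/
theorem exists_form_eval {d : ℕ} (hd : 1 ≤ d) {v : Fin 3 → ℝ} (hv : v ≠ 0) (z : ℝ) :
    ∃ F : RealForm d, eval v (F : MvPolynomial (Fin 3) ℝ) = z := by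
  obtain ⟨c, hc⟩ := exists_dotProduct_eq_one hv
  obtain ⟨F, hF, -⟩ := exists_form_gradAt hd hc ((d * z) • c)
  refine ⟨F, ?_⟩
  have h := gradAt_dotProduct_self F.2 v
  have hd0 : (d : ℝ) ≠ 0 := by positivity
  rw [hF, smul_dotProduct, hc, aeval_eq_eval] at h
  simpa [hd0] using h.symm

end Constant

/-! ### Avoidable degenerations of one curve -/

section Single

open Module

variable {W : Type*} [NormedAddCommGroup W] [NormedSpace ℝ W] [FiniteDimensional ℝ W] [Nontrivial W]
  {γ : ℝ → W} (hγ : ContDiff ℝ 2 γ) {d : ℕ} (f : W →ₗ[ℝ] RealForm d)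
  (hf : Function.Surjective f)
include hγ hf

/-- Three parameters of the flag (v, w) and time, against five equations: at a singular point the
Hessian kills v, so only its values on (w, w) and (w, e) have to be added to the gradient. -/
theorem isAvoidable_degenerate_hessian (hd : 2 ≤ d) :
    IsAvoidable γ (fun x _ => ∃ v w : Fin 3 → ℝ, LinearIndependent ℝ ![v, w] ∧
      gradAt (f x).1 v = 0 ∧ (hessian (f x).1 v).mulVec w = 0) := by
  have key : ∀ σ : Equiv.Perm (Fin 3), IsAvoidable γ (fun x y => ∃ e ∈ (univ : Set (ℝ × ℝ × ℝ)),
      (gradAt (f x).1 (chartPoint σ e.1 e.2.1),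
        hessForm (f x).1 (chartPoint σ e.1 e.2.1) (chartDir σ e.2.2) (chartDir σ e.2.2),
        hessForm (f x).1 (chartPoint σ e.1 e.2.1) (chartDir σ e.2.2) (fun i => ![0, 0, 1] (σ i)))
      = 0) := by
    intro σ
    refine isAvoidable_of_linear hγ _ (fun e => ⟨fun x y => by simp, fun c x => by simp⟩)
      (fun x y => ?_) univ (fun e _ τ => ?_) (by simp)
    · have h1 : ContDiff ℝ 1 fun e : ℝ × ℝ × ℝ => chartPoint σ e.1 e.2.1 :=
        ContDiff.chartPoint σ (by fun_prop) (by fun_prop)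
      have h2 : ContDiff ℝ 1 fun e : ℝ × ℝ × ℝ => chartDir σ e.2.2 :=
        ContDiff.chartDir σ (by fun_prop)
      exact (h1.gradAt _).prodMk ((h1.hessForm h2 h2 _).prodMk (h1.hessForm h2 contDiff_const _))
    · obtain ⟨_, cv, cw, ce, rfl, h1, h2, h3, h4, h5, h6, h7⟩ :=
        exists_chart_dual σ e.1 e.2.1 e.2.2
      obtain ⟨F, h8, h9, h10⟩ := exists_form_hessForm hd h1 h2 h3 h4 h5 h6 h7 τ.1 τ.2.1 τ.2.2
      obtain ⟨x, rfl⟩ := hf F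
      exact ⟨x, 0, by rw [h8, h9, h10]⟩
  refine (IsAvoidable.exists key).mono fun x _ => ?_
  rintro ⟨v, w, hvw, hv, hw⟩
  obtain ⟨σ, a, b, s, c, μ, ν, hc, hμ, rfl, rfl⟩ := exists_chartFlag hvw
  rw [gradAt_smul_point (f x).2, smul_eq_zero_iff_right (pow_ne_zero _ hc)] at hv
  rw [hessian_smul_point (f x).2, Matrix.smul_mulVec, smul_eq_zero_iff_right (pow_ne_zero _ hc),
    Matrix.mulVec_add, Matrix.mulVec_smul, Matrix.mulVec_smul, hessian_mulVec_self (f x).2, hv,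
    smul_zero, smul_zero, add_zero, smul_eq_zero_iff_right hμ] at hw
  refine ⟨σ, (a, b, s), mem_univ _, ?_⟩
  have h1 : ∀ y, hessForm (f x).1 (chartPoint σ a b) (chartDir σ s) y = 0 := fun y => by
    rw [hessForm_comm, hessForm, hw, dotProduct_zero]
  simp [hv, h1]

/-- Four real parameters and time, against six real equations. In degree two these are not
independent, since the pairing of the gradient at u with the conjugate of u is real. -/
theorem isAvoidable_nonreal_singular (hd : 3 ≤ d) :
    IsAvoidable γ (fun x _ => ∃ u : Fin 3 → ℂ, IsNonreal u ∧ gradAt (f x).1 u = 0) := by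
  have key : ∀ σ : Equiv.Perm (Fin 3), IsAvoidable γ (fun x y =>
      ∃ e ∈ {e : ℂ × ℂ | IsNonreal (chartPoint σ e.1 e.2)},
      gradAt (f x).1 (chartPoint σ e.1 e.2) = 0) := by
    intro σ
    refine isAvoidable_of_linear hγ _ (fun e => ⟨fun x y => by simp, fun c x => by simp⟩)
      (fun x y => ?_) _ (fun e he τ => ?_) (by simp [finrank_complex_three])
    · exact (ContDiff.chartPoint σ contDiff_fst contDiff_snd).gradAt _
    · obtain ⟨F, hF⟩ := exists_form_gradAt_complex hd he τ
      obtain ⟨x, rfl⟩ := hf F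
      exact ⟨x, 0, hF⟩
  refine (IsAvoidable.exists key).mono fun x _ => ?_
  rintro ⟨u, hu, h⟩
  obtain ⟨σ, a, b, c, hc, rfl⟩ := exists_chartPoint (u := u) (fun h0 => by
    apply hu.ne_zero 0; ext i; simp [h0])
  rw [gradAt_smul_point (f x).2, smul_eq_zero_iff_right (pow_ne_zero _ hc)] at h
  exact ⟨σ, (a, b), hu.of_smul, h⟩

/-- Four parameters and time, against six equations. Independence comes from a form with prescribed
gradient at one point and vanishing to second order along a line through the other, which needs d ≥
3. -/
theorem isAvoidable_two_singular (hd : 3 ≤ d) :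
    IsAvoidable γ (fun x _ => ∃ v w : Fin 3 → ℝ, LinearIndependent ℝ ![v, w] ∧
      gradAt (f x).1 v = 0 ∧ gradAt (f x).1 w = 0) := by
  have key : ∀ σ : Equiv.Perm (Fin 3) × Equiv.Perm (Fin 3), IsAvoidable γ (fun x y =>
      ∃ e ∈ {e : (ℝ × ℝ) × (ℝ × ℝ) |
        LinearIndependent ℝ ![chartPoint σ.1 e.1.1 e.1.2, chartPoint σ.2 e.2.1 e.2.2]},
      (gradAt (f x).1 (chartPoint σ.1 e.1.1 e.1.2), gradAt (f x).1 (chartPoint σ.2 e.2.1 e.2.2))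
        = 0) := by
    intro σ
    refine isAvoidable_of_linear hγ _ (fun e => ⟨fun x y => by simp, fun c x => by simp⟩)
      (fun x y => ?_) _ (fun e he τ => ?_) (by simp)
    · have h1 : ContDiff ℝ 1 fun e : (ℝ × ℝ) × (ℝ × ℝ) => chartPoint σ.1 e.1.1 e.1.2 :=
        ContDiff.chartPoint σ.1 (by fun_prop) (by fun_prop)
      have h2 : ContDiff ℝ 1 fun e : (ℝ × ℝ) × (ℝ × ℝ) => chartPoint σ.2 e.2.1 e.2.2 :=
        ContDiff.chartPoint σ.2 (by fun_prop) (by fun_prop)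
      exact (h1.gradAt _).prodMk (h2.gradAt _)
    · obtain ⟨_, ca, cb, _, h1, h2, -, h3, h4, -⟩ := exists_dual_basis he
      obtain ⟨F, hF, hF0⟩ := exists_form_gradAt (d := d) (by omega) h1 τ.1
      obtain ⟨G, hG, hG0⟩ := exists_form_gradAt (d := d) (by omega) h4 τ.2
      obtain ⟨x, hx⟩ := hf (F + G)
      refine ⟨x, 0, ?_⟩
      simp [hx, hF, hG, hF0 hd _ h2, hG0 hd _ h3]
  refine (IsAvoidable.exists key).mono fun x _ => ?_
  rintro ⟨v, w, hvw, hv, hw⟩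
  obtain ⟨σ, a, b, c, hc, rfl⟩ := exists_chartPoint (hvw.ne_zero 0 : v ≠ 0)
  obtain ⟨σ', a', b', c', hc', rfl⟩ := exists_chartPoint (hvw.ne_zero 1 : w ≠ 0)
  rw [gradAt_smul_point (f x).2, smul_eq_zero_iff_right (pow_ne_zero _ hc)] at hv
  rw [gradAt_smul_point (f x).2, smul_eq_zero_iff_right (pow_ne_zero _ hc')] at hw
  refine ⟨(σ, σ'), ((a, b), (a', b')), linearIndependent_pair_of_smul hvw, ?_⟩
  simp [hv, hw]

/-- Two parameters and time, against three equations on the value and one on the velocity. This is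
transversality to the discriminant. -/
theorem isAvoidable_stationary_singular (hd : 1 ≤ d) :
    IsAvoidable γ (fun x y => ∃ v : Fin 3 → ℝ, v ≠ 0 ∧
      gradAt (f x).1 v = 0 ∧ eval v (f y).1 = 0) := by
  have key : ∀ σ : Equiv.Perm (Fin 3), IsAvoidable γ (fun x y => ∃ e ∈ (univ : Set (ℝ × ℝ)),
      (gradAt (f x).1 (chartPoint σ e.1 e.2), aeval (chartPoint σ e.1 e.2) (f y).1) = 0) := by
    intro σ
    refine isAvoidable_of_linear hγ _ (fun e => ⟨fun x y => by simp, fun c x => by simp⟩)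
      (fun x y => ?_) _ (fun e he τ => ?_) (by simp)
    · have h1 := ContDiff.chartPoint (𝕜 := ℝ) (n := 1) σ
        (contDiff_fst (𝕜 := ℝ) (E := ℝ) (F := ℝ)) contDiff_snd
      exact (h1.gradAt _).prodMk (h1.mvPolynomial_aeval _)
    · obtain ⟨c, hc⟩ := exists_dotProduct_eq_one (chartPoint_ne_zero σ e.1 e.2)
      obtain ⟨F, hF, -⟩ := exists_form_gradAt (d := d) (by omega) hc τ.1
      obtain ⟨G, hG⟩ := exists_form_eval (d := d) (by omega) (chartPoint_ne_zero σ e.1 e.2) τ.2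
      obtain ⟨x, rfl⟩ := hf F
      obtain ⟨y, rfl⟩ := hf G
      exact ⟨x, y, by rw [hF, aeval_eq_eval, hG]⟩
  refine (IsAvoidable.exists key).mono fun x y => ?_
  rintro ⟨v, hv0, hv, hw⟩
  obtain ⟨σ, a, b, c, hc, rfl⟩ := exists_chartPoint hv0
  rw [gradAt_smul_point (f x).2, smul_eq_zero_iff_right (pow_ne_zero _ hc)] at hv
  rw [← aeval_eq_eval, aeval_smul_of_isHomogeneous (f y).2, mul_eq_zero,
    or_iff_right (pow_ne_zero _ hc)] at hw
  exact ⟨σ, (a, b), mem_univ _, by simp [hv, hw]⟩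

end Single

/-! ### Avoidable degenerations of a pair of curves -/

section Pair

open Module

variable {W : Type*} [NormedAddCommGroup W] [NormedSpace ℝ W] [FiniteDimensional ℝ W] [Nontrivial W]
  {γ : ℝ → W} (hγ : ContDiff ℝ 2 γ) {m n : ℕ} (f : W →ₗ[ℝ] RealForm m) (g : W →ₗ[ℝ] RealForm n)
  (hfg : ∀ F G, ∃ x, f x = F ∧ g x = G)
include hγ hfg

/-- Two parameters and time, against four equations. -/
theorem isAvoidable_singular_mem (hm : 1 ≤ m) (hn : 1 ≤ n) :
    IsAvoidable γ (fun x _ => ∃ v : Fin 3 → ℝ, v ≠ 0 ∧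
      gradAt (f x).1 v = 0 ∧ eval v (g x).1 = 0) := by
  have key : ∀ σ : Equiv.Perm (Fin 3), IsAvoidable γ (fun x y => ∃ e ∈ (univ : Set (ℝ × ℝ)),
      (gradAt (f x).1 (chartPoint σ e.1 e.2), aeval (chartPoint σ e.1 e.2) (g x).1) = 0) := by
    intro σ
    refine isAvoidable_of_linear hγ _ (fun e => ⟨fun x y => by simp, fun c x => by simp⟩)
      (fun x y => ?_) _ (fun e he τ => ?_) (by simp)
    · have h1 := ContDiff.chartPoint (𝕜 := ℝ) (n := 1) σ
        (contDiff_fst (𝕜 := ℝ) (E := ℝ) (F := ℝ)) contDiff_snd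
      exact (h1.gradAt _).prodMk (h1.mvPolynomial_aeval _)
    · obtain ⟨c, hc⟩ := exists_dotProduct_eq_one (chartPoint_ne_zero σ e.1 e.2)
      obtain ⟨F, hF, -⟩ := exists_form_gradAt (d := m) (by omega) hc τ.1
      obtain ⟨G, hG⟩ := exists_form_eval (d := n) (by omega) (chartPoint_ne_zero σ e.1 e.2) τ.2
      obtain ⟨x, rfl, rfl⟩ := hfg F G
      exact ⟨x, 0, by rw [hF, aeval_eq_eval, hG]⟩
  refine (IsAvoidable.exists key).mono fun x y => ?_
  rintro ⟨v, hv0, hv, hw⟩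
  obtain ⟨σ, a, b, c, hc, rfl⟩ := exists_chartPoint hv0
  rw [gradAt_smul_point (f x).2, smul_eq_zero_iff_right (pow_ne_zero _ hc)] at hv
  rw [← aeval_eq_eval, aeval_smul_of_isHomogeneous (g x).2, mul_eq_zero,
    or_iff_right (pow_ne_zero _ hc)] at hw
  exact ⟨σ, (a, b), mem_univ _, by simp [hv, hw]⟩

/-- Three complex parameters, the point and c, and real time: seven real parameters against eight
real equations. That u lies on the first curve follows by Euler's relation from the equations. -/
theorem isAvoidable_nonreal_tangency (hm : 3 ≤ m) (hn : 1 ≤ n) :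
    IsAvoidable γ (fun x _ => ∃ (u : Fin 3 → ℂ) (c : ℂ), IsNonreal u ∧
      gradAt (f x).1 u = c • gradAt (g x).1 u ∧ aeval u (g x).1 = 0) := by
  have key : ∀ σ : Equiv.Perm (Fin 3), IsAvoidable γ (fun x y =>
      ∃ e ∈ {e : ℂ × ℂ × ℂ | IsNonreal (chartPoint σ e.1 e.2.1)},
      (gradAt (f x).1 (chartPoint σ e.1 e.2.1) - e.2.2 • gradAt (g x).1 (chartPoint σ e.1 e.2.1),
        aeval (chartPoint σ e.1 e.2.1) (g x).1) = 0) := by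
    intro σ
    refine isAvoidable_of_linear hγ _ (fun e => ⟨fun x y => ?_, fun c x => ?_⟩)
      (fun x y => ?_) _ (fun e he τ => ?_) (by simp [finrank_complex_three])
    · simp; abel
    · simp [smul_sub, smul_comm e.2.2 c]
    · have h1 : ContDiff ℝ 1 fun e : ℂ × ℂ × ℂ => chartPoint σ e.1 e.2.1 :=
        ContDiff.chartPoint σ (by fun_prop) (by fun_prop)
      have h2 : ContDiff ℝ 1 fun e : ℂ × ℂ × ℂ => e.2.2 := by fun_prop
      exact ((h1.gradAt _).sub (h2.smul (h1.gradAt _))).prodMk (h1.mvPolynomial_aeval _)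
    · obtain ⟨G, hG⟩ := exists_form_aeval_complex (d := n) (by omega) he τ.2
      obtain ⟨F, hF⟩ := exists_form_gradAt_complex hm he
        (τ.1 + e.2.2 • gradAt G.1 (chartPoint σ e.1 e.2.1))
      obtain ⟨x, rfl, rfl⟩ := hfg F G
      exact ⟨x, 0, by rw [hF, hG, add_sub_cancel_right]⟩
  refine (IsAvoidable.exists key).mono fun x _ => ?_
  rintro ⟨u, k, hu, h, h'⟩
  obtain ⟨σ, a, b, c, hc, rfl⟩ := exists_chartPoint (u := u) (fun h0 => by
    apply hu.ne_zero 0; ext i; simp [h0])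
  rw [gradAt_smul_point (f x).2, gradAt_smul_point (g x).2] at h
  rw [aeval_smul_of_isHomogeneous (g x).2, mul_eq_zero, or_iff_right (pow_ne_zero _ hc)] at h'
  refine ⟨σ, (a, b, (c ^ (m - 1))⁻¹ * k * c ^ (n - 1)), hu.of_smul, ?_⟩
  have h1 : gradAt (f x).1 (chartPoint σ a b) =
      ((c ^ (m - 1))⁻¹ * k * c ^ (n - 1)) • gradAt (g x).1 (chartPoint σ a b) := by
    rw [mul_assoc, mul_smul, mul_smul, ← h, inv_smul_smul₀ (pow_ne_zero _ hc)]
  simp [h1, h']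

/-- Four parameters (the flag and c) and time, against six equations. -/
theorem isAvoidable_degenerate_tangency (hm : 2 ≤ m) (hn : 1 ≤ n) :
    IsAvoidable γ (fun x _ => ∃ (v w : Fin 3 → ℝ) (i : Fin 3) (c : ℝ), v i = 1 ∧
      LinearIndependent ℝ ![v, w] ∧ gradAt (f x).1 v = c • gradAt (g x).1 v ∧
      eval v (g x).1 = 0 ∧ gradAt (g x).1 v ⬝ᵥ w = 0 ∧
      hessForm (f x).1 v w w = c * hessForm (g x).1 v w w) := by
  have key : ∀ σ : Equiv.Perm (Fin 3), IsAvoidable γ (fun x y =>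
      ∃ e ∈ (univ : Set (ℝ × ℝ × ℝ × ℝ)),
      (gradAt (f x).1 (chartPoint σ e.1 e.2.1) - e.2.2.2 • gradAt (g x).1 (chartPoint σ e.1 e.2.1),
        aeval (chartPoint σ e.1 e.2.1) (g x).1,
        gradAt (g x).1 (chartPoint σ e.1 e.2.1) ⬝ᵥ chartDir σ e.2.2.1,
        hessForm (f x).1 (chartPoint σ e.1 e.2.1) (chartDir σ e.2.2.1) (chartDir σ e.2.2.1) -
        e.2.2.2 *
        hessForm (g x).1 (chartPoint σ e.1 e.2.1) (chartDir σ e.2.2.1) (chartDir σ e.2.2.1)) = 0) := by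
    intro σ
    refine isAvoidable_of_linear hγ _ (fun e => ⟨fun x y => ?_, fun c x => ?_⟩)
      (fun x y => ?_) _ (fun e he τ => ?_) (by simp)
    · simp only [Prod.fst_add, map_add, Submodule.coe_add, gradAt_add, smul_add, add_dotProduct,
        hessForm_add, Prod.mk_add_mk, Prod.mk.injEq]
      refine ⟨by abel, trivial, trivial, by ring⟩
    · simp only [Prod.smul_fst, map_smul, Submodule.coe_smul, gradAt_smul, smul_dotProduct,
        hessForm_smul, Prod.smul_mk, Prod.mk.injEq, smul_sub, smul_comm e.2.2.2 c, smul_eq_mul]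
      refine ⟨trivial, trivial, trivial, by ring⟩
    · have h1 : ContDiff ℝ 1 fun e : ℝ × ℝ × ℝ × ℝ => chartPoint σ e.1 e.2.1 :=
        ContDiff.chartPoint σ (by fun_prop) (by fun_prop)
      have h2 : ContDiff ℝ 1 fun e : ℝ × ℝ × ℝ × ℝ => chartDir σ e.2.2.1 :=
        ContDiff.chartDir σ (by fun_prop)
      have h3 : ContDiff ℝ 1 fun e : ℝ × ℝ × ℝ × ℝ => e.2.2.2 := by fun_prop
      refine ((h1.gradAt _).sub (h3.smul (h1.gradAt _))).prodMk ((h1.mvPolynomial_aeval _).prodMk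
        (ContDiff.prodMk ?_ ((h1.hessForm h2 h2 _).sub (h3.mul (h1.hessForm h2 h2 _)))))
      exact ContDiff.sum fun i _ => (contDiff_pi.1 (h1.gradAt _) i).mul (contDiff_pi.1 h2 i)
    · obtain ⟨_, cv, cw, ce, rfl, h1, h2, h3, h4, h5, h6, h7⟩ :=
        exists_chart_dual σ e.1 e.2.1 e.2.2.1
      -- By Euler's relation the gradient of G must pair with the point to n times the prescribed
      -- value. The corresponding multiple of cv contributes μ on the direction w, which the
      -- multiple of cw compensates.
      obtain ⟨μ, hμ⟩ : ∃ μ : ℝ, μ = ((n : ℝ) * τ.2.1) * cv ⬝ᵥ chartDir σ e.2.2.1 := ⟨_, rfl⟩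
      obtain ⟨G, hG, -⟩ := exists_form_gradAt (d := n) hn h1
        (((n : ℝ) * τ.2.1) • cv + (τ.2.2.1 - μ) • cw)
      obtain ⟨F, h8, h9, -⟩ := exists_form_hessForm hm h1 h2 h3 h4 h5 h6 h7
        (τ.1 + e.2.2.2 • gradAt G.1 (chartPoint σ e.1 e.2.1))
        (τ.2.2.2 + e.2.2.2 *
          hessForm G.1 (chartPoint σ e.1 e.2.1) (chartDir σ e.2.2.1) (chartDir σ e.2.2.1)) 0
      have h10 := gradAt_dotProduct_self G.2 (chartPoint σ e.1 e.2.1)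
      have hn0 : (n : ℝ) ≠ 0 := by positivity
      rw [hG, add_dotProduct, smul_dotProduct, smul_dotProduct, h1, h2] at h10
      have h11 : aeval (chartPoint σ e.1 e.2.1) G.1 = τ.2.1 := by
        simpa [hn0] using h10.symm
      have h12 : gradAt G.1 (chartPoint σ e.1 e.2.1) ⬝ᵥ chartDir σ e.2.2.1 = τ.2.2.1 := by
        rw [hG, add_dotProduct, smul_dotProduct, smul_dotProduct, h4, smul_eq_mul, ← hμ]
        simp
      obtain ⟨x, rfl, rfl⟩ := hfg F G
      exact ⟨x, 0, by rw [h8, h9, h11, h12, add_sub_cancel_right, add_sub_cancel_right]⟩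
  refine (IsAvoidable.exists key).mono fun x _ => ?_
  rintro ⟨v, w, i, c, hi, hvw, h1, h2, h3, h4⟩
  -- Since `v i = 1`, the vector v is its own chart point. A rescaling of v would change c when the
  -- degrees differ.
  obtain ⟨σ, a, b, s, μ, ν, hμ, hv, rfl⟩ := exists_chartFlag_of_ne_zero hvw (hi ▸ one_ne_zero)
  rw [hi, one_smul] at hv
  subst hv
  have h5 : ∀ {d : ℕ} (F : RealForm d), gradAt F.1 (chartPoint σ a b) ⬝ᵥ chartPoint σ a b =
      d * eval (chartPoint σ a b) F.1 := fun F => by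
    rw [gradAt_dotProduct_self F.2, aeval_eq_eval]
  have h6 : gradAt (g x).1 (chartPoint σ a b) ⬝ᵥ chartDir σ s = 0 := by
    rw [dotProduct_add, dotProduct_smul, dotProduct_smul, h5, h2] at h3
    simpa [hμ] using h3
  have h7 : gradAt (g x).1 (chartPoint σ a b) ⬝ᵥ chartPoint σ a b = 0 := by rw [h5, h2, mul_zero]
  -- Adding a multiple of v to the direction does not matter: the Hessian sends v to a multiple of
  -- the gradient, which here kills both v and the direction.
  have h8 : ∀ {d : ℕ} (F : RealForm d) (k : ℝ),
      gradAt F.1 (chartPoint σ a b) = k • gradAt (g x).1 (chartPoint σ a b) →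
      hessForm F.1 (chartPoint σ a b) (μ • chartDir σ s + ν • chartPoint σ a b)
        (μ • chartDir σ s + ν • chartPoint σ a b) =
        μ * μ * hessForm F.1 (chartPoint σ a b) (chartDir σ s) (chartDir σ s) := by
    intro d F k hk
    have h9 : ∀ y, y = chartDir σ s ∨ y = chartPoint σ a b →
        hessForm F.1 (chartPoint σ a b) y (chartPoint σ a b) = 0 := by
      rintro y hy
      rw [hessForm, hessian_mulVec_self F.2, hk, dotProduct_comm, smul_dotProduct, smul_dotProduct]
      rcases hy with rfl | rfl
      · rw [h6]; simp
      · rw [h7]; simp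
    have h10 := hessForm_comm F.1 (chartPoint σ a b) (chartPoint σ a b) (chartDir σ s)
    rw [h9 _ (Or.inl rfl)] at h10
    have h11 := h9 _ (Or.inl rfl)
    have h12 := h9 _ (Or.inr rfl)
    simp only [hessForm, Matrix.mulVec_add, Matrix.mulVec_smul, dotProduct_add, add_dotProduct,
      dotProduct_smul, smul_dotProduct, smul_eq_mul] at h10 h11 h12 ⊢
    rw [h10, h11, h12]
    ring
  rw [h8 _ _ h1, h8 (g x) 1 (by rw [one_smul])] at h4
  refine ⟨σ, (a, b, s, c), mem_univ _, ?_⟩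
  have h9 : hessForm (f x).1 (chartPoint σ a b) (chartDir σ s) (chartDir σ s) =
      c * hessForm (g x).1 (chartPoint σ a b) (chartDir σ s) (chartDir σ s) := by
    apply mul_left_cancel₀ (mul_ne_zero hμ hμ)
    linear_combination h4
  simp [h1, h2, h6, h9, aeval_eq_eval]

/-- One parameter c and time, against three equations. It serves for pairs of lines, whose gradients
are constant, so that one fixed point is enough. -/
theorem isAvoidable_proportional (hm : 1 ≤ m) (v : Fin 3 → ℝ) (hv : v ≠ 0) :
    IsAvoidable γ (fun x _ => ∃ c : ℝ, gradAt (f x).1 v = c • gradAt (g x).1 v) := by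
  have key : IsAvoidable γ (fun x y => ∃ c ∈ (univ : Set ℝ),
      gradAt (f x).1 v - c • gradAt (g x).1 v = 0) := by
    refine isAvoidable_of_linear hγ _ (fun e => ⟨fun x y => ?_, fun c x => ?_⟩)
      (fun x y => ?_) _ (fun e he τ => ?_) (by simp)
    · simp; abel
    · simp [smul_sub, smul_comm e c]
    · fun_prop
    · obtain ⟨c, hc⟩ := exists_dotProduct_eq_one hv
      obtain ⟨F, hF, -⟩ := exists_form_gradAt (d := m) (by omega) hc τ
      obtain ⟨x, hx, hx'⟩ := hfg F 0
      exact ⟨x, 0, by simp [hx, hx', hF]⟩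
  exact key.mono fun x _ ⟨c, hc⟩ => ⟨c, mem_univ _, sub_eq_zero.2 hc⟩

omit hγ hfg in
-- Some member F - cG of the pencil of conics has rank at most one. The parameters are c, the two of
-- the kernel plane, and time; a symmetric matrix of order three killing a given plane satisfies
-- five equations.
theorem isAvoidable_double_line (hγ : ContDiff ℝ 2 γ) (f g : W →ₗ[ℝ] RealForm 2)
    (hfg : ∀ F G, ∃ x, f x = F ∧ g x = G) :
    IsAvoidable γ (fun x _ => ∃ (v w : Fin 3 → ℝ) (c : ℝ), LinearIndependent ℝ ![v, w] ∧
      gradAt (f x).1 v = c • gradAt (g x).1 v ∧ gradAt (f x).1 w = c • gradAt (g x).1 w) := by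
  have key : ∀ σ : Equiv.Perm (Fin 3), IsAvoidable γ (fun x y => ∃ e ∈ (univ : Set (ℝ × ℝ × ℝ)),
      (gradAt ((f - e.1 • g) x).1 (chartPoint σ 0 e.2.1),
        hessForm ((f - e.1 • g) x).1 (chartPoint σ 0 e.2.1) (chartDir σ e.2.2) (chartDir σ e.2.2),
        hessForm ((f - e.1 • g) x).1 (chartPoint σ 0 e.2.1) (chartDir σ e.2.2)
          (fun i => ![0, 0, 1] (σ i))) = 0) := by
    intro σ
    have hsub : ∀ (x : W) (c : ℝ), ((f - c • g) x).1 = (f x).1 + (-c) • (g x).1 := fun x c => by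
      rw [neg_smul, ← sub_eq_add_neg]; rfl
    refine isAvoidable_of_linear hγ _ (fun e => ⟨fun x y => ?_, fun c x => ?_⟩)
      (fun x y => ?_) univ (fun e _ τ => ?_) (by simp)
    · simp only [Prod.fst_add, map_add, Submodule.coe_add, gradAt_add, hessForm_add,
        Prod.mk_add_mk]
    · simp only [Prod.smul_fst, map_smul, Submodule.coe_smul, gradAt_smul, hessForm_smul,
        Prod.smul_mk, smul_eq_mul]
    · have h1 : ContDiff ℝ 1 fun e : ℝ × ℝ × ℝ => chartPoint σ (0 : ℝ) e.2.1 :=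
        ContDiff.chartPoint σ (by fun_prop) (by fun_prop)
      have h2 : ContDiff ℝ 1 fun e : ℝ × ℝ × ℝ => chartDir σ e.2.2 :=
        ContDiff.chartDir σ (by fun_prop)
      have h3 : ContDiff ℝ 1 fun e : ℝ × ℝ × ℝ => -e.1 := by fun_prop
      simp only [hsub, gradAt_add, gradAt_smul, hessForm_add, hessForm_smul]
      exact ((h1.gradAt _).add (h3.smul (h1.gradAt _))).prodMk
        (((h1.hessForm h2 h2 _).add (h3.mul (h1.hessForm h2 h2 _))).prodMk
        ((h1.hessForm h2 contDiff_const _).add (h3.mul (h1.hessForm h2 contDiff_const _))))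
    · obtain ⟨_, cv, cw, ce, rfl, h1, h2, h3, h4, h5, h6, h7⟩ :=
        exists_chart_dual σ 0 e.2.1 e.2.2
      obtain ⟨F, h8, h9, h10⟩ := exists_form_hessForm le_rfl h1 h2 h3 h4 h5 h6 h7 τ.1 τ.2.1 τ.2.2
      obtain ⟨x, rfl, hx⟩ := hfg F 0
      refine ⟨x, 0, ?_⟩
      have h11 : (f - e.1 • g) x = f x := by simp [hx]
      rw [h11, h8, h9, h10]
  refine (IsAvoidable.exists key).mono fun x _ => ?_
  rintro ⟨v, w, k, hvw, hv, hw⟩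
  obtain ⟨σ, a, b, s, c, μ, ν, hc, hμ, rfl, rfl⟩ := exists_chartFlag hvw
  set M := (f - k • g) x with hM
  have hM' : ∀ v, gradAt (f x).1 v = k • gradAt (g x).1 v → (hessian M.1 0).mulVec v = 0 := by
    intro v h
    have h1 : M.1 = (f x).1 + (-k) • (g x).1 := by rw [neg_smul, ← sub_eq_add_neg]; rfl
    rw [hessian_mulVec_of_isHomogeneous_two M.2, h1, gradAt_add, gradAt_smul, h]
    simp
  have h1 : (hessian M.1 0).mulVec (chartPoint σ a b) = 0 := by
    have := hM' _ hv
    rwa [Matrix.mulVec_smul, smul_eq_zero_iff_right hc] at this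
  have h2 : (hessian M.1 0).mulVec (chartDir σ s) = 0 := by
    have := hM' _ hw
    rwa [Matrix.mulVec_add, Matrix.mulVec_smul, Matrix.mulVec_smul, h1, smul_zero, add_zero,
      smul_eq_zero_iff_right hμ] at this
  -- The kernel plane contains many flags; taking the one whose point has a = 0 reduces its
  -- parameters from three to two.
  have h3 : chartPoint σ 0 (b - a * s) = chartPoint σ a b - a • chartDir σ s := by
    ext i
    simp only [chartPoint, chartDir, Pi.sub_apply, Pi.smul_apply]
    generalize σ i = j
    fin_cases j <;> simp
  refine ⟨σ, (k, b - a * s, s), mem_univ _, ?_⟩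
  have h4 : gradAt M.1 (chartPoint σ 0 (b - a * s)) = 0 := by
    rw [← hessian_mulVec_of_isHomogeneous_two M.2 0, h3, Matrix.mulVec_sub, Matrix.mulVec_smul, h1,
      h2, smul_zero, sub_zero]
  have h5 : ∀ y, hessForm M.1 (chartPoint σ 0 (b - a * s)) (chartDir σ s) y = 0 := fun y => by
    rw [hessForm_comm, hessForm, hessian_mulVec_of_isHomogeneous_two M.2,
      ← hessian_mulVec_of_isHomogeneous_two M.2 0, h2, dotProduct_zero]
  rw [← hM, h4, h5, h5]
  rfl

end Pair

/-! ### Generic forms and generic pairs of forms -/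

section Generic

open Module

/-- The conditions on a form `F`, moving with velocity `F'`, that hold along a generic path. -/
structure IsGenericForm {d : ℕ} (F F' : RealForm d) : Prop where
  hessian_ne : 2 ≤ d → ¬ ∃ v w : Fin 3 → ℝ, LinearIndependent ℝ ![v, w] ∧
      gradAt F.1 v = 0 ∧ (hessian F.1 v).mulVec w = 0
  nonreal : 3 ≤ d → ¬ ∃ u : Fin 3 → ℂ, IsNonreal u ∧ gradAt F.1 u = 0
  unique : 3 ≤ d → ¬ ∃ v w : Fin 3 → ℝ, LinearIndependent ℝ ![v, w] ∧
      gradAt F.1 v = 0 ∧ gradAt F.1 w = 0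
  velocity : ¬ ∃ v : Fin 3 → ℝ, v ≠ 0 ∧ gradAt F.1 v = 0 ∧ eval v F'.1 = 0

/-- The conditions on a pair of forms `F`, `G` that hold along a generic path, and which concern
the mutual position of the two curves. -/
structure IsGenericPair {m n : ℕ} (F : RealForm m) (G : RealForm n) : Prop where
  node_left : ¬ ∃ v : Fin 3 → ℝ, v ≠ 0 ∧ gradAt F.1 v = 0 ∧ eval v G.1 = 0
  node_right : ¬ ∃ v : Fin 3 → ℝ, v ≠ 0 ∧ gradAt G.1 v = 0 ∧ eval v F.1 = 0
  nonreal_left : 3 ≤ m → ¬ ∃ (u : Fin 3 → ℂ) (c : ℂ), IsNonreal u ∧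
      gradAt F.1 u = c • gradAt G.1 u ∧ aeval u G.1 = 0
  nonreal_right : 3 ≤ n → ¬ ∃ (u : Fin 3 → ℂ) (c : ℂ), IsNonreal u ∧
      gradAt G.1 u = c • gradAt F.1 u ∧ aeval u F.1 = 0
  tangency_left : 2 ≤ m → ¬ ∃ (v w : Fin 3 → ℝ) (i : Fin 3) (c : ℝ), v i = 1 ∧
      LinearIndependent ℝ ![v, w] ∧ gradAt F.1 v = c • gradAt G.1 v ∧
      eval v G.1 = 0 ∧ gradAt G.1 v ⬝ᵥ w = 0 ∧ hessForm F.1 v w w = c * hessForm G.1 v w w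
  tangency_right : 2 ≤ n → ¬ ∃ (v w : Fin 3 → ℝ) (i : Fin 3) (c : ℝ), v i = 1 ∧
      LinearIndependent ℝ ![v, w] ∧ gradAt G.1 v = c • gradAt F.1 v ∧
      eval v F.1 = 0 ∧ gradAt F.1 v ⬝ᵥ w = 0 ∧ hessForm G.1 v w w = c * hessForm F.1 v w w
  lines : ¬ ∃ c : ℝ, gradAt F.1 (chartPoint 1 0 0 : Fin 3 → ℝ) = c • gradAt G.1 (chartPoint 1 0 0)
  conics : m = 2 → n = 2 → ¬ ∃ (v w : Fin 3 → ℝ) (c : ℝ), LinearIndependent ℝ ![v, w] ∧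
      gradAt F.1 v = c • gradAt G.1 v ∧ gradAt F.1 w = c • gradAt G.1 w

variable {W : Type*} [NormedAddCommGroup W] [NormedSpace ℝ W] [FiniteDimensional ℝ W] [Nontrivial W]
  {γ : ℝ → W}

theorem IsAvoidable.of_imp {p : Prop} {Q : W → W → Prop} (h : p → IsAvoidable γ Q) :
    IsAvoidable γ (fun x y => p ∧ Q x y) := by
  by_cases hp : p
  · exact (h hp).mono fun x y hQ => hQ.2
  · exact (isAvoidable_false γ).mono fun x y hQ => hp hQ.1

theorem isAvoidable_not_isGenericForm (hγ : ContDiff ℝ 2 γ) {d : ℕ} (hd : 1 ≤ d)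
    (f : W →ₗ[ℝ] RealForm d) (hf : Function.Surjective f) :
    IsAvoidable γ (fun x y => ¬ IsGenericForm (f x) (f y)) := by
  refine ((IsAvoidable.of_imp (isAvoidable_degenerate_hessian hγ f hf)).or
    ((IsAvoidable.of_imp (isAvoidable_nonreal_singular hγ f hf)).or
    ((IsAvoidable.of_imp (isAvoidable_two_singular hγ f hf)).or
    (isAvoidable_stationary_singular hγ f hf hd)))).mono fun x y h => ?_
  by_contra H
  simp only [not_or] at H
  obtain ⟨h1, h2, h3, h4⟩ := H
  exact h ⟨fun hd hx => h1 ⟨hd, hx⟩, fun hd hx => h2 ⟨hd, hx⟩, fun hd hx => h3 ⟨hd, hx⟩, h4⟩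

theorem isAvoidable_not_isGenericPair (hγ : ContDiff ℝ 2 γ) {m n : ℕ} (hm : 1 ≤ m) (hn : 1 ≤ n)
    (f : W →ₗ[ℝ] RealForm m) (g : W →ₗ[ℝ] RealForm n) (hfg : ∀ F G, ∃ x, f x = F ∧ g x = G) :
    IsAvoidable γ (fun x _ => ¬ IsGenericPair (f x) (g x)) := by
  have hgf : ∀ G F, ∃ x, g x = G ∧ f x = F := fun G F => (hfg F G).imp fun x hx => hx.symm
  have h2 : m = 2 → n = 2 → IsAvoidable γ (fun x _ => ∃ (v w : Fin 3 → ℝ) (c : ℝ),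
      LinearIndependent ℝ ![v, w] ∧ gradAt (f x).1 v = c • gradAt (g x).1 v ∧
      gradAt (f x).1 w = c • gradAt (g x).1 w) := by
    rintro rfl rfl
    exact isAvoidable_double_line hγ f g hfg
  refine ((isAvoidable_singular_mem hγ f g hfg hm hn).or
    ((isAvoidable_singular_mem hγ g f hgf hn hm).or
    ((IsAvoidable.of_imp fun h => isAvoidable_nonreal_tangency hγ f g hfg h hn).or
    ((IsAvoidable.of_imp fun h => isAvoidable_nonreal_tangency hγ g f hgf h hm).or
    ((IsAvoidable.of_imp fun h => isAvoidable_degenerate_tangency hγ f g hfg h hn).or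
    ((IsAvoidable.of_imp fun h => isAvoidable_degenerate_tangency hγ g f hgf h hm).or
    ((isAvoidable_proportional hγ f g hfg hm _ (chartPoint_ne_zero 1 0 0)).or
    (IsAvoidable.of_imp fun h => IsAvoidable.of_imp fun h' => h2 h h')))))))).mono fun x y h => ?_
  by_contra H
  simp only [not_or] at H
  obtain ⟨h1, h2, h3, h4, h5, h6, h7, h8⟩ := H
  exact h ⟨h1, h2, fun hd hx => h3 ⟨hd, hx⟩, fun hd hx => h4 ⟨hd, hx⟩, fun hd hx => h5 ⟨hd, hx⟩,
    fun hd hx => h6 ⟨hd, hx⟩, h7, fun hm hn hx => h8 ⟨hm, hn, hx⟩⟩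

end Generic

/-! ### Singular points of generic forms -/

section GenericForm

variable {d : ℕ} {F F' : RealForm d}

theorem gradAt_ofReal (P : MvPolynomial (Fin 3) ℝ) (v : Fin 3 → ℝ) :
    gradAt P (fun i => (v i : ℂ)) = fun i => ((gradAt P v i : ℝ) : ℂ) := by
  ext i
  rw [gradAt, gradAt]
  exact (aeval_algebraMap_apply ℂ v (pderiv i P))

theorem gradAt_ofReal_eq_zero {P : MvPolynomial (Fin 3) ℝ} {v : Fin 3 → ℝ} :
    gradAt P (fun i => (v i : ℂ)) = 0 ↔ gradAt P v = 0 := by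
  rw [gradAt_ofReal]
  simp [funext_iff]

theorem aeval_ofReal (P : MvPolynomial (Fin 3) ℝ) (v : Fin 3 → ℝ) :
    aeval (fun i => (v i : ℂ)) P = (eval v P : ℂ) := by
  rw [← aeval_eq_eval]
  exact aeval_algebraMap_apply ℂ v P

/-- The real and imaginary parts of the gradient of a quadratic form. -/
theorem gradAt_complex_of_isHomogeneous_two {P : MvPolynomial (Fin 3) ℝ} (hP : P.IsHomogeneous 2)
    (u : Fin 3 → ℂ) (i : Fin 3) : gradAt P u i =
      gradAt P (fun j => (u j).re) i + Complex.I * gradAt P (fun j => (u j).im) i := by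
  have h1 : (pderiv i P).IsHomogeneous 1 := hP.pderiv
  obtain ⟨ξ, hξ⟩ : ∃ ξ : Fin 3 → ℝ, ξ = gradAt (pderiv i P) 0 := ⟨_, rfl⟩
  have h2 : ∀ v : Fin 3 → ℝ, gradAt P v i = ξ ⬝ᵥ v := fun v => by
    have := gradAt_dotProduct_self h1 v
    rw [gradAt_eq_of_isHomogeneous_one h1 v 0, ← hξ] at this
    simpa [gradAt] using this.symm
  have h3 : gradAt P u i = (fun j => (ξ j : ℂ)) ⬝ᵥ u := by
    have := gradAt_dotProduct_self h1 u
    rw [gradAt_eq_of_isHomogeneous_one h1 u 0, ← hξ] at this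
    simpa [gradAt] using this.symm
  rw [h2, h2, h3]
  apply Complex.ext <;> simp [dotProduct]

theorem gradAt_eq_zero_of_dependent {P : MvPolynomial (Fin 3) ℝ} (hP : P.IsHomogeneous 2)
    {u : Fin 3 → ℂ} (h : gradAt P u = 0) :
    gradAt P (fun j => (u j).re) = 0 ∧ gradAt P (fun j => (u j).im) = 0 := by
  constructor <;> ext i
  all_goals
    have h1 := gradAt_complex_of_isHomogeneous_two hP u i
    rw [h] at h1
  · simpa using (congrArg Complex.re h1).symm
  · simpa using (congrArg Complex.im h1).symm

theorem exists_ne_zero_eval_eq_zero (F' : RealForm 1) :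
    ∃ v : Fin 3 → ℝ, v ≠ 0 ∧ eval v F'.1 = 0 := by
  let ξ := gradAt F'.1 (0 : Fin 3 → ℝ)
  have h : ∀ v : Fin 3 → ℝ, eval v F'.1 = ξ ⬝ᵥ v := fun v => by
    have := gradAt_dotProduct_self F'.2 v
    rw [gradAt_eq_of_isHomogeneous_one F'.2 v 0, aeval_eq_eval] at this
    simpa using this.symm
  by_cases h0 : ξ 0 = 0
  · exact ⟨![1, 0, 0], by simp, by rw [h]; simp [dotProduct, Fin.sum_univ_three, h0]⟩
  · exact ⟨![-ξ 1, ξ 0, 0], by simp [h0], by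
      rw [h]; simp [dotProduct, Fin.sum_univ_three]; ring⟩

namespace IsGenericForm

variable (hd : 1 ≤ d) (h : IsGenericForm F F')
include hd h

/-- A linear form with zero gradient is zero, so all real points are singular, and the velocity,
itself linear, vanishes at one of them. -/
theorem gradAt_ne_zero_of_eq_one (h1 : d = 1) (u : Fin 3 → ℂ) : gradAt F.1 u ≠ 0 := by
  subst h1
  intro hu
  obtain ⟨v, hv, hv'⟩ := exists_ne_zero_eval_eq_zero F'
  rw [gradAt_eq_of_isHomogeneous_one F.2 u v] at hu
  exact h.velocity ⟨v, hv, by ext i; simpa using congrFun hu i, hv'⟩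

/-- In degree two, where `nonreal` says nothing, the real and imaginary parts of a nonreal singular
point both lie in the kernel of the quadratic form, contradicting `hessian_ne`. -/
theorem exists_real {u : Fin 3 → ℂ} (hu : gradAt F.1 u = 0) :
    ∃ (z : ℂ) (v : Fin 3 → ℝ), u = z • fun i => (v i : ℂ) := by
  apply exists_real_of_not_isNonreal
  intro hn
  rcases (by omega : d = 1 ∨ d = 2 ∨ 3 ≤ d) with h1 | h2 | h3
  · exact h.gradAt_ne_zero_of_eq_one hd h1 u hu
  · subst h2
    obtain ⟨ha, hb⟩ := gradAt_eq_zero_of_dependent F.2 hu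
    refine h.hessian_ne le_rfl ⟨_, _, hn, ha, ?_⟩
    rw [hessian_mulVec_of_isHomogeneous_two F.2, hb]
  · exact h.nonreal h3 ⟨u, hn, hu⟩

theorem not_linearIndependent {v w : Fin 3 → ℝ} (hv : gradAt F.1 v = 0) (hw : gradAt F.1 w = 0) :
    ¬ LinearIndependent ℝ ![v, w] := by
  intro hvw
  rcases (by omega : d = 1 ∨ d = 2 ∨ 3 ≤ d) with h1 | h2 | h3
  · exact h.gradAt_ne_zero_of_eq_one hd h1 _ (gradAt_ofReal_eq_zero.2 hv)
  · subst h2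
    refine h.hessian_ne le_rfl ⟨_, _, hvw, hv, ?_⟩
    rw [hessian_mulVec_of_isHomogeneous_two F.2, hw]
  · exact h.unique h3 ⟨v, w, hvw, hv, hw⟩

theorem exists_smul_eq {v w : Fin 3 → ℝ} (hv0 : v ≠ 0) (hv : gradAt F.1 v = 0)
    (hw : gradAt F.1 w = 0) : ∃ c : ℝ, w = c • v := by
  have h1 := h.not_linearIndependent hd hv hw
  by_contra! H
  exact h1 ((LinearIndependent.pair_iff' hv0).2 fun a ha => H a ha.symm)

theorem mulVec_eq_zero {v w : Fin 3 → ℝ} (hv0 : v ≠ 0) (hv : gradAt F.1 v = 0)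
    (hw : (hessian F.1 v).mulVec w = 0) : ∃ c : ℝ, w = c • v := by
  rcases (by omega : d = 1 ∨ 2 ≤ d) with h1 | h2
  · exact absurd (gradAt_ofReal_eq_zero.2 hv) (h.gradAt_ne_zero_of_eq_one hd h1 _)
  · by_contra! H
    exact h.hessian_ne h2 ⟨v, w, (LinearIndependent.pair_iff' hv0).2 fun a ha => H a ha.symm, hv, hw⟩

theorem rank_hessian {v : Fin 3 → ℝ} (hv0 : v ≠ 0) (hv : gradAt F.1 v = 0) :
    (hessian F.1 v).rank = 2 := by
  have h1 : LinearMap.ker (hessian F.1 v).mulVecLin = Submodule.span ℝ {v} := by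
    ext w
    rw [LinearMap.mem_ker, Matrix.mulVecLin_apply, Submodule.mem_span_singleton]
    constructor
    · intro hw
      obtain ⟨c, hc⟩ := h.mulVec_eq_zero hd hv0 hv hw
      exact ⟨c, hc.symm⟩
    · rintro ⟨c, rfl⟩
      rw [Matrix.mulVec_smul, hessian_mulVec_self F.2, hv, smul_zero, smul_zero]
  have h2 := (hessian F.1 v).mulVecLin.finrank_range_add_finrank_ker
  rw [h1, finrank_span_singleton hv0] at h2
  simp only [Module.finrank_fintype_fun_eq_card, Fintype.card_fin] at h2
  rw [Matrix.rank]
  omega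

end IsGenericForm

end GenericForm

/-! ### Common points of generic pairs -/

section GenericPair

/-- Simple tangency at a real point of two curves given by polynomials. -/
def IsSimpleTangency (P Q : MvPolynomial (Fin 3) ℝ) (v : Fin 3 → ℝ) : Prop :=
  gradAt P v ≠ 0 ∧ gradAt Q v ≠ 0 ∧ ∃ c : ℝ, gradAt P v = c • gradAt Q v ∧
    ∀ w : Fin 3 → ℝ, gradAt Q v ⬝ᵥ w = 0 → w ∉ Submodule.span ℝ {v} →
      hessForm P v w w ≠ c * hessForm Q v w w

variable {m n : ℕ} {F F' : RealForm m} {G G' : RealForm n}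

theorem not_linearIndependent_pair {𝕜 : Type*} [Field 𝕜] {ξ η : Fin 3 → 𝕜} (hη : η ≠ 0)
    (h : ¬ LinearIndependent 𝕜 ![ξ, η]) : ∃ c : 𝕜, ξ = c • η := by
  rw [LinearIndependent.pair_symm_iff, LinearIndependent.pair_iff' hη] at h
  push Not at h
  exact h.imp fun c hc => hc.symm

/-- Let u = a + ib, and read F, G as bilinear forms. Vanishing at u means F(a, a) = F(b, b) and F(a,
b) = 0, and likewise for G; pairing the tangency relation with a gives F(a, a) = c G(a, a). If G(a,
a) ≠ 0, then c is real and F - cG kills a and b, which `conics` excludes. Otherwise both conics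
contain the real line through a and b, and G has a singular point on this line, which `node_right`
excludes. -/
theorem IsGenericPair.conics_nonreal {F G : RealForm 2} (h : IsGenericPair F G) {u : Fin 3 → ℂ}
    (hu : IsNonreal u) (hF : aeval u F.1 = 0) (hG : aeval u G.1 = 0) {c : ℂ}
    (hc : gradAt F.1 u = c • gradAt G.1 u) : False := by
  set a : Fin 3 → ℝ := fun j => (u j).re with ha
  set b : Fin 3 → ℝ := fun j => (u j).im with hb
  have hsymm : ∀ (P : RealForm 2) (x y : Fin 3 → ℝ), gradAt P.1 x ⬝ᵥ y = gradAt P.1 y ⬝ᵥ x :=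
    fun P x y => by
      rw [dotProduct_comm, dotProduct_comm _ x, ← hessian_mulVec_of_isHomogeneous_two P.2 0 x,
        ← hessian_mulVec_of_isHomogeneous_two P.2 0 y]
      exact hessForm_comm P.1 0 y x
  have hself : ∀ P : RealForm 2, aeval u P.1 = 0 →
      gradAt P.1 a ⬝ᵥ a = gradAt P.1 b ⬝ᵥ b ∧ gradAt P.1 a ⬝ᵥ b = 0 := by
    intro P hP
    have h1 := gradAt_dotProduct_self P.2 u
    rw [hP, mul_zero] at h1
    have h2 := hsymm P a b
    simp only [dotProduct, Fin.sum_univ_three, gradAt_complex_of_isHomogeneous_two P.2 u,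
      ← ha, ← hb] at h1 h2 ⊢
    have h3 := congrArg Complex.re h1
    have h4 := congrArg Complex.im h1
    simp at h3 h4
    have ea : ∀ i, (u i).re = a i := fun i => rfl
    have eb : ∀ i, (u i).im = b i := fun i => rfl
    simp only [ea, eb] at h3 h4
    constructor <;> linarith
  obtain ⟨hF1, hF2⟩ := hself F hF
  obtain ⟨hG1, hG2⟩ := hself G hG
  have hc' : ∀ i, (gradAt F.1 a i + Complex.I * gradAt F.1 b i : ℂ) =
      c * (gradAt G.1 a i + Complex.I * gradAt G.1 b i) := fun i => by
    rw [← gradAt_complex_of_isHomogeneous_two F.2 u, ← gradAt_complex_of_isHomogeneous_two G.2 u, hc]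
    rfl
  have hcc : ∀ x : Fin 3 → ℝ, ((gradAt F.1 a ⬝ᵥ x : ℝ) + Complex.I * (gradAt F.1 b ⬝ᵥ x : ℝ) : ℂ) =
      c * ((gradAt G.1 a ⬝ᵥ x : ℝ) + Complex.I * (gradAt G.1 b ⬝ᵥ x : ℝ)) := fun x => by
    simp only [dotProduct, Fin.sum_univ_three]
    push_cast
    linear_combination x 0 * hc' 0 + x 1 * hc' 1 + x 2 * hc' 2
  have hFa := hcc a
  rw [hsymm F b a, hsymm G b a, hF2, hG2, Complex.ofReal_zero, mul_zero, add_zero, add_zero] at hFa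
  by_cases hs : gradAt G.1 a ⬝ᵥ a = 0
  · rw [hs, Complex.ofReal_zero, mul_zero, Complex.ofReal_eq_zero] at hFa
    rw [hFa] at hF1
    rw [hs] at hG1
    obtain ⟨e, ca, cb, ce, -, -, -, -, -, -, h1, h2, h3, H⟩ := exists_dual_basis hu
    have key : ∀ ξ : Fin 3 → ℝ, ξ ⬝ᵥ a = 0 → ξ ⬝ᵥ b = 0 → ξ = (ξ ⬝ᵥ e) • ce := by
      intro ξ ha0 hb0
      ext i
      have h4 : ξ i = ∑ j, ξ j * (ca i * a j + cb i * b j + ce i * e j) := by simp [ha, hb, H]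
      have h5 : ξ i = ca i * (ξ ⬝ᵥ a) + cb i * (ξ ⬝ᵥ b) + ce i * (ξ ⬝ᵥ e) := by
        conv_lhs => rw [h4]
        simp only [dotProduct, Fin.sum_univ_three]
        ring
      rw [ha0, hb0] at h5
      rw [h5, Pi.smul_apply, smul_eq_mul]
      ring
    have hGa := key _ hs hG2
    have hGb := key (gradAt G.1 b) (by rw [hsymm]; exact hG2) hG1.symm
    -- The gradients of G at a and b both annihilate a and b, hence are multiples of one covector;
    -- the combination in which they cancel gives the singular point.
    obtain ⟨s, t, hst, h0⟩ : ∃ s t : ℝ, (s ≠ 0 ∨ t ≠ 0) ∧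
        s * (gradAt G.1 a ⬝ᵥ e) + t * (gradAt G.1 b ⬝ᵥ e) = 0 := by
      by_cases hα : gradAt G.1 a ⬝ᵥ e = 0
      · exact ⟨1, 0, Or.inl one_ne_zero, by simp [hα]⟩
      · exact ⟨-(gradAt G.1 b ⬝ᵥ e), gradAt G.1 a ⬝ᵥ e, Or.inr hα, by ring⟩
    have hlin : ∀ P : RealForm 2, gradAt P.1 (s • a + t • b) =
        s • gradAt P.1 a + t • gradAt P.1 b := fun P => by
      rw [← hessian_mulVec_of_isHomogeneous_two P.2 0, Matrix.mulVec_add, Matrix.mulVec_smul,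
        Matrix.mulVec_smul, hessian_mulVec_of_isHomogeneous_two P.2,
        hessian_mulVec_of_isHomogeneous_two P.2]
    refine h.node_right ⟨s • a + t • b, fun h4 => ?_, ?_, ?_⟩
    · have := LinearIndependent.pair_iff.1 hu s t h4
      tauto
    · rw [hlin, hGa, hGb, smul_smul, smul_smul, ← add_smul, h0, zero_smul]
    · have h6 := gradAt_dotProduct_self F.2 (s • a + t • b)
      have hF3 := hsymm F a b
      rw [hF2] at hF3
      rw [hlin] at h6
      simp only [add_dotProduct, smul_dotProduct, dotProduct_add, dotProduct_smul, hFa, ← hF1, hF2,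
        ← hF3, aeval_eq_eval] at h6
      simpa using h6.symm
  · obtain ⟨r, rfl⟩ : ∃ r : ℝ, c = r := by
      refine ⟨(gradAt F.1 a ⬝ᵥ a) / (gradAt G.1 a ⬝ᵥ a), ?_⟩
      push_cast
      rw [eq_div_iff (by exact_mod_cast hs), hFa]
    refine h.conics rfl rfl ⟨a, b, r, hu, ?_, ?_⟩ <;> ext i
    · simpa using congrArg Complex.re (hc' i)
    · simpa using congrArg Complex.im (hc' i)

/-- Gradients of linear forms are real constants, so c is real and the relation holds at the base
point of `lines`. -/
theorem IsGenericPair.lines_independent {F G : RealForm 1} (h : IsGenericPair F G)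
    {u : Fin 3 → ℂ} {c : ℂ} (hG : gradAt G.1 u ≠ 0) (hc : gradAt F.1 u = c • gradAt G.1 u) :
    False := by
  have hF1 := gradAt_eq_of_isHomogeneous_one F.2 u (chartPoint 1 0 0)
  have hG1 := gradAt_eq_of_isHomogeneous_one G.2 u (chartPoint 1 0 0)
  obtain ⟨i, hi⟩ := Function.ne_iff.1 hG
  rw [hF1, hG1] at hc
  rw [hG1] at hi
  simp only [Complex.coe_algebraMap, Pi.zero_apply, ne_eq, Complex.ofReal_eq_zero] at hi
  have hci := fun j => congrFun hc j
  simp only [Complex.coe_algebraMap, Pi.smul_apply, smul_eq_mul] at hci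
  obtain ⟨r, rfl⟩ : ∃ r : ℝ, c = r := by
    refine ⟨gradAt F.1 (chartPoint 1 0 0) i / gradAt G.1 (chartPoint 1 0 0) i, ?_⟩
    push_cast
    rw [eq_div_iff (by exact_mod_cast hi), hci]
  refine h.lines ⟨r, ?_⟩
  ext j
  exact_mod_cast hci j

theorem linearIndependent_of_notMem_span {v w : Fin 3 → ℝ} (hv : v ≠ 0)
    (hw : w ∉ Submodule.span ℝ {v}) : LinearIndependent ℝ ![v, w] :=
  (LinearIndependent.pair_iff' hv).2 fun a ha =>
    hw (Submodule.mem_span_singleton.2 ⟨a, ha⟩)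

/-- The curves of a generic pair have only allowed common points. -/
theorem IsGenericPair.common_point (hm : 1 ≤ m) (hn : 1 ≤ n) (hmn : Even (m + n))
    (hF : IsGenericForm F F') (hG : IsGenericForm G G') (h : IsGenericPair F G) {u : Fin 3 → ℂ}
    (hu : u ≠ 0) (hFu : aeval u F.1 = 0) (hGu : aeval u G.1 = 0) :
    gradAt F.1 u ≠ 0 ∧ gradAt G.1 u ≠ 0 ∧
      (LinearIndependent ℂ ![gradAt F.1 u, gradAt G.1 u] ∨
        ∃ (z : ℂ) (v : Fin 3 → ℝ), u = z • (fun i => (v i : ℂ)) ∧ v ≠ 0 ∧ eval v F.1 = 0 ∧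
          eval v G.1 = 0 ∧ IsSimpleTangency F.1 G.1 v) := by
  have real : ∀ (z : ℂ) (v : Fin 3 → ℝ), u = z • (fun i => (v i : ℂ)) → z ≠ 0 ∧ v ≠ 0 ∧
      eval v F.1 = 0 ∧ eval v G.1 = 0 := by
    rintro z v rfl
    have hz : z ≠ 0 := by rintro rfl; simp at hu
    have hv : v ≠ 0 := by rintro rfl; apply hu; ext i; simp
    rw [aeval_smul_of_isHomogeneous F.2, aeval_ofReal, mul_eq_zero, or_iff_right (pow_ne_zero _ hz),
      Complex.ofReal_eq_zero] at hFu
    rw [aeval_smul_of_isHomogeneous G.2, aeval_ofReal, mul_eq_zero, or_iff_right (pow_ne_zero _ hz),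
      Complex.ofReal_eq_zero] at hGu
    exact ⟨hz, hv, hFu, hGu⟩
  have hFne : gradAt F.1 u ≠ 0 := fun h0 => by
    obtain ⟨z, v, hzv⟩ := hF.exists_real hm h0
    obtain ⟨hz, hv, -, hGv⟩ := real z v hzv
    rw [hzv, gradAt_smul_point F.2, smul_eq_zero_iff_right (pow_ne_zero _ hz),
      gradAt_ofReal_eq_zero] at h0
    exact h.node_left ⟨v, hv, h0, hGv⟩
  have hGne : gradAt G.1 u ≠ 0 := fun h0 => by
    obtain ⟨z, v, hzv⟩ := hG.exists_real hn h0
    obtain ⟨hz, hv, hFv, -⟩ := real z v hzv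
    rw [hzv, gradAt_smul_point G.2, smul_eq_zero_iff_right (pow_ne_zero _ hz),
      gradAt_ofReal_eq_zero] at h0
    exact h.node_right ⟨v, hv, h0, hFv⟩
  refine ⟨hFne, hGne, or_iff_not_imp_left.2 fun hdep => ?_⟩
  obtain ⟨c, hc⟩ := not_linearIndependent_pair hGne hdep
  have hc0 : c ≠ 0 := by rintro rfl; rw [zero_smul] at hc; exact hFne hc
  -- Evenness of m + n excludes a line together with a conic.
  have hcases : 3 ≤ m ∨ 3 ≤ n ∨ (m = 2 ∧ n = 2) ∨ (m = 1 ∧ n = 1) := by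
    obtain ⟨r, hr⟩ := hmn; omega
  have h11 : ¬ (m = 1 ∧ n = 1) := by
    rintro ⟨rfl, rfl⟩
    exact h.lines_independent hGne hc
  by_cases hnr : IsNonreal u
  · exfalso
    rcases hcases with h3 | h3 | ⟨rfl, rfl⟩ | h1
    · exact h.nonreal_left h3 ⟨u, c, hnr, hc, hGu⟩
    · exact h.nonreal_right h3 ⟨u, c⁻¹, hnr, by rw [hc, inv_smul_smul₀ hc0], hFu⟩
    · exact h.conics_nonreal hnr hFu hGu hc
    · exact h11 h1
  obtain ⟨z, v, rfl⟩ := exists_real_of_not_isNonreal hnr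
  obtain ⟨σ, a, b, k, hk, hv⟩ := exists_chartPoint (real z v rfl).2.1
  have hu' : z • (fun i => (v i : ℂ)) = (z * k) • (fun i => ((chartPoint σ a b i : ℝ) : ℂ)) := by
    ext i; rw [hv]; simp [mul_assoc]
  rw [hu'] at hc hFne hGne hdep
  obtain ⟨hz, hv0, hFv, hGv⟩ := real _ _ hu'
  rw [hu']
  set V : Fin 3 → ℝ := chartPoint σ a b with hV
  rw [gradAt_smul_point F.2, ne_eq, smul_eq_zero_iff_right (pow_ne_zero _ hz),
    gradAt_ofReal_eq_zero] at hFne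
  rw [gradAt_smul_point G.2, ne_eq, smul_eq_zero_iff_right (pow_ne_zero _ hz),
    gradAt_ofReal_eq_zero] at hGne
  -- The gradients at V are real vectors proportional over ℂ, hence over ℝ: the factor is the
  -- quotient of two real coordinates.
  obtain ⟨r, hr⟩ : ∃ r : ℝ, gradAt F.1 V = r • gradAt G.1 V := by
    obtain ⟨k', hk'⟩ : ∃ k' : ℂ, ∀ i, ((gradAt F.1 V i : ℝ) : ℂ) = k' * gradAt G.1 V i := by
      refine ⟨((z * k) ^ (m - 1))⁻¹ * (c * (z * k) ^ (n - 1)), fun i => ?_⟩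
      have := congrFun hc i
      rw [gradAt_smul_point F.2, gradAt_smul_point G.2, gradAt_ofReal, gradAt_ofReal] at this
      simp only [Pi.smul_apply, smul_eq_mul] at this
      rw [mul_assoc, mul_assoc, ← this, inv_mul_cancel_left₀ (pow_ne_zero _ hz)]
    obtain ⟨i, hi⟩ := Function.ne_iff.1 hGne
    refine ⟨gradAt F.1 V i / gradAt G.1 V i, ?_⟩
    ext j
    have h1 := hk' i
    have h2 := hk' j
    have h3 : ((gradAt G.1 V i : ℝ) : ℂ) ≠ 0 := by exact_mod_cast hi
    rw [← div_eq_iff h3] at h1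
    rw [← h1] at h2
    exact_mod_cast h2
  have hr0 : r ≠ 0 := by rintro rfl; rw [zero_smul] at hr; exact hFne hr
  have hVi : V (σ.symm 0) = 1 := by simp [hV, chartPoint]
  refine ⟨z * k, V, rfl, hv0, hFv, hGv, hFne, hGne, r, hr, fun w hw hwV heq => ?_⟩
  have hind := linearIndependent_of_notMem_span hv0 hwV
  rcases (by omega : 2 ≤ m ∨ 2 ≤ n ∨ (m = 1 ∧ n = 1)) with h2 | h2 | h1
  · exact h.tangency_left h2 ⟨V, w, _, r, hVi, hind, hr, hGv, hw, heq⟩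
  · refine h.tangency_right h2 ⟨V, w, _, r⁻¹, hVi, hind, by rw [hr, inv_smul_smul₀ hr0], hFv, ?_, ?_⟩
    · rw [hr, smul_dotProduct, hw, smul_zero]
    · rw [heq, inv_mul_cancel_left₀ hr0]
  · exact h11 h1

end GenericPair

/-! ### Pairs of forms without dot-like nodes -/

section Safe

open Topology

variable {d m n : ℕ}

theorem contDiff_eval_form {k : WithTop ℕ∞}
    (D : MvPolynomial (Fin 3) ℝ →ₗ[ℝ] MvPolynomial (Fin 3) ℝ) :
    ContDiff ℝ k (fun p : FormSpace d × (Fin 3 → ℝ) => eval p.2 (D (toForm d p.1).1)) := by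
  let L : (Fin 3 → ℝ) → (FormSpace d →L[ℝ] ℝ) := fun v =>
    (IsLinearMap.mk' (fun p => aeval v (D (toForm d p).1))
      ⟨fun x y => by simp, fun c x => by simp⟩).toContinuousLinearMap
  have hL : ContDiff ℝ k L := contDiff_clm_apply_iff.2 fun F =>
    contDiff_id.mvPolynomial_aeval (D (toForm d F).1)
  have h : (fun p : FormSpace d × (Fin 3 → ℝ) => eval p.2 (D (toForm d p.1).1)) =
      fun p => L p.2 p.1 := by
    ext p; simp [L, aeval_eq_eval]
  rw [h]
  exact (hL.comp contDiff_snd).clm_apply contDiff_fst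

theorem contDiff_gradAt_form {k : WithTop ℕ∞} :
    ContDiff ℝ k (fun p : FormSpace d × (Fin 3 → ℝ) => gradAt (toForm d p.1).1 p.2) :=
  contDiff_pi.2 fun i => contDiff_eval_form (pderiv i).toLinearMap

theorem contDiff_hessForm_form {k : WithTop ℕ∞} (x y : Fin 3 → ℝ) :
    ContDiff ℝ k (fun p : FormSpace d × (Fin 3 → ℝ) => hessForm (toForm d p.1).1 p.2 x y) := by
  simp only [hessForm, dotProduct, Matrix.mulVec, hessian, Matrix.of_apply]
  refine ContDiff.sum fun i _ => contDiff_const.mul (ContDiff.sum fun j _ => ?_)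
  exact (contDiff_eval_form ((pderiv i).toLinearMap ∘ₗ (pderiv j).toLinearMap)).mul contDiff_const

/-- At its real singular points, `P` is not locally of definite sign opposite to that of `Q`, so
that the double plane `w² = P Q` has no dot-like node there. -/
def IsSafe (P Q : MvPolynomial (Fin 3) ℝ) : Prop :=
  ∀ v : Fin 3 → ℝ, v ≠ 0 → gradAt P v = 0 → ∃ x, 0 < eval v Q * hessForm P v x x

/-- The pairs of forms whose product defines a double plane without dot-like nodes. -/
def safePairs (m n : ℕ) : Set (FormSpace m × FormSpace n) :=
  {p | IsSafe (toForm m p.1).1 (toForm n p.2).1 ∧ IsSafe (toForm n p.2).1 (toForm m p.1).1}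

theorem hessForm_eq_zero_of_isHomogeneous_le_one {P : MvPolynomial (Fin 3) ℝ}
    (hP : P.IsHomogeneous d) (hd : d ≤ 1) (v x y : Fin 3 → ℝ) : hessForm P v x y = 0 := by
  have h : hessian P v = 0 := by
    ext i j
    have h1 : (pderiv j P).IsHomogeneous 0 := by
      simpa [Nat.sub_eq_zero_of_le hd] using hP.pderiv (i := j)
    rw [hessian, Matrix.of_apply,
      totalDegree_eq_zero_iff_eq_C.1 ((totalDegree_zero_iff_isHomogeneous _).2 h1)]
    simp
  simp [hessForm, h]

/-- The product scales by c^n c^(m-2), an even power of c even when c is negative. For m ≤ 1, where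
m - 2 would be truncated, the Hessian is zero. -/
theorem exists_pos_smul_point (hmn : Even (m + n)) (F : RealForm m) (G : RealForm n)
    {v : Fin 3 → ℝ} {c : ℝ} (hc : c ≠ 0) (h : ∃ x, 0 < eval v G.1 * hessForm F.1 v x x) :
    ∃ x, 0 < eval (c • v) G.1 * hessForm F.1 (c • v) x x := by
  obtain ⟨x, hx⟩ := h
  refine ⟨x, ?_⟩
  rcases Nat.lt_or_ge 1 m with hm | hm
  · rw [← aeval_eq_eval, aeval_smul_of_isHomogeneous G.2, hessForm, hessian_smul_point F.2,
      Matrix.smul_mulVec, dotProduct_smul, smul_eq_mul, aeval_eq_eval]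
    have h1 : 0 < c ^ n * c ^ (m - 1 - 1) := by
      rw [← pow_add]
      refine Even.pow_pos ?_ hc
      obtain ⟨r, hr⟩ := hmn
      exact ⟨r - 1, by omega⟩
    have := mul_pos h1 hx
    rw [hessForm] at this
    linarith
  · rw [hessForm_eq_zero_of_isHomogeneous_le_one F.2 hm] at hx
    simp at hx

theorem isSafe_iff_sphere (hmn : Even (m + n)) (F : RealForm m) (G : RealForm n) :
    IsSafe F.1 G.1 ↔ ∀ v ∈ Metric.sphere (0 : Fin 3 → ℝ) 1,
      gradAt F.1 v ≠ 0 ∨ ∃ x, 0 < eval v G.1 * hessForm F.1 v x x := by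
  constructor
  · intro h v hv
    by_cases h0 : gradAt F.1 v = 0
    · exact Or.inr (h v (fun h1 => by simp [h1] at hv) h0)
    · exact Or.inl h0
  · intro h v hv hgrad
    have hc : ‖v‖ ≠ 0 := norm_ne_zero_iff.2 hv
    have h1 := h (‖v‖⁻¹ • v) (by simp [norm_smul, hc])
    rw [gradAt_smul_point F.2, hgrad, smul_zero] at h1
    have := exists_pos_smul_point hmn F G hc (h1.resolve_left fun h2 => h2 rfl)
    rwa [smul_inv_smul₀ hc] at this

/-- At a point of the sphere either the gradient is nonzero or some direction x has positive sign.
Both persist, with the same x, for nearby forms and points, and the sphere is compact. -/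
theorem isOpen_isSafe (hmn : Even (m + n)) :
    IsOpen {p : FormSpace m × FormSpace n | IsSafe (toForm m p.1).1 (toForm n p.2).1} := by
  rw [isOpen_iff_mem_nhds]
  intro p hp
  simp only [isSafe_iff_sphere hmn]
  simp only [mem_ofPred_eq, isSafe_iff_sphere hmn] at hp
  refine (isCompact_sphere (0 : Fin 3 → ℝ) 1).eventually_forall_of_forall_eventually fun v hv => ?_
  have hfst : Continuous fun z : (FormSpace m × FormSpace n) × (Fin 3 → ℝ) => (z.1.1, z.2) := by
    fun_prop
  have hsnd : Continuous fun z : (FormSpace m × FormSpace n) × (Fin 3 → ℝ) => (z.1.2, z.2) := by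
    fun_prop
  have hgrad : Continuous fun p : FormSpace m × (Fin 3 → ℝ) => gradAt (toForm m p.1).1 p.2 :=
    (contDiff_gradAt_form (d := m) (k := 0)).continuous
  have heval : Continuous fun p : FormSpace n × (Fin 3 → ℝ) => eval p.2 (toForm n p.1).1 :=
    (contDiff_eval_form (d := n) (k := 0) LinearMap.id).continuous
  have hhess : ∀ x, Continuous fun p : FormSpace m × (Fin 3 → ℝ) =>
      hessForm (toForm m p.1).1 p.2 x x :=
    fun x => (contDiff_hessForm_form (d := m) (k := 0) x x).continuous
  rcases hp v hv with h | ⟨x, hx⟩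
  · have h1 := hgrad.comp hfst
    filter_upwards [h1.continuousAt.eventually_ne (x := (p, v)) h] with z hz
    exact Or.inl hz
  · have h1 := (heval.comp hsnd).mul ((hhess x).comp hfst)
    have h2 : Filter.Tendsto _ (𝓝 (p, v)) _ := h1.tendsto (p, v)
    filter_upwards [h2.eventually_const_lt hx] with z hz
    exact Or.inr ⟨x, hz⟩

theorem isOpen_safePairs (hmn : Even (m + n)) : IsOpen (safePairs m n) :=
  (isOpen_isSafe hmn).inter
    ((isOpen_isSafe (by rwa [add_comm])).preimage (continuous_swap (X := FormSpace m)))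

theorem IsSafe.ne_zero {P Q : MvPolynomial (Fin 3) ℝ} (h : IsSafe P Q) : P ≠ 0 := by
  rintro rfl
  obtain ⟨x, hx⟩ := h (fun _ => 1) (fun h => by simpa using congrFun h 0) (by simp)
  have h0 : hessian (0 : MvPolynomial (Fin 3) ℝ) (fun _ => 1) = 0 := by ext i j; simp [hessian]
  simp [hessForm, h0] at hx

end Safe

/-! ### Dot-like nodes of double planes -/

section DoublePlane

/-- Derivatives along lines determine the gradients and Hessians of polynomials obtained by
substitution, such as `doublePlaneChart` and `substForm`, by uniqueness of derivatives in one
variable. -/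
theorem hasDerivAt_eval_line {σ : Type*} [Fintype σ] (g : MvPolynomial σ ℝ) (p η : σ → ℝ) (r : ℝ) :
    HasDerivAt (fun r : ℝ => eval (p + r • η) g) (gradAt g (p + r • η) ⬝ᵥ η) r := by
  classical
  induction g using MvPolynomial.induction_on with
  | C a => simpa [gradAt, dotProduct] using hasDerivAt_const r a
  | add f g hf hg => simpa [add_dotProduct] using hf.fun_add hg
  | mul_X f i hf =>
    have h1 : HasDerivAt (fun r : ℝ => p i + r * η i) (η i) r := by
      simpa using ((hasDerivAt_id' r).mul_const (η i)).const_add (p i)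
    have h2 := hf.fun_mul h1
    have h3 : gradAt (X i : MvPolynomial σ ℝ) (p + r • η) ⬝ᵥ η = η i := by
      simp [gradAt, dotProduct, pderiv_X, Pi.single_apply, apply_ite]
    rw [gradAt_mul, add_dotProduct, smul_dotProduct, smul_dotProduct, h3]
    simp only [eval_mul, eval_X, Pi.add_apply, Pi.smul_apply, smul_eq_mul, aeval_eq_eval]
    exact h2.congr_deriv (by ring)

theorem hasDerivAt_gradAt_line {σ : Type*} [Fintype σ] (g : MvPolynomial σ ℝ) (p η y : σ → ℝ)
    (r : ℝ) : HasDerivAt (fun r : ℝ => gradAt g (p + r • η) ⬝ᵥ y)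
      (hessForm g (p + r • η) η y) r := by
  have h := HasDerivAt.fun_sum (u := Finset.univ) fun i _ =>
    (hasDerivAt_eval_line (pderiv i g) p η r).mul_const (y i)
  simp only [gradAt, aeval_eq_eval, dotProduct] at h ⊢
  refine h.congr_deriv ?_
  rw [hessForm_comm]
  simp only [hessForm, dotProduct, Matrix.mulVec, hessian, Matrix.of_apply, Finset.mul_sum,
    Finset.sum_mul]
  refine Finset.sum_congr rfl fun i _ => Finset.sum_congr rfl fun j _ => ?_
  rw [pderiv_pderiv_comm]
  ring

theorem eval_doublePlaneChart (f : MvPolynomial (Fin 3) ℝ) (i : Fin 3) (p : Option (Fin 2) → ℝ) :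
    eval p (doublePlaneChart f i) =
      p none ^ 2 - eval (i.insertNth (1 : ℝ) fun j => p (some j) : Fin 3 → ℝ) f := by
  rw [doublePlaneChart, eval_sub, eval_pow, eval_X]
  congr 1
  rw [← aeval_eq_eval, ← AlgHom.comp_apply, comp_aeval, aeval_eq_eval]
  congr 2
  ext k
  refine Fin.succAboveCases i ?_ (fun j => ?_) k <;> simp

/-- The derivatives of the equation of the double plane. -/
theorem doublePlaneChart_derivatives (f : MvPolynomial (Fin 3) ℝ) (i : Fin 3)
    (p η : Option (Fin 2) → ℝ) {a y : Fin 3 → ℝ}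
    (ha : a = (i.insertNth (1 : ℝ) fun j => p (some j) : Fin 3 → ℝ))
    (hy : y = (i.insertNth (0 : ℝ) fun j => η (some j) : Fin 3 → ℝ)) :
    gradAt (doublePlaneChart f i) p ⬝ᵥ η = 2 * p none * η none - gradAt f a ⬝ᵥ y ∧
    hessForm (doublePlaneChart f i) p η η = 2 * η none ^ 2 - hessForm f a y y := by
  have hline : ∀ r : ℝ, eval (p + r • η) (doublePlaneChart f i) =
      (p none + r * η none) ^ 2 - eval (a + r • y) f := fun r => by
    rw [eval_doublePlaneChart, ha, hy]
    congr 3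
    ext k
    refine Fin.succAboveCases i ?_ (fun j => ?_) k <;> simp
  have h1 : ∀ r : ℝ, HasDerivAt (fun r : ℝ => p none + r * η none) (η none) r := fun r => by
    simpa using ((hasDerivAt_id' r).mul_const (η none)).const_add (p none)
  have hgrad : ∀ r : ℝ, gradAt (doublePlaneChart f i) (p + r • η) ⬝ᵥ η =
      2 * (p none + r * η none) * η none - gradAt f (a + r • y) ⬝ᵥ y := fun r => by
    have h2 := (((h1 r).fun_pow 2).fun_sub (hasDerivAt_eval_line f a y r))
    have h3 := hasDerivAt_eval_line (doublePlaneChart f i) p η r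
    simp only [hline] at h3
    simpa using h3.unique h2
  have hhess : hessForm (doublePlaneChart f i) (p + (0 : ℝ) • η) η η =
      2 * η none * η none - hessForm f (a + (0 : ℝ) • y) y y := by
    have h2 := ((((h1 0).const_mul 2).mul_const (η none)).fun_sub
      (hasDerivAt_gradAt_line f a y y 0))
    have h3 := hasDerivAt_gradAt_line (doublePlaneChart f i) p η η 0
    simp only [hgrad] at h3
    exact h3.unique h2
  have h0 := hgrad 0
  simp only [zero_smul, add_zero, zero_mul] at h0 hhess
  exact ⟨h0, by rw [hhess]; ring⟩

variable {m n : ℕ}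

/-- If P(a) ≠ 0, then F is singular at a: its gradient vanishes on the chart plane by assumption and
on a by Euler's relation. There the Hessian of FP is P(a) Hess F, and being negative on the plane it
leaves no direction for safety. If P(a) = 0, the Hessian of FP is a symmetrized product of two
gradients and cannot be definite. -/
theorem not_isSafe_of_negative_definite {F : RealForm m} {P : MvPolynomial (Fin 3) ℝ} {i : Fin 3}
    {a : Fin 3 → ℝ} (ha : a i = 1) (hF : eval a F.1 = 0)
    (hgrad : ∀ y : Fin 3 → ℝ, y i = 0 → gradAt (F.1 * P) a ⬝ᵥ y = 0)
    (hhess : ∀ y : Fin 3 → ℝ, y i = 0 → y ≠ 0 → hessForm (F.1 * P) a y y < 0) :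
    ¬ IsSafe F.1 P := by
  intro hsafe
  have ha0 : a ≠ 0 := fun h => by simp [h] at ha
  simp only [gradAt_mul, hessForm_mul, aeval_eq_eval, hF, zero_smul, zero_add, zero_mul,
    smul_dotProduct, smul_eq_mul] at hgrad hhess
  by_cases hP : eval a P = 0
  · let e : Fin 2 → Fin 3 → ℝ := fun j => Pi.single (i.succAbove j) 1
    -- A nonzero vector of the chart plane killed by the gradient of F; the Hessian of FP vanishes
    -- on it.
    obtain ⟨s, t, hst, h0⟩ : ∃ s t : ℝ, (s ≠ 0 ∨ t ≠ 0) ∧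
        gradAt F.1 a ⬝ᵥ (s • e 0 + t • e 1) = 0 := by
      by_cases hα : gradAt F.1 a ⬝ᵥ e 0 = 0
      · exact ⟨1, 0, Or.inl one_ne_zero, by simp [hα]⟩
      · refine ⟨-(gradAt F.1 a ⬝ᵥ e 1), gradAt F.1 a ⬝ᵥ e 0, Or.inr hα, ?_⟩
        rw [dotProduct_add, dotProduct_smul, dotProduct_smul, smul_eq_mul, smul_eq_mul]
        ring
    have hne : i.succAbove 0 ≠ i.succAbove 1 := fun h => by simpa using i.succAbove_right_injective h
    have := hhess (s • e 0 + t • e 1) (by simp [e, Fin.ne_succAbove]) (fun h => by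
      have h1 := congrFun h (i.succAbove 0)
      have h2 := congrFun h (i.succAbove 1)
      simp [e, hne, hne.symm] at h1 h2
      tauto)
    rw [hP, dotProduct_comm (s • e 0 + t • e 1) (gradAt F.1 a), h0] at this
    simp at this
  · have hdec : ∀ y : Fin 3 → ℝ, y = y i • a + (y - y i • a) := fun y => by abel
    have hker : ∀ y : Fin 3 → ℝ, (y - y i • a) i = 0 := fun y => by simp [ha]
    have hg : gradAt F.1 a = 0 := by
      rw [← dotProduct_eq_zero_iff]
      intro y
      rw [hdec y, dotProduct_add, dotProduct_smul, gradAt_dotProduct_self F.2, aeval_eq_eval, hF,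
        mul_zero, smul_zero, zero_add]
      exact (mul_eq_zero.1 (hgrad _ (hker y))).resolve_left hP
    obtain ⟨x, hx⟩ := hsafe a ha0 hg
    have h1 : (hessian F.1 a).mulVec a = 0 := by rw [hessian_mulVec_self F.2, hg, smul_zero]
    have h2 : ∀ y, hessForm F.1 a a y = 0 ∧ hessForm F.1 a y a = 0 := fun y => by
      rw [hessForm_comm F.1 a a y]
      simp [hessForm, h1]
    -- The vector a lies in the kernel of the Hessian, so x may be projected along a to the chart
    -- plane.
    have h3 : hessForm F.1 a x x = hessForm F.1 a (x - x i • a) (x - x i • a) := by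
      have h4 := h2 x
      have h5 := h2 a
      simp only [hessForm, Matrix.mulVec_sub, Matrix.mulVec_smul, sub_dotProduct, dotProduct_sub,
        smul_dotProduct, dotProduct_smul, smul_eq_mul] at h4 h5 ⊢
      rw [h4.1, h4.2, h5.1]
      ring
    rw [h3] at hx
    by_cases h0 : x - x i • a = 0
    · rw [h0] at hx
      simp [hessForm] at hx
    · have := hhess _ (hker x) h0
      rw [hg] at this
      simp at this
      linarith

/-- The double planes defined by safe pairs have no dot-like nodes. -/
theorem not_doublePlaneHasDotLikeNode {F : RealForm m} {G : RealForm n}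
    (h : IsSafe F.1 G.1 ∧ IsSafe G.1 F.1) : ¬ DoublePlaneHasDotLikeNode (F.1 * G.1) := by
  rintro ⟨i, p, hp0, hp1, hp2⟩
  rw [← gradAt_eq_grad] at hp1
  set a : Fin 3 → ℝ := (i.insertNth (1 : ℝ) fun j => p (some j) : Fin 3 → ℝ) with ha
  let e : Option (Fin 2) → ℝ := Pi.single none 1
  have hy0 : (0 : Fin 3 → ℝ) = (i.insertNth (0 : ℝ) fun j => e (some j) : Fin 3 → ℝ) := by
    ext k
    refine Fin.succAboveCases i ?_ (fun j => ?_) k <;> simp [e]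
  obtain ⟨h1, h2⟩ := doublePlaneChart_derivatives (F.1 * G.1) i p e ha hy0
  have hw : p none = 0 := by
    rw [hp1] at h1
    simpa [e] using h1.symm
  -- The second derivative in the direction of w is 2, so a definite Hessian is positive definite.
  have hpos : (hessian (doublePlaneChart (F.1 * G.1) i) p).PosDef := by
    refine hp2.resolve_right fun hneg => ?_
    have h3 := hneg.dotProduct_mulVec_pos (x := e) (fun h => by simpa [e] using congrFun h none)
    rw [Matrix.neg_mulVec, dotProduct_neg, star_trivial] at h3
    rw [hessForm] at h2
    rw [h2] at h3
    simp [e, hessForm] at h3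
    linarith
  have hplane : ∀ y : Fin 3 → ℝ, y i = 0 → gradAt (F.1 * G.1) a ⬝ᵥ y = 0 ∧
      (y ≠ 0 → hessForm (F.1 * G.1) a y y < 0) := by
    intro y hy
    let η : Option (Fin 2) → ℝ := fun o => o.elim 0 fun j => y (i.succAbove j)
    have hyη : y = (i.insertNth (0 : ℝ) fun j => η (some j) : Fin 3 → ℝ) := by
      ext k
      refine Fin.succAboveCases i ?_ (fun j => ?_) k <;> simp [η, hy]
    obtain ⟨h3, h4⟩ := doublePlaneChart_derivatives (F.1 * G.1) i p η ha hyη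
    refine ⟨?_, fun hy0 => ?_⟩
    · rw [hp1] at h3
      simpa [η] using h3.symm
    · have h5 := hpos.dotProduct_mulVec_pos (x := η) (fun h => hy0 (by
        rw [hyη, h]
        ext k
        refine Fin.succAboveCases i ?_ (fun j => ?_) k <;> simp))
      rw [star_trivial] at h5
      rw [hessForm] at h4
      rw [h4] at h5
      simp [η] at h5
      linarith
  have hai : a i = 1 := by simp [ha]
  rw [eval_doublePlaneChart, hw, ← ha, eval_mul] at hp0
  rcases mul_eq_zero.1 (by linarith : eval a F.1 * eval a G.1 = 0) with hF | hG
  · exact not_isSafe_of_negative_definite hai hF (fun y hy => (hplane y hy).1)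
      (fun y hy => (hplane y hy).2) h.1
  · rw [mul_comm] at hplane
    exact not_isSafe_of_negative_definite hai hG (fun y hy => (hplane y hy).1)
      (fun y hy => (hplane y hy).2) h.2

end DoublePlane

/-! ### Curves defined by forms -/

section Curves

variable {d m n : ℕ}

theorem curveForm_mk (F : RealForm d) (h : F ≠ 0) :
    ∃ α : ℝ, α ≠ 0 ∧ curveForm (Projectivization.mk ℝ F h) = α • F.1 := by
  obtain ⟨α, hα⟩ := Projectivization.exists_smul_eq_mk_rep ℝ F h
  exact ⟨α, α.ne_zero, by rw [curveForm, ← hα]; rfl⟩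

theorem Matrix.rank_smul_eq {M : Matrix (Fin 3) (Fin 3) ℝ} {α : ℝ} (hα : α ≠ 0) :
    (α • M).rank = M.rank := by
  have h : α • M = (α • (1 : Matrix (Fin 3) (Fin 3) ℝ)) * M := by simp
  rw [h]
  exact Matrix.rank_mul_eq_right_of_isUnit_det _ _ (by simp [hα])

/-- By Euler's relation a zero gradient forces the form to vanish when d ≥ 1, so the gradient alone
decides. -/
theorem isSingularPoint_mk (hd : 1 ≤ d) (F : RealForm d) (h : F ≠ 0) (u : Fin 3 → ℂ) :
    IsSingularPoint (Projectivization.mk ℝ F h) u ↔ u ≠ 0 ∧ gradAt F.1 u = 0 := by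
  obtain ⟨α, hα, hF⟩ := curveForm_mk F h
  have hd0 : (d : ℂ) ≠ 0 := by exact_mod_cast (by omega : d ≠ 0)
  rw [IsSingularPoint, complexForm, grad_map_eq_gradAt, eval_map_eq_aeval, hF]
  simp only [gradAt_smul, map_smul, smul_eq_zero, hα, false_or]
  refine and_congr_right fun _ => ⟨fun h => h.2, fun hg => ⟨?_, hg⟩⟩
  have := gradAt_dotProduct_self F.2 u
  rw [hg, zero_dotProduct] at this
  exact (mul_eq_zero.1 this.symm).resolve_left hd0

theorem isCommonPoint_mk (F : RealForm m) (hF : F ≠ 0) (G : RealForm n) (hG : G ≠ 0)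
    (u : Fin 3 → ℂ) :
    IsCommonPoint (Projectivization.mk ℝ F hF) (Projectivization.mk ℝ G hG) u ↔
      u ≠ 0 ∧ aeval u F.1 = 0 ∧ aeval u G.1 = 0 := by
  obtain ⟨α, hα, hF'⟩ := curveForm_mk F hF
  obtain ⟨β, hβ, hG'⟩ := curveForm_mk G hG
  rw [IsCommonPoint, complexForm, complexForm, eval_map_eq_aeval, eval_map_eq_aeval, hF', hG']
  simp only [map_smul, smul_eq_zero, hα, hβ, false_or, ne_eq]

theorem meetTransversallyAt_mk {F : RealForm m} (hF : F ≠ 0) {G : RealForm n} (hG : G ≠ 0)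
    {u : Fin 3 → ℂ} (h : LinearIndependent ℂ ![gradAt F.1 u, gradAt G.1 u]) :
    MeetTransversallyAt (Projectivization.mk ℝ F hF) (Projectivization.mk ℝ G hG) u := by
  obtain ⟨α, hα, hF'⟩ := curveForm_mk F hF
  obtain ⟨β, hβ, hG'⟩ := curveForm_mk G hG
  rw [MeetTransversallyAt, complexForm, complexForm, grad_map_eq_gradAt, grad_map_eq_gradAt, hF',
    hG', gradAt_smul, gradAt_smul]
  rw [LinearIndependent.pair_iff] at h ⊢
  intro s t hst
  have := h (s * α) (t * β) (by
    rw [mul_smul, mul_smul]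
    simpa [Complex.coe_smul] using hst)
  simpa [hα, hβ] using this

theorem hasSimpleTangencyAt_mk {F : RealForm m} (hF : F ≠ 0) {G : RealForm n} (hG : G ≠ 0)
    {v : Fin 3 → ℝ} (hv : v ≠ 0) (hFv : eval v F.1 = 0) (hGv : eval v G.1 = 0)
    (h : IsSimpleTangency F.1 G.1 v) :
    HasSimpleTangencyAt (Projectivization.mk ℝ F hF) (Projectivization.mk ℝ G hG) v := by
  obtain ⟨α, hα, hF'⟩ := curveForm_mk F hF
  obtain ⟨β, hβ, hG'⟩ := curveForm_mk G hG
  obtain ⟨hFg, hGg, c, hc, H⟩ := h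
  simp only [HasSimpleTangencyAt, hF', hG', ← gradAt_eq_grad, gradAt_smul, hessian_smul, smul_eval,
    hFv, hGv, mul_zero, ne_eq, smul_eq_zero, hα, hβ, hFg, hGg, false_or, not_false_eq_true,
    true_and, hv, smul_dotProduct, smul_eq_mul, mul_eq_zero]
  refine ⟨α * c / β, ?_, fun w hw hwv => ?_⟩
  · rw [hc, smul_smul, smul_smul]
    congr 1
    field_simp
  · rw [smul_smul, div_mul_cancel₀ _ hβ, mul_smul, ← smul_sub, Matrix.smul_mulVec, dotProduct_smul,
      smul_eq_mul]
    refine mul_ne_zero hα ?_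
    rw [Matrix.sub_mulVec, dotProduct_sub, Matrix.smul_mulVec, dotProduct_smul, smul_eq_mul,
      sub_ne_zero]
    exact H w hw hwv

theorem exists_represents {φ : ℝ → RealForm d} (h : ∀ t ∈ Icc (0 : ℝ) 1, φ t ≠ 0) :
    ∃ A : ℝ → PlaneCurve d, Represents φ A := by
  classical
  -- Outside [0, 1] the form may vanish; the curve of `φ 0` is a default value there.
  refine ⟨fun t => if ht : φ t ≠ 0 then Projectivization.mk ℝ (φ t) ht else
    Projectivization.mk ℝ (φ 0) (h 0 (by simp)), fun t ht => ⟨h t ht, ?_⟩⟩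
  exact dif_pos (h t ht)

theorem contDiff_coeff_toForm {k : WithTop ℕ∞} {φ : ℝ → FormSpace d} (hφ : ContDiff ℝ k φ)
    (e : Fin 3 →₀ ℕ) : ContDiff ℝ k (fun t => coeff e (toForm d (φ t)).1) := by
  let L : FormSpace d →ₗ[ℝ] ℝ :=
    (lcoeff ℝ e) ∘ₗ (homogeneousSubmodule (Fin 3) ℝ d).subtype ∘ₗ (toForm d).toLinearMap
  exact L.toContinuousLinearMap.contDiff.comp hφ

theorem mem_Icc_cases {t : ℝ} (ht : t ∈ Icc (0 : ℝ) 1) : t = 0 ∨ t = 1 ∨ t ∈ Ioo (0 : ℝ) 1 := by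
  rcases ht.1.eq_or_lt with h | h
  · exact Or.inl h.symm
  · exact Or.inr (ht.2.eq_or_lt.imp_right fun h' => ⟨h, h'⟩)

/-- Genericity is needed at interior times only, because the end curves are nonsingular. -/
theorem isSimpleNodalDeformation_of_isGenericForm (hd : 1 ≤ d) {φ : ℝ → FormSpace d}
    (hφ : ContDiff ℝ ∞ φ) {A : ℝ → PlaneCurve d} (hA : Represents (fun t => toForm d (φ t)) A)
    (h0 : IsNonsingularCurve (A 0)) (h1 : IsNonsingularCurve (A 1))
    (h : ∀ t ∈ Ioo (0 : ℝ) 1, IsGenericForm (toForm d (φ t)) (toForm d (deriv φ t))) :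
    IsSimpleNodalDeformation A := by
  refine ⟨_, hA, fun e => (contDiff_coeff_toForm hφ e).contDiffOn, fun t ht hs => ?_⟩
  rcases mem_Icc_cases ht with rfl | rfl | ht'
  · exact absurd h0 hs
  · exact absurd h1 hs
  have hgen := h t ht'
  obtain ⟨hne, hAt⟩ := hA t ht
  obtain ⟨α, hα, hform⟩ := curveForm_mk _ hne
  rw [hAt] at hs ⊢
  rw [IsNonsingularCurve] at hs
  push Not at hs
  simp only [isSingularPoint_mk hd, hform] at hs ⊢
  obtain ⟨u, hu0, hu⟩ := hs
  obtain ⟨z, v, hzv⟩ := hgen.exists_real hd hu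
  have hz : z ≠ 0 := by rintro rfl; simp [hzv] at hu0
  have hv0 : v ≠ 0 := by
    rintro rfl
    exact hu0 (by rw [hzv]; ext; simp)
  have hv : gradAt (toForm d (φ t)).1 v = 0 := by
    rw [hzv, gradAt_smul_point (toForm d (φ t)).2, smul_eq_zero] at hu
    exact gradAt_ofReal_eq_zero.1 (hu.resolve_left (pow_ne_zero _ hz))
  refine ⟨v, ⟨fun h => hv0 ?_, gradAt_ofReal_eq_zero.2 hv⟩, ?_, ?_, ?_⟩
  · ext i
    simpa using congrFun h i
  · rintro w ⟨hw0, hw⟩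
    obtain ⟨z', v', hzv'⟩ := hgen.exists_real hd hw
    have hz' : z' ≠ 0 := by rintro rfl; simp [hzv'] at hw0
    have hv' : gradAt (toForm d (φ t)).1 v' = 0 := by
      rw [hzv', gradAt_smul_point (toForm d (φ t)).2, smul_eq_zero] at hw
      exact gradAt_ofReal_eq_zero.1 (hw.resolve_left (pow_ne_zero _ hz'))
    obtain ⟨c, rfl⟩ := hgen.exists_smul_eq hd hv0 hv hv'
    refine ⟨z' * c, ?_⟩
    rw [hzv']
    ext i
    simp [mul_assoc]
  · rw [hessian_smul, Matrix.rank_smul_eq hα]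
    exact hgen.rank_hessian hd hv0 hv
  · let L : FormSpace d →ₗ[ℝ] ℝ := (aeval v).toLinearMap ∘ₗ
      (homogeneousSubmodule (Fin 3) ℝ d).subtype ∘ₗ (toForm d).toLinearMap
    have hL : ∀ x, L x = eval v (toForm d x).1 := fun x => by simp [L, aeval_eq_eval]
    have hderiv : HasDerivAt (fun s => L (φ s)) (L (deriv φ t)) t :=
      L.toContinuousLinearMap.hasFDerivAt.comp_hasDerivAt t
        ((hφ.differentiable (by simp)).differentiableAt.hasDerivAt)
    simp only [hL] at hderiv
    rw [hderiv.hasDerivWithinAt.derivWithin (uniqueDiffOn_Icc one_pos t ht)]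
    exact fun hv' => hgen.velocity ⟨v, hv0, hv, hv'⟩

theorem isSimultaneousNodalDeformation_of_isGenericPair (hm : 1 ≤ m) (hn : 1 ≤ n)
    (hmn : Even (m + n)) {φ : ℝ → FormSpace m} (hφ : ContDiff ℝ ∞ φ) {ψ : ℝ → FormSpace n}
    (hψ : ContDiff ℝ ∞ ψ) {B : ℝ → PlaneCurve m} (hB : Represents (fun t => toForm m (φ t)) B)
    {C : ℝ → PlaneCurve n} (hC : Represents (fun t => toForm n (ψ t)) C)
    (hB₀ : IsNonsingularCurve (B 0)) (hC₀ : IsNonsingularCurve (C 0))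
    (hB₁ : IsNonsingularCurve (B 1)) (hC₁ : IsNonsingularCurve (C 1))
    (h₀ : AreTransverse (B 0) (C 0)) (h₁ : AreTransverse (B 1) (C 1))
    (h : ∀ t ∈ Ioo (0 : ℝ) 1, IsGenericForm (toForm m (φ t)) (toForm m (deriv φ t)) ∧
      IsGenericForm (toForm n (ψ t)) (toForm n (deriv ψ t)) ∧
      IsGenericPair (toForm m (φ t)) (toForm n (ψ t))) :
    IsSimultaneousNodalDeformation B C := by
  refine ⟨isSimpleNodalDeformation_of_isGenericForm hm hφ hB hB₀ hB₁ fun t ht => (h t ht).1,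
    isSimpleNodalDeformation_of_isGenericForm hn hψ hC hC₀ hC₁ fun t ht => (h t ht).2.1,
    fun t ht u hu => ?_⟩
  rcases mem_Icc_cases ht with rfl | rfl | ht'
  · exact ⟨hB₀ u, hC₀ u, Or.inl (h₀ u hu)⟩
  · exact ⟨hB₁ u, hC₁ u, Or.inl (h₁ u hu)⟩
  obtain ⟨hF, hG, hFG⟩ := h t ht'
  obtain ⟨hF0, hBt⟩ := hB t ht
  obtain ⟨hG0, hCt⟩ := hC t ht
  rw [hBt, hCt] at hu ⊢
  rw [isCommonPoint_mk] at hu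
  obtain ⟨hu0, hFu, hGu⟩ := hu
  obtain ⟨h1, h2, h3⟩ := hFG.common_point hm hn hmn hF hG hu0 hFu hGu
  rw [isSingularPoint_mk hm, isSingularPoint_mk hn]
  refine ⟨fun h => h1 h.2, fun h => h2 h.2, h3.imp (meetTransversallyAt_mk hF0 hG0) ?_⟩
  rintro ⟨z, v, hzv, hv, hFv, hGv, hv'⟩
  exact ⟨z, v, hzv, hasSimpleTangencyAt_mk hF0 hG0 hv hFv hGv hv'⟩

theorem curveForm_curveUnion_mk (F : RealForm m) (hF : F ≠ 0) (G : RealForm n) (hG : G ≠ 0) :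
    ∃ α : ℝ, α ≠ 0 ∧ curveForm (curveUnion (Projectivization.mk ℝ F hF)
      (Projectivization.mk ℝ G hG)) = α • (F.1 * G.1) := by
  obtain ⟨α, hα, hF'⟩ := curveForm_mk F hF
  obtain ⟨β, hβ, hG'⟩ := curveForm_mk G hG
  rw [curveUnion]
  generalize_proofs h1 h2
  obtain ⟨δ, hδ, h⟩ := curveForm_mk _ h2
  refine ⟨δ * (α * β), mul_ne_zero hδ (mul_ne_zero hα hβ), ?_⟩
  rw [h]
  simp only [hF', hG', smul_mul_smul_comm, smul_smul]

theorem curveUnion_mk (F : RealForm m) (hF : F ≠ 0) (G : RealForm n) (hG : G ≠ 0)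
    (H : RealForm (m + n)) (hH : H.1 = F.1 * G.1) :
    ∃ h0 : H ≠ 0, curveUnion (Projectivization.mk ℝ F hF) (Projectivization.mk ℝ G hG) =
      Projectivization.mk ℝ H h0 := by
  have h0 : H ≠ 0 := by
    rintro rfl
    exact mul_ne_zero (fun h => hF (Subtype.ext h)) (fun h => hG (Subtype.ext h)) hH.symm
  refine ⟨h0, ?_⟩
  obtain ⟨α, hα, hF'⟩ := curveForm_mk F hF
  obtain ⟨β, hβ, hG'⟩ := curveForm_mk G hG
  rw [curveUnion, Projectivization.mk_eq_mk_iff']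
  refine ⟨α * β, Subtype.ext ?_⟩
  simp only [Submodule.coe_smul, hH, hF', hG', smul_mul_smul_comm]

theorem isNiceFor_of_safePairs {φ : ℝ → FormSpace m} (hφ : Continuous φ)
    {ψ : ℝ → FormSpace n} (hψ : Continuous ψ) {B : ℝ → PlaneCurve m}
    (hB : Represents (fun t => toForm m (φ t)) B) {C : ℝ → PlaneCurve n}
    (hC : Represents (fun t => toForm n (ψ t)) C)
    (h : ∀ t ∈ Icc (0 : ℝ) 1, (φ t, ψ t) ∈ safePairs m n) {W₀ : Set RealPlane}
    (hW₀ : W₀ = region ((toForm m (φ 0)).1 * (toForm n (ψ 0)).1)) :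
    IsNiceFor (fun t => curveUnion (B t) (C t)) W₀ := by
  refine ⟨fun t => ⟨(toForm m (φ t)).1 * (toForm n (ψ t)).1,
    IsHomogeneous.mul (toForm m (φ t)).2 (toForm n (ψ t)).2⟩, fun t ht => ?_, fun e => ?_,
    hW₀.symm, fun t ht => not_doublePlaneHasDotLikeNode (h t ht)⟩
  · obtain ⟨hF, hBt⟩ := hB t ht
    obtain ⟨hG, hCt⟩ := hC t ht
    simp only [hBt, hCt]
    exact curveUnion_mk _ hF _ hG _ rfl
  · simp only [coeff_mul]
    refine (continuous_finsetSum _ fun x _ => ?_).continuousOn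
    exact (contDiff_coeff_toForm (k := 0) (contDiff_zero.2 hφ) x.1).continuous.mul
      (contDiff_coeff_toForm (k := 0) (contDiff_zero.2 hψ) x.2).continuous

end Curves

/-! ### Linear substitutions in forms -/

section Substitution

open Topology

variable {d : ℕ}

/-- Evaluations at real points separate forms, so they embed the finite-dimensional space of forms
linearly, hence as a closed subspace, into the functions with the product topology. -/
theorem continuous_formSpace {X : Type*} [TopologicalSpace X] {f : X → FormSpace d}
    (hf : ∀ v, Continuous fun x => eval v (toForm d (f x)).1) : Continuous f := by
  let L : FormSpace d →ₗ[ℝ] ((Fin 3 → ℝ) → ℝ) := LinearMap.pi fun v => (aeval v).toLinearMap ∘ₗ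
    (homogeneousSubmodule (Fin 3) ℝ d).subtype ∘ₗ (toForm d).toLinearMap
  have hL : ∀ x v, L x v = eval v (toForm d x).1 := fun x v => by simp [L, aeval_eq_eval]
  have hker : L.ker = ⊥ := by
    refine (LinearMap.ker_eq_bot' (f := L)).2 fun x hx => ?_
    have : (toForm d x).1 = 0 := MvPolynomial.funext fun v => by rw [← hL, hx]; simp
    exact (toForm d).map_eq_zero_iff.1 (Subtype.ext this)
  refine (LinearMap.isClosedEmbedding_of_injective hker).isEmbedding.continuous_iff.2
    (continuous_pi fun v => ?_)
  simpa only [Function.comp_apply, hL] using hf v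

/-- The linear substitution `h` in forms of degree `d`. -/
noncomputable def substForm (d : ℕ) (h : (Fin 3 → ℝ) →ₗ[ℝ] (Fin 3 → ℝ)) :
    FormSpace d →ₗ[ℝ] FormSpace d :=
  (toForm d).symm.toLinearMap ∘ₗ
    ((aeval fun i => linForm (LinearMap.toMatrix' h i)).toLinearMap.restrict fun P hP => by
      rw [mem_homogeneousSubmodule] at hP ⊢
      simpa using IsHomogeneous.aeval hP (fun i => linForm (LinearMap.toMatrix' h i))
        fun i => linForm_isHomogeneous _) ∘ₗ
    (toForm d).toLinearMap

theorem eval_substForm (h : (Fin 3 → ℝ) →ₗ[ℝ] (Fin 3 → ℝ)) (F : FormSpace d) (x : Fin 3 → ℝ) :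
    eval x (toForm d (substForm d h F)).1 = eval (h x) (toForm d F).1 := by
  simp only [substForm, LinearMap.comp_apply, LinearEquiv.coe_coe, LinearEquiv.apply_symm_apply,
    LinearMap.coe_restrict_apply, AlgHom.toLinearMap_apply]
  rw [← aeval_eq_eval, ← AlgHom.comp_apply, comp_aeval, aeval_eq_eval]
  congr 2
  ext i
  rw [aeval_eq_eval, eval_linForm]
  exact congrFun (LinearMap.toMatrix'_mulVec h x) i

theorem gradAt_substForm (h : (Fin 3 → ℝ) →ₗ[ℝ] (Fin 3 → ℝ)) (F : FormSpace d)
    (x y : Fin 3 → ℝ) :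
    gradAt (toForm d (substForm d h F)).1 x ⬝ᵥ y = gradAt (toForm d F).1 (h x) ⬝ᵥ h y := by
  have h1 := hasDerivAt_eval_line (toForm d (substForm d h F)).1 x y 0
  have h2 := hasDerivAt_eval_line (toForm d F).1 (h x) (h y) 0
  simp only [eval_substForm, map_add, map_smul] at h1
  simpa using h1.unique h2

theorem hessForm_substForm (h : (Fin 3 → ℝ) →ₗ[ℝ] (Fin 3 → ℝ)) (F : FormSpace d)
    (x y : Fin 3 → ℝ) :
    hessForm (toForm d (substForm d h F)).1 x y y = hessForm (toForm d F).1 (h x) (h y) (h y) := by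
  have h1 := hasDerivAt_gradAt_line (toForm d (substForm d h F)).1 x y y 0
  have h2 := hasDerivAt_gradAt_line (toForm d F).1 (h x) (h y) (h y) 0
  simp only [gradAt_substForm, map_add, map_smul] at h1
  simpa using h1.unique h2

/-- The form has no real singular points. -/
def IsRealNonsingular (P : MvPolynomial (Fin 3) ℝ) : Prop :=
  ∀ v : Fin 3 → ℝ, v ≠ 0 → gradAt P v ≠ 0

theorem gradAt_substForm_eq_zero (h : (Fin 3 → ℝ) ≃ₗ[ℝ] (Fin 3 → ℝ)) {F : FormSpace d}
    {x : Fin 3 → ℝ} (hx : gradAt (toForm d (substForm d h F)).1 x = 0) :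
    gradAt (toForm d F).1 (h x) = 0 := by
  rw [← dotProduct_eq_zero_iff]
  intro y
  have := gradAt_substForm (h : (Fin 3 → ℝ) →ₗ[ℝ] (Fin 3 → ℝ)) F x (h.symm y)
  rw [hx] at this
  simpa using this.symm

theorem IsRealNonsingular.substForm {F : FormSpace d} (hF : IsRealNonsingular (toForm d F).1)
    (h : (Fin 3 → ℝ) ≃ₗ[ℝ] (Fin 3 → ℝ)) :
    IsRealNonsingular (toForm d (substForm d h F)).1 := fun v hv hgrad =>
  hF (h v) (by simpa using hv) (gradAt_substForm_eq_zero h hgrad)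

theorem substForm_comp (h h' : (Fin 3 → ℝ) →ₗ[ℝ] (Fin 3 → ℝ)) (F : FormSpace d) :
    substForm d (h' ∘ₗ h) F = substForm d h (substForm d h' F) := by
  refine (toForm d).injective (Subtype.ext (MvPolynomial.funext fun x => ?_))
  simp only [eval_substForm, LinearMap.comp_apply]

/-- The real nonsingular forms of degree `d`. -/
def realNonsingularForms (d : ℕ) : Set (FormSpace d) := {F | IsRealNonsingular (toForm d F).1}

/-- The ray of `w` can be moved to that of `v` by a linear substitution, which does not change the
deformation class of real nonsingular forms of degree `d`. -/
def IsLinked (d : ℕ) (w v : Fin 3 → ℝ) : Prop :=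
  ∃ (h : (Fin 3 → ℝ) ≃ₗ[ℝ] (Fin 3 → ℝ)) (c : ℝ), 0 < c ∧ h w = c • v ∧
    ∀ F ∈ realNonsingularForms d, JoinedIn (realNonsingularForms d) F (substForm d h F)

theorem IsLinked.trans {w v x : Fin 3 → ℝ} (h₁ : IsLinked d w v) (h₂ : IsLinked d v x) :
    IsLinked d w x := by
  obtain ⟨h, c, hc, hw, H⟩ := h₁
  obtain ⟨h', c', hc', hv, H'⟩ := h₂
  refine ⟨h.trans h', c * c', mul_pos hc hc', ?_, fun F hF => ?_⟩
  · rw [LinearEquiv.trans_apply, hw, map_smul, hv, smul_smul]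
  · have h1 := H' F hF
    have h2 := H _ h1.target_mem
    rw [LinearEquiv.coe_trans, substForm_comp]
    exact h1.trans h2

theorem dotProduct_self_pos_of_ne_zero {w : Fin 3 → ℝ} (hw : w ≠ 0) : 0 < w ⬝ᵥ w :=
  lt_of_le_of_ne (Finset.sum_nonneg fun i _ => mul_self_nonneg (w i))
    fun h => hw (dotProduct_self_eq_zero.1 h.symm)

/-- The shears x ↦ x + s(w·x)e with e orthogonal to w are invertible, with inverse at -s, and form a
path from the identity. Here e is chosen so that the shear at s = 1 sends w to cv, where c > 0 makes
cv - w orthogonal to w. -/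
theorem isLinked_of_dotProduct_pos {w v : Fin 3 → ℝ} (h : 0 < w ⬝ᵥ v) : IsLinked d w v := by
  have hw' : 0 < w ⬝ᵥ w := dotProduct_self_pos_of_ne_zero (by rintro rfl; simp at h)
  have hw := hw'.ne'
  set c : ℝ := (w ⬝ᵥ w) / (w ⬝ᵥ v) with hc
  set e : Fin 3 → ℝ := (w ⬝ᵥ w)⁻¹ • (c • v - w) with he
  have hwe : w ⬝ᵥ e = 0 := by
    rw [he, dotProduct_smul, dotProduct_sub, dotProduct_smul, hc, smul_eq_mul, smul_eq_mul,
      div_mul_cancel₀ _ h.ne', sub_self, mul_zero]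
  let f : ℝ → (Fin 3 → ℝ) →ₗ[ℝ] (Fin 3 → ℝ) := fun s =>
    IsLinearMap.mk' (fun x => x + (s * (w ⬝ᵥ x)) • e)
      ⟨fun x y => by rw [dotProduct_add]; module, fun a x => by
        rw [dotProduct_smul, smul_eq_mul]; module⟩
  have hf : ∀ s x, f s x = x + (s * (w ⬝ᵥ x)) • e := fun s x => rfl
  have hff : ∀ s x, f (-s) (f s x) = x := fun s x => by
    rw [hf, hf, dotProduct_add, dotProduct_smul, hwe]; module
  let g : ℝ → (Fin 3 → ℝ) ≃ₗ[ℝ] (Fin 3 → ℝ) := fun s =>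
    { f s with
      invFun := f (-s)
      left_inv := hff s
      right_inv := fun x => by simpa using hff (-s) x }
  have hg : ∀ s, (g s : (Fin 3 → ℝ) →ₗ[ℝ] (Fin 3 → ℝ)) = f s := fun s => rfl
  refine ⟨g 1, c, div_pos hw' h, ?_, fun F hF => ?_⟩
  · change f 1 w = c • v
    rw [hf, he, one_mul, smul_smul, mul_inv_cancel₀ hw]
    module
  · refine JoinedIn.ofLine (f := fun s => substForm d (g s) F) (Continuous.continuousOn ?_) ?_ rfl ?_
    · refine continuous_formSpace fun x => ?_
      simp only [eval_substForm, hg, hf]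
      exact (MvPolynomial.continuous_eval _).comp (by fun_prop)
    · refine (toForm d).injective (Subtype.ext (MvPolynomial.funext fun x => ?_))
      simp only [eval_substForm, hg, hf]
      simp
    · rintro _ ⟨s, -, rfl⟩
      exact IsRealNonsingular.substForm hF (g s)

theorem isLinked_of_dotProduct_nonneg {w v : Fin 3 → ℝ} (hw : w ≠ 0) (hv : v ≠ 0)
    (h : 0 ≤ w ⬝ᵥ v) : IsLinked d w v := by
  refine (isLinked_of_dotProduct_pos (v := w + v) ?_).trans (isLinked_of_dotProduct_pos ?_)
  · rw [dotProduct_add]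
    linarith [dotProduct_self_pos_of_ne_zero hw]
  · rw [add_dotProduct]
    linarith [dotProduct_self_pos_of_ne_zero hv]

/-- Go through z or -z, where z is orthogonal to w; one of the two has nonnegative product with v.
This covers v on the ray opposite to w. -/
theorem isLinked (d : ℕ) {w v : Fin 3 → ℝ} (hw : w ≠ 0) (hv : v ≠ 0) : IsLinked d w v := by
  obtain ⟨z, hz, hwz⟩ := exists_ne_zero_dotProduct_eq_zero w
  rcases le_total 0 (z ⬝ᵥ v) with h | h
  · exact (isLinked_of_dotProduct_nonneg hw hz (by rw [dotProduct_comm, hwz])).trans (isLinked_of_dotProduct_nonneg hz hv h)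
  · refine (isLinked_of_dotProduct_nonneg hw (neg_ne_zero.2 hz) ?_).trans
      (isLinked_of_dotProduct_nonneg (neg_ne_zero.2 hz) hv ?_)
    · rw [dotProduct_neg, dotProduct_comm, hwz, neg_zero]
    · rw [neg_dotProduct]; linarith

end Substitution

/-! ### Joining forms by safe paths -/

section Joining

open Topology Filter

variable {d m n : ℕ}

/-- The Euclidean sphere is used because `eventually_gradAt_ne_zero` differentiates v·v. -/
theorem isRealNonsingular_iff_sphere (F : RealForm d) :
    IsRealNonsingular F.1 ↔ ∀ v ∈ {v : Fin 3 → ℝ | v ⬝ᵥ v = 1}, gradAt F.1 v ≠ 0 := by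
  refine ⟨fun h v hv => h v (by rintro rfl; simp at hv), fun h v hv hgrad => ?_⟩
  have h0 := dotProduct_self_pos_of_ne_zero hv
  refine h ((√(v ⬝ᵥ v))⁻¹ • v) ?_ ?_
  · have h1 : √(v ⬝ᵥ v) ≠ 0 := (Real.sqrt_pos.2 h0).ne'
    have h2 := Real.mul_self_sqrt h0.le
    simp only [mem_ofPred_eq, smul_dotProduct, dotProduct_smul, smul_eq_mul]
    field_simp
    rw [pow_two, h2]
  · rw [gradAt_smul_point F.2, hgrad, smul_zero]

theorem isCompact_dotProduct_self_eq_one : IsCompact {v : Fin 3 → ℝ | v ⬝ᵥ v = 1} := by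
  refine Metric.isCompact_of_isClosed_isBounded
    (isClosed_eq (by simp only [dotProduct]; fun_prop) continuous_const) ?_
  refine (Metric.isBounded_closedBall (x := (0 : Fin 3 → ℝ)) (r := 1)).subset fun v hv => ?_
  rw [mem_closedBall_zero_iff, pi_norm_le_iff_of_nonneg zero_le_one]
  intro i
  rw [Real.norm_eq_abs, ← sq_le_one_iff_abs_le_one]
  have h1 : v i * v i ≤ v ⬝ᵥ v :=
    Finset.single_le_sum (f := fun j => v j * v j) (fun j _ => mul_self_nonneg _)
      (Finset.mem_univ i)
  rw [mem_ofPred_eq] at hv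
  nlinarith

/-- A node on a generic path disappears at once. -/
theorem eventually_gradAt_ne_zero (hd : 1 ≤ d) {φ : ℝ → FormSpace d} (hφ : ContDiff ℝ ∞ φ) {t₀ : ℝ}
    (h : IsGenericForm (toForm d (φ t₀)) (toForm d (deriv φ t₀))) {v : Fin 3 → ℝ}
    (hv : v ≠ 0) (hgrad : gradAt (toForm d (φ t₀)).1 v = 0) :
    ∀ᶠ z : ℝ × (Fin 3 → ℝ) in 𝓝 (t₀, v),
      z.1 ≠ t₀ → z.2 ⬝ᵥ z.2 = v ⬝ᵥ v → gradAt (toForm d (φ z.1)).1 z.2 ≠ 0 := by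
  have hΦ : ContDiff ℝ ∞ (fun p : FormSpace d × (Fin 3 → ℝ) => gradAt (toForm d p.1).1 p.2) :=
    contDiff_gradAt_form
  have hin : ContDiff ℝ ∞ (fun z : ℝ × (Fin 3 → ℝ) => (φ z.1, z.2)) :=
    (hφ.comp contDiff_fst).prodMk contDiff_snd
  -- The component x·x removes the scaling freedom of the singular point. If the derivative of Ψ at
  -- (t₀, v) is injective, Ψ does not take its value there again nearby.
  obtain ⟨Ψ, hΨ⟩ : ∃ Ψ : ℝ × (Fin 3 → ℝ) → (Fin 3 → ℝ) × ℝ,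
      ∀ z, Ψ z = (gradAt (toForm d (φ z.1)).1 z.2, z.2 ⬝ᵥ z.2) := ⟨_, fun z => rfl⟩
  have hsmooth : ContDiff ℝ ∞ Ψ := by
    have h1 : ContDiff ℝ ∞ (fun z : ℝ × (Fin 3 → ℝ) => z.2 ⬝ᵥ z.2) := by
      simp only [dotProduct]; fun_prop
    have h2 := (hΦ.comp hin).prodMk h1
    exact (funext hΨ : Ψ = _) ▸ h2
  have hD := (hsmooth.differentiable (by simp)).differentiableAt (x := (t₀, v)) |>.hasFDerivAt
  set D := fderiv ℝ Ψ (t₀, v)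
  have hD1 : D (1, 0) = (gradAt (toForm d (deriv φ t₀)).1 v, 0) := by
    have h1 : HasDerivAt (fun t : ℝ => (t, v)) ((1 : ℝ), (0 : Fin 3 → ℝ)) t₀ :=
      (hasDerivAt_id' t₀).prodMk (hasDerivAt_const t₀ v)
    have h2 := hD.comp_hasDerivAt t₀ h1
    let L : FormSpace d →ₗ[ℝ] (Fin 3 → ℝ) := IsLinearMap.mk' (fun x => gradAt (toForm d x).1 v)
      ⟨fun x y => by simp, fun c x => by simp⟩
    have h3 : HasDerivAt (fun t => L (φ t)) (L (deriv φ t₀)) t₀ :=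
      L.toContinuousLinearMap.hasFDerivAt.comp_hasDerivAt t₀
        ((hφ.differentiable (by simp)).differentiableAt.hasDerivAt)
    have h4 := h3.prodMk (hasDerivAt_const t₀ (v ⬝ᵥ v))
    refine h2.unique (h4.congr_of_eventuallyEq (Eventually.of_forall fun t => ?_))
    rw [Function.comp_apply, hΨ]
    rfl
  have hD2 : ∀ y, ∀ z, (D (0, y)).1 ⬝ᵥ z = hessForm (toForm d (φ t₀)).1 v y z ∧
      (D (0, y)).2 = 2 * (v ⬝ᵥ y) := by
    intro y z
    have h1 : HasDerivAt (fun r : ℝ => (t₀, v + r • y)) ((0 : ℝ), y) 0 :=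
      (hasDerivAt_const _ t₀).prodMk
        (by simpa using ((hasDerivAt_id' (0 : ℝ)).smul_const y).const_add v)
    have h2 := HasFDerivAt.comp_hasDerivAt (l := Ψ) (l' := D) (0 : ℝ) (by simpa using hD) h1
    have h3 := hasDerivAt_gradAt_line (toForm d (φ t₀)).1 v y z 0
    have hfst := (hasFDerivAt_fst (𝕜 := ℝ) (p := Ψ (t₀, v + (0 : ℝ) • y))).comp_hasDerivAt (0 : ℝ) h2
    have hsnd := (hasFDerivAt_snd (𝕜 := ℝ) (p := Ψ (t₀, v + (0 : ℝ) • y))).comp_hasDerivAt (0 : ℝ) h2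
    constructor
    · have h4 : HasDerivAt (fun r : ℝ => gradAt (toForm d (φ t₀)).1 (v + r • y) ⬝ᵥ z)
          ((D (0, y)).1 ⬝ᵥ z) 0 := by
        have h5 := HasDerivAt.fun_sum (u := Finset.univ) fun i _ =>
          ((hasDerivAt_pi.1 hfst i).mul_const (z i))
        refine h5.congr_of_eventuallyEq (Eventually.of_forall fun r => ?_)
        simp only [Function.comp_apply, hΨ, dotProduct]
      simpa using h4.unique h3
    · have h4 : HasDerivAt (fun r : ℝ => (v + r • y) ⬝ᵥ (v + r • y)) ((D (0, y)).2) 0 := by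
        refine hsnd.congr_of_eventuallyEq (Eventually.of_forall fun r => ?_)
        simp only [Function.comp_apply, hΨ]
      have h6 : ∀ i, HasDerivAt (fun r : ℝ => v i + r * y i) (y i) 0 := fun i => by
        simpa using ((hasDerivAt_id' (0 : ℝ)).mul_const (y i)).const_add (v i)
      have h5 := HasDerivAt.fun_sum (u := Finset.univ) fun i _ => (h6 i).fun_mul (h6 i)
      have h7 := h4.unique h5
      rw [h7, dotProduct, Finset.mul_sum]
      exact Finset.sum_congr rfl fun i _ => by ring
  have hker : (D : ℝ × (Fin 3 → ℝ) →ₗ[ℝ] (Fin 3 → ℝ) × ℝ).ker = ⊥ := by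
    refine (LinearMap.ker_eq_bot' (f := (D : ℝ × (Fin 3 → ℝ) →ₗ[ℝ] (Fin 3 → ℝ) × ℝ))).2 ?_
    rintro ⟨τ, y⟩ hz
    have h1 : D (τ, y) = τ • D (1, 0) + D (0, y) := by
      rw [← map_smul, ← map_add]; simp
    have h0 : τ • D (1, 0) + D (0, y) = 0 := by rw [← h1]; exact hz
    rw [hD1] at h0
    have hval : ∀ z, τ * (gradAt (toForm d (deriv φ t₀)).1 v ⬝ᵥ z) +
        hessForm (toForm d (φ t₀)).1 v y z = 0 := fun z => by
      have := congrArg (fun p => p.1 ⬝ᵥ z) h0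
      simpa [add_dotProduct, (hD2 y z).1] using this
    -- Pairing with v eliminates y, because the Hessian kills v; what remains is τ d times the
    -- velocity at the node. After τ = 0, the vector y lies in the kernel of the Hessian, so it is a
    -- multiple of v, and it is orthogonal to v.
    have hτ : τ = 0 := by
      have := hval v
      rw [gradAt_dotProduct_self (toForm d (deriv φ t₀)).2, hessForm,
        hessian_mulVec_self (toForm d (φ t₀)).2, hgrad, smul_zero, dotProduct_zero, add_zero,
        aeval_eq_eval] at this
      have hd0 : (d : ℝ) ≠ 0 := by exact_mod_cast (by omega : d ≠ 0)
      have hvel : eval v (toForm d (deriv φ t₀)).1 ≠ 0 := fun h' => h.velocity ⟨v, hv, hgrad, h'⟩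
      simpa [hd0, hvel] using this
    have hy : (hessian (toForm d (φ t₀)).1 v).mulVec y = 0 := by
      rw [← dotProduct_eq_zero_iff]
      intro z
      have := hval z
      rw [hτ, zero_mul, zero_add, hessForm_comm, hessForm, dotProduct_comm] at this
      exact this
    obtain ⟨c, rfl⟩ := h.mulVec_eq_zero hd hv hgrad hy
    have h2 := congrArg Prod.snd h0
    simp [(hD2 (c • v) 0).2, hτ] at h2
    rcases h2 with h2 | h2
    · simp [h2, hτ]
    · exact absurd h2 hv
  obtain ⟨K, -, hK⟩ := LinearMap.exists_antilipschitzWith _ hker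
  have hne := hD.eventually_ne (c := Ψ (t₀, v)) ⟨K, hK⟩
  rw [eventually_nhdsWithin_iff] at hne
  filter_upwards [hne] with z hz hz1 hz2 hz3
  refine hz (fun h => hz1 (by rw [h])) ?_
  rw [hΨ, hΨ, hz3, hz2, hgrad]

theorem eventually_isRealNonsingular (hd : 1 ≤ d) {φ : ℝ → FormSpace d} (hφ : ContDiff ℝ ∞ φ)
    {t₀ : ℝ} (h : IsGenericForm (toForm d (φ t₀)) (toForm d (deriv φ t₀))) :
    ∀ᶠ t in 𝓝 t₀, t ≠ t₀ → φ t ∈ realNonsingularForms d := by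
  have key : ∀ᶠ t in 𝓝 t₀, ∀ v ∈ {v : Fin 3 → ℝ | v ⬝ᵥ v = 1},
      t ≠ t₀ → v ⬝ᵥ v = 1 → gradAt (toForm d (φ t)).1 v ≠ 0 := by
    refine isCompact_dotProduct_self_eq_one.eventually_forall_of_forall_eventually fun v hv => ?_
    have hv0 : v ≠ 0 := by rintro rfl; simp at hv
    by_cases hgrad : gradAt (toForm d (φ t₀)).1 v = 0
    · have := eventually_gradAt_ne_zero hd hφ h hv0 hgrad
      rwa [show v ⬝ᵥ v = 1 from hv] at this
    · have hΦ : Continuous fun p : FormSpace d × (Fin 3 → ℝ) => gradAt (toForm d p.1).1 p.2 :=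
        (contDiff_gradAt_form (d := d) (k := 0)).continuous
      have hin : Continuous (fun z : ℝ × (Fin 3 → ℝ) => (φ z.1, z.2)) :=
        (hφ.continuous.comp continuous_fst).prodMk continuous_snd
      filter_upwards [(hΦ.comp hin).continuousAt.eventually_ne (x := (t₀, v)) hgrad] with z hz _ _
      exact hz
  filter_upwards [key] with t ht hne
  exact (isRealNonsingular_iff_sphere _).2 fun v hv => ht v hv hne hv

end Joining

/-! ### Avoiding unsafe nodes by linear substitutions -/

section Joining

open Topology Filter

variable {d m n : ℕ}

/-- The forms which are safe with respect to `Q`. -/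
def safeForms (d : ℕ) (Q : MvPolynomial (Fin 3) ℝ) : Set (FormSpace d) :=
  {F | IsSafe (toForm d F).1 Q}

theorem realNonsingularForms_subset (Q : MvPolynomial (Fin 3) ℝ) :
    realNonsingularForms d ⊆ safeForms d Q := fun _ hF v hv hgrad => absurd hgrad (hF v hv)

theorem isOpen_safeForms (hmn : Even (m + n)) (G : FormSpace n) :
    IsOpen (safeForms m (toForm n G).1) :=
  (isOpen_isSafe hmn).preimage (Continuous.prodMk_left G)

/-- Otherwise the Hessian vanishes by polarization, and its kernel is larger than the line of v. -/
theorem exists_hessForm_ne_zero (hd : 1 ≤ d) {F F' : RealForm d} (h : IsGenericForm F F')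
    {v : Fin 3 → ℝ} (hv : v ≠ 0) (hgrad : gradAt F.1 v = 0) : ∃ y, hessForm F.1 v y y ≠ 0 := by
  by_contra! H
  have hpol : ∀ y z, hessForm F.1 v y z = 0 := fun y z => by
    have h1 := H (y + z)
    have h2 := H y
    have h3 := H z
    have h4 := hessForm_comm F.1 v y z
    simp only [hessForm, Matrix.mulVec_add, add_dotProduct, dotProduct_add] at h1 h2 h3 h4 ⊢
    linarith
  have h0 : ∀ w, (hessian F.1 v).mulVec w = 0 := fun w => by
    rw [← dotProduct_eq_zero_iff]
    intro z
    rw [dotProduct_comm]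
    exact hpol z w
  obtain ⟨z, hz, hvz⟩ := exists_ne_zero_dotProduct_eq_zero v
  obtain ⟨c, rfl⟩ := h.mulVec_eq_zero hd hv hgrad (h0 z)
  rw [smul_dotProduct, smul_eq_mul] at hvz
  exact (mul_ne_zero (fun h => hz (by rw [h, zero_smul])) (dotProduct_self_pos_of_ne_zero hv).ne')
    hvz

/-- A real nonsingular form with a real zero takes both signs. -/
theorem exists_mul_eval_pos {P : MvPolynomial (Fin 3) ℝ} (hP : IsRealNonsingular P)
    {p : Fin 3 → ℝ} (hp : p ≠ 0) (hPp : eval p P = 0) {σ : ℝ} (hσ : σ ≠ 0) :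
    ∃ w, 0 < eval w P * σ := by
  have h1 := hasDerivAt_eval_line P p (σ • gradAt P p) 0
  have h2 : 0 < (gradAt P p ⬝ᵥ (σ • gradAt P p)) * σ := by
    rw [dotProduct_smul, smul_eq_mul]
    have := dotProduct_self_pos_of_ne_zero (hP p hp)
    have := mul_pos this (mul_self_pos.2 hσ)
    linarith
  have h3 := (h1.mul_const σ)
  by_contra! H
  -- If σP were nowhere positive, its zero at p would be a maximum along the line in direction σ∇P,
  -- where its derivative is σ²|∇P|² > 0.
  have h4 : IsLocalMax (fun r : ℝ => eval (p + r • σ • gradAt P p) P * σ) 0 :=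
    Eventually.of_forall fun r => by
      simp only [zero_smul, add_zero, hPp, zero_mul]
      exact H _
  have h5 := h4.hasDerivAt_eq_zero h3
  simp only [zero_smul, add_zero] at h5
  exact h2.ne' h5

/-- The node of a generic form can be moved by a substitution to a point where it is safe. -/
theorem exists_substForm_mem_safeForms (hmn : Even (m + n)) (hm : 1 ≤ m) (hn : 1 ≤ n)
    {G : FormSpace n} (hG : G ∈ realNonsingularForms n) {p : Fin 3 → ℝ} (hp : p ≠ 0)
    (hGp : eval p (toForm n G).1 = 0) {F : FormSpace m} {F' : RealForm m}
    (hF : IsGenericForm (toForm m F) F') :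
    ∃ h : (Fin 3 → ℝ) ≃ₗ[ℝ] (Fin 3 → ℝ), substForm m h F ∈ safeForms m (toForm n G).1 ∧
      ∀ F ∈ realNonsingularForms m, JoinedIn (realNonsingularForms m) F (substForm m h F) := by
  -- The node of F if there is one, an arbitrary nonzero vector otherwise.
  obtain ⟨v, hv, hlink⟩ : ∃ v : Fin 3 → ℝ, v ≠ 0 ∧ ((∃ x : Fin 3 → ℝ, x ≠ 0 ∧
      gradAt (toForm m F).1 x = 0) → gradAt (toForm m F).1 v = 0) := by
    by_cases h : ∃ x : Fin 3 → ℝ, x ≠ 0 ∧ gradAt (toForm m F).1 x = 0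
    · obtain ⟨x, hx⟩ := h
      exact ⟨x, hx.1, fun _ => hx.2⟩
    · exact ⟨p, hp, fun h' => absurd h' h⟩
  obtain ⟨w, hw, hwv⟩ : ∃ w : Fin 3 → ℝ, w ≠ 0 ∧ (gradAt (toForm m F).1 v = 0 →
      ∃ y, 0 < eval w (toForm n G).1 * hessForm (toForm m F).1 v y y) := by
    by_cases hgrad : gradAt (toForm m F).1 v = 0
    · obtain ⟨y, hy⟩ := exists_hessForm_ne_zero hm hF hv hgrad
      obtain ⟨w, hw⟩ := exists_mul_eval_pos hG hp hGp hy
      refine ⟨w, ?_, fun _ => ⟨y, hw⟩⟩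
      rintro rfl
      have := aeval_smul_of_isHomogeneous (toForm n G).2 (0 : ℝ) (0 : Fin 3 → ℝ)
      rw [smul_zero, zero_pow (by omega), zero_mul, aeval_eq_eval] at this
      rw [this, zero_mul] at hw
      exact hw.false
    · exact ⟨v, hv, fun h => absurd h hgrad⟩
  -- The sign of G at w is that of a nonzero value of the Hessian at v. Since h takes the ray of w
  -- to that of v, the substituted form has its node at w.
  obtain ⟨h, c, hc, hwc, hjoin⟩ := isLinked m hw hv
  refine ⟨h, fun x hx hgrad => ?_, hjoin⟩
  have hgrad' := gradAt_substForm_eq_zero h hgrad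
  have hgv := hlink ⟨h x, by simpa using hx, hgrad'⟩
  obtain ⟨y, hy⟩ := hwv hgv
  obtain ⟨a, ha⟩ := hF.exists_smul_eq hm hv hgv hgrad'
  have hxw : x = (a * c⁻¹) • w := by
    apply h.injective
    rw [ha, map_smul, hwc, smul_smul, mul_assoc, inv_mul_cancel₀ hc.ne', mul_one]
  have hac : a * c⁻¹ ≠ 0 := fun h0 => hx (by rw [hxw, h0, zero_smul])
  rw [hxw]
  refine exists_pos_smul_point hmn _ _ hac ⟨h.symm y, ?_⟩
  rw [hessForm_substForm]
  simp only [LinearEquiv.coe_coe, LinearEquiv.apply_symm_apply]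
  rw [hwc, hessForm, hessian_smul_point (toForm m F).2, Matrix.smul_mulVec, dotProduct_smul,
    smul_eq_mul]
  rw [hessForm] at hy
  have := mul_pos (pow_pos hc (m - 1 - 1)) hy
  linarith

/-- The real nonsingular forms on a short generic path are joined by safe forms. -/
theorem exists_pos_joinedIn_safeForms (hmn : Even (m + n)) (hm : 1 ≤ m) (hn : 1 ≤ n)
    {G : FormSpace n} (hG : G ∈ realNonsingularForms n) {p : Fin 3 → ℝ} (hp : p ≠ 0)
    (hGp : eval p (toForm n G).1 = 0) {φ : ℝ → FormSpace m} (hφ : ContDiff ℝ ∞ φ) {t₀ : ℝ}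
    (ht₀ : φ t₀ ∈ realNonsingularForms m ∨
      IsGenericForm (toForm m (φ t₀)) (toForm m (deriv φ t₀))) :
    ∃ δ > 0, ∀ s t, |s - t₀| < δ → |t - t₀| < δ →
      (s ≠ t₀ ∨ φ t₀ ∈ realNonsingularForms m) → (t ≠ t₀ ∨ φ t₀ ∈ realNonsingularForms m) →
      JoinedIn (safeForms m (toForm n G).1) (φ s) (φ t) := by
  have segment : ∀ (T : FormSpace m →ₗ[ℝ] FormSpace m) (s t δ : ℝ),
      (∀ t, |t - t₀| < δ → T (φ t) ∈ safeForms m (toForm n G).1) → |s - t₀| < δ → |t - t₀| < δ →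
      JoinedIn (safeForms m (toForm n G).1) (T (φ s)) (T (φ t)) := by
    intro T s t δ hδ hs ht
    have hcont : Continuous fun t => T (φ t) :=
      T.toContinuousLinearMap.continuous.comp hφ.continuous
    have hpc := (((convex_ball t₀ δ).isPathConnected
      ⟨s, by rwa [Metric.mem_ball, Real.dist_eq]⟩).image hcont)
    refine (hpc.joinedIn _ ⟨s, by rwa [Metric.mem_ball, Real.dist_eq], rfl⟩ _
      ⟨t, by rwa [Metric.mem_ball, Real.dist_eq], rfl⟩).mono ?_
    rintro _ ⟨r, hr, rfl⟩
    exact hδ r (by rwa [Metric.mem_ball, Real.dist_eq] at hr)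
  have near : ∀ T : FormSpace m →ₗ[ℝ] FormSpace m, T (φ t₀) ∈ safeForms m (toForm n G).1 →
      ∀ᶠ t in 𝓝 t₀, T (φ t) ∈ safeForms m (toForm n G).1 := fun T hT => by
    have hcont : Continuous fun t => T (φ t) :=
      T.toContinuousLinearMap.continuous.comp hφ.continuous
    exact hcont.continuousAt.eventually_mem ((isOpen_safeForms hmn G).mem_nhds hT)
  by_cases hreal : φ t₀ ∈ realNonsingularForms m
  · obtain ⟨δ, hδ, H⟩ := Metric.eventually_nhds_iff.1
      (near LinearMap.id (realNonsingularForms_subset _ hreal))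
    refine ⟨δ, hδ, fun s t hs ht _ _ => segment LinearMap.id s t δ (fun r hr => H ?_) hs ht⟩
    rwa [Real.dist_eq]
  · have hgen := ht₀.resolve_left hreal
    obtain ⟨h, hmem, hjoin⟩ := exists_substForm_mem_safeForms hmn hm hn hG hp hGp hgen
    obtain ⟨δ, hδ, H⟩ := Metric.eventually_nhds_iff.1
      ((near _ hmem).and (eventually_isRealNonsingular hm hφ hgen))
    refine ⟨δ, hδ, fun s t hs ht hs' ht' => ?_⟩
    have hs1 := (H (by rwa [Real.dist_eq] : dist s t₀ < δ)).2 (hs'.resolve_right hreal)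
    have ht1 := (H (by rwa [Real.dist_eq] : dist t t₀ < δ)).2 (ht'.resolve_right hreal)
    -- The detour: from φ s to its image under h through real nonsingular forms, across the safe
    -- node along the image of the path, and back from the image of φ t to φ t.
    have h1 := (hjoin _ hs1).mono (realNonsingularForms_subset (toForm n G).1)
    have h2 := (hjoin _ ht1).mono (realNonsingularForms_subset (toForm n G).1)
    exact (h1.trans (segment _ s t δ (fun r hr => (H (by rwa [Real.dist_eq])).1) hs ht)).trans
      h2.symm

/-- Nodal times must be skipped, hence the punctured neighbourhoods. Two steps of the chain over the
connected interval are composed at a common time, which exists because punctured neighbourhoods in ℝ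
are nonempty. -/
theorem rel_of_locally {J : ℝ → ℝ → Prop} (trans : ∀ s t u, J s t → J t u → J s u)
    (hloc : ∀ a ∈ Icc (0 : ℝ) 1,
      ∃ δ > 0, ∀ s t, |s - a| < δ → |t - a| < δ → s ≠ a → t ≠ a → J s t) :
    ∀ᶠ s in 𝓝[≠] (0 : ℝ), ∀ᶠ t in 𝓝[≠] (1 : ℝ), J s t := by
  refine isPreconnected_Icc.induction₂' (s := Icc (0 : ℝ) 1)
    (fun a b => ∀ᶠ s in 𝓝[≠] a, ∀ᶠ t in 𝓝[≠] b, J s t) (fun a ha => ?_) ?_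
    (left_mem_Icc.2 zero_le_one) (right_mem_Icc.2 zero_le_one)
  · obtain ⟨δ, hδ, H⟩ := hloc a ha
    have hball : ∀ b, |b - a| < δ → ∀ᶠ s in 𝓝[≠] b, |s - a| < δ ∧ s ≠ a := by
      intro b hb
      have hb' : ∀ᶠ t in 𝓝 b, |t - a| < δ :=
        (by fun_prop : Continuous fun t => |t - a|).continuousAt.eventually_lt_const hb
      have hne : ∀ᶠ t in 𝓝[≠] b, t ≠ a := by
        rcases eq_or_ne b a with rfl | hba
        · exact self_mem_nhdsWithin
        · exact nhdsWithin_le_nhds (eventually_ne_nhds hba)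
      exact (hb'.filter_mono nhdsWithin_le_nhds).and hne
    have ha' := hball a (by simpa using hδ)
    have hnear : ∀ᶠ b in 𝓝[Icc 0 1] a, |b - a| < δ := by
      refine Eventually.filter_mono nhdsWithin_le_nhds ?_
      exact (by fun_prop : Continuous fun t => |t - a|).continuousAt.eventually_lt_const
        (by simpa using hδ)
    filter_upwards [hnear] with b hb
    have hb' := hball b hb
    constructor
    · filter_upwards [ha'] with s hs
      filter_upwards [hb'] with t ht
      exact H s t hs.1 ht.1 hs.2 ht.2
    · filter_upwards [hb'] with s hs
      filter_upwards [ha'] with t ht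
      exact H s t hs.1 ht.1 hs.2 ht.2
  · intro a b c _ _ _ hab hbc
    filter_upwards [hab] with s hs
    obtain ⟨t, hst, htu⟩ := (hs.and hbc).exists
    exact htu.mono fun u hu => trans s t u hst hu

/-- Any two real nonsingular forms are joined by forms which are safe with respect to a given real
nonsingular form with real zeros. -/
theorem joinedIn_safeForms (hmn : Even (m + n)) (hm : 1 ≤ m) (hn : 1 ≤ n) {G : FormSpace n}
    (hG : G ∈ realNonsingularForms n) {p : Fin 3 → ℝ} (hp : p ≠ 0)
    (hGp : eval p (toForm n G).1 = 0) {F₀ F₁ : FormSpace m} (hF₀ : F₀ ∈ realNonsingularForms m)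
    (hF₁ : F₁ ∈ realNonsingularForms m) : JoinedIn (safeForms m (toForm n G).1) F₀ F₁ := by
  let γ : ℝ → FormSpace m := fun t => F₀ + t • (F₁ - F₀)
  have hγ : ∀ k : WithTop ℕ∞, ContDiff ℝ k γ := fun k => by fun_prop
  have := formSpace_nontrivial m
  -- The size of the perturbation is irrelevant, since this path need not stay in a given set.
  obtain ⟨q, -, hq⟩ := (isAvoidable_not_isGenericForm (hγ 2) hm
    (toForm m).toLinearMap (toForm m).surjective).exists_perturb one_pos
  set φ := perturb γ q
  have hφ : ContDiff ℝ ∞ φ := contDiff_perturb (hγ ∞) q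
  have h0 : φ 0 = F₀ := by simp [φ, γ]
  have h1 : φ 1 = F₁ := by simp [φ, γ]
  have hloc : ∀ t ∈ Icc (0 : ℝ) 1, φ t ∈ realNonsingularForms m ∨
      IsGenericForm (toForm m (φ t)) (toForm m (deriv φ t)) := by
    intro t ht
    rcases mem_Icc_cases ht with rfl | rfl | ht
    · exact Or.inl (h0 ▸ hF₀)
    · exact Or.inl (h1 ▸ hF₁)
    · exact Or.inr (not_not.1 (hq t ht))
  have hrel := rel_of_locally
    (J := fun s t => JoinedIn (safeForms m (toForm n G).1) (φ s) (φ t))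
    (fun s t u h h' => h.trans h') fun a ha => by
      obtain ⟨δ, hδ, H⟩ := exists_pos_joinedIn_safeForms hmn hm hn hG hp hGp hφ (hloc a ha)
      exact ⟨δ, hδ, fun s t hs ht hs' ht' => H s t hs ht (Or.inl hs') (Or.inl ht')⟩
  have hend : ∀ a ∈ Icc (0 : ℝ) 1, φ a ∈ realNonsingularForms m →
      ∀ᶠ s in 𝓝[≠] a, JoinedIn (safeForms m (toForm n G).1) (φ a) (φ s) := by
    intro a ha haφ
    obtain ⟨δ, hδ, H⟩ := exists_pos_joinedIn_safeForms hmn hm hn hG hp hGp hφ (hloc a ha)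
    have : ∀ᶠ s in 𝓝 a, |s - a| < δ :=
      (by fun_prop : Continuous fun t => |t - a|).continuousAt.eventually_lt_const
        (by simpa using hδ)
    filter_upwards [nhdsWithin_le_nhds this] with s hs
    exact H a s (by simpa using hδ) hs (Or.inr haφ) (Or.inr haφ)
  obtain ⟨s, hs, hs'⟩ := (hrel.and (hend 0 (by simp) (h0 ▸ hF₀))).exists
  obtain ⟨t, ht, ht'⟩ := (hs.and (hend 1 (by simp) (h1 ▸ hF₁))).exists
  rw [h0] at hs'
  rw [h1] at ht'
  exact (hs'.trans ht).trans ht'.symm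

theorem joinedIn_safePairs_left (hmn : Even (m + n)) (hm : 1 ≤ m) (hn : 1 ≤ n) {G : FormSpace n}
    (hG : G ∈ realNonsingularForms n) {p : Fin 3 → ℝ} (hp : p ≠ 0)
    (hGp : eval p (toForm n G).1 = 0) {F₀ F₁ : FormSpace m} (hF₀ : F₀ ∈ realNonsingularForms m)
    (hF₁ : F₁ ∈ realNonsingularForms m) : JoinedIn (safePairs m n) (F₀, G) (F₁, G) := by
  refine ((joinedIn_safeForms hmn hm hn hG hp hGp hF₀ hF₁).map (f := fun F => (F, G))
    (Continuous.prodMk_left G)).mono ?_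
  rintro _ ⟨F, hF, rfl⟩
  exact ⟨hF, realNonsingularForms_subset _ hG⟩

theorem joinedIn_safePairs_right (hmn : Even (m + n)) (hm : 1 ≤ m) (hn : 1 ≤ n) {F : FormSpace m}
    (hF : F ∈ realNonsingularForms m) {p : Fin 3 → ℝ} (hp : p ≠ 0)
    (hFp : eval p (toForm m F).1 = 0) {G₀ G₁ : FormSpace n} (hG₀ : G₀ ∈ realNonsingularForms n)
    (hG₁ : G₁ ∈ realNonsingularForms n) : JoinedIn (safePairs m n) (F, G₀) (F, G₁) := by
  refine ((joinedIn_safeForms (add_comm m n ▸ hmn) hn hm hF hp hFp hG₀ hG₁).map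
    (f := fun G => (F, G)) (Continuous.prodMk_right F)).mono ?_
  rintro _ ⟨G, hG, rfl⟩
  exact ⟨realNonsingularForms_subset _ hF, hG⟩

/-- The Fermat form `xᵈ + yᵈ - zᵈ` is real nonsingular and has real zeros. -/
theorem exists_realNonsingularForm (hd : 1 ≤ d) : ∃ F ∈ realNonsingularForms d,
    ∃ p : Fin 3 → ℝ, p ≠ 0 ∧ eval p (toForm d F).1 = 0 := by
  let P : MvPolynomial (Fin 3) ℝ := X 0 ^ d + X 1 ^ d - X 2 ^ d
  have hX : ∀ i : Fin 3, (X i ^ d : MvPolynomial (Fin 3) ℝ).IsHomogeneous d := fun i => by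
    simpa using (isHomogeneous_X ℝ i).pow d
  have hP : P.IsHomogeneous d := ((hX 0).add (hX 1)).sub (hX 2)
  have hd0 : (d : ℝ) ≠ 0 := by exact_mod_cast (by omega : d ≠ 0)
  refine ⟨(toForm d).symm ⟨P, hP⟩, ?_, ![1, 0, 1], by simp, ?_⟩
  · simp only [realNonsingularForms, mem_ofPred_eq, LinearEquiv.apply_symm_apply]
    intro v hv hgrad
    have h : ∀ i, v i ^ (d - 1) = 0 := fun i => by
      have := congrFun hgrad i
      fin_cases i <;> simpa [gradAt, P, pderiv_pow, pderiv_X, Pi.single_apply, hd0] using this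
    exact hv (funext fun i => eq_zero_of_pow_eq_zero (h i))
  · simp [P, show d ≠ 0 by omega]

/-- Only a factor with real zeros may be kept fixed. If the factors with zeros at the two ends are
on different sides, two moves suffice. If they are on the same side, the other factor is first moved
to a Fermat form, which then stays fixed for the second move. -/
theorem joinedIn_safePairs (hmn : Even (m + n)) (hm : 1 ≤ m) (hn : 1 ≤ n) {F₀ F₁ : FormSpace m}
    (hF₀ : F₀ ∈ realNonsingularForms m) (hF₁ : F₁ ∈ realNonsingularForms m) {G₀ G₁ : FormSpace n}
    (hG₀ : G₀ ∈ realNonsingularForms n) (hG₁ : G₁ ∈ realNonsingularForms n)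
    {p₀ p₁ : Fin 3 → ℝ} (hp₀ : p₀ ≠ 0) (hp₁ : p₁ ≠ 0)
    (h₀ : eval p₀ (toForm m F₀).1 = 0 ∨ eval p₀ (toForm n G₀).1 = 0)
    (h₁ : eval p₁ (toForm m F₁).1 = 0 ∨ eval p₁ (toForm n G₁).1 = 0) :
    JoinedIn (safePairs m n) (F₀, G₀) (F₁, G₁) := by
  rcases h₀ with h₀ | h₀ <;> rcases h₁ with h₁ | h₁
  · obtain ⟨G, hG, p, hp, hGp⟩ := exists_realNonsingularForm hn
    exact ((joinedIn_safePairs_right hmn hm hn hF₀ hp₀ h₀ hG₀ hG).trans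
      (joinedIn_safePairs_left hmn hm hn hG hp hGp hF₀ hF₁)).trans
      (joinedIn_safePairs_right hmn hm hn hF₁ hp₁ h₁ hG hG₁)
  · exact (joinedIn_safePairs_right hmn hm hn hF₀ hp₀ h₀ hG₀ hG₁).trans
      (joinedIn_safePairs_left hmn hm hn hG₁ hp₁ h₁ hF₀ hF₁)
  · exact (joinedIn_safePairs_left hmn hm hn hG₀ hp₀ h₀ hF₀ hF₁).trans
      (joinedIn_safePairs_right hmn hm hn hF₁ hp₁ h₁ hG₀ hG₁)
  · obtain ⟨F, hF, p, hp, hFp⟩ := exists_realNonsingularForm hm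
    exact ((joinedIn_safePairs_left hmn hm hn hG₀ hp₀ h₀ hF₀ hF).trans
      (joinedIn_safePairs_right hmn hm hn hF hp hFp hG₀ hG₁)).trans
      (joinedIn_safePairs_left hmn hm hn hG₁ hp₁ h₁ hF hF₁)

end Joining

/-! ### From a path of safe pairs to a nodal deformation -/

section Deformation

open Topology

variable {d m n : ℕ}

/-- Points in a connected component of an open set are joined by smooth paths. -/
theorem JoinedIn.exists_contDiff {E : Type*} [NormedAddCommGroup E] [NormedSpace ℝ E] {U : Set E}
    (hU : IsOpen U) {x y : E} (h : JoinedIn U x y) :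
    ∃ γ : ℝ → E, (∀ k : WithTop ℕ∞, ContDiff ℝ k γ) ∧ γ 0 = x ∧ γ 1 = y ∧
      ∀ t ∈ Icc (0 : ℝ) 1, γ t ∈ U := by
  obtain ⟨c, hc⟩ := h
  have hcompact : IsCompact (range c) := isCompact_range c.continuous
  obtain ⟨δ, hδ, hsub⟩ := hcompact.exists_thickening_subset_open hU (by
    rintro _ ⟨t, rfl⟩; exact hc t)
  -- Bernstein polynomials keep the end points of the path; at 1 this needs N ≠ 0.
  obtain ⟨N, hN0, hb⟩ : ∃ N ≠ 0, dist (bernsteinApproximation N c.toContinuousMap)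
      c.toContinuousMap < δ := by
    obtain ⟨N, hN⟩ := (Metric.tendsto_atTop.1
      (bernsteinApproximation_uniform c.toContinuousMap)) δ hδ
    exact ⟨N + 1, N.succ_ne_zero, hN _ N.le_succ⟩
  let γ : ℝ → E := fun t => ∑ k : Fin (N + 1),
    ((N.choose k : ℝ) * t ^ (k : ℕ) * (1 - t) ^ (N - k)) • c (bernstein.z k)
  have hγ : ∀ t : unitInterval, γ t = bernsteinApproximation N c.toContinuousMap t := fun t => by
    rw [bernsteinApproximation.apply]
    exact Finset.sum_congr rfl fun k _ => by rw [bernstein_apply]; rfl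
  refine ⟨γ, fun k => by fun_prop, ?_, ?_, fun t ht => ?_⟩
  · rw [show (0 : ℝ) = ((0 : unitInterval) : ℝ) from rfl, hγ, bernsteinApproximation.apply_zero]
    exact c.source
  · rw [show (1 : ℝ) = ((1 : unitInterval) : ℝ) from rfl, hγ, bernsteinApproximation.apply_one hN0]
    exact c.target
  · refine hsub (Metric.mem_thickening_iff.2 ⟨c ⟨t, ht⟩, mem_range_self _, ?_⟩)
    rw [show γ t = _ from hγ ⟨t, ht⟩]
    exact (ContinuousMap.dist_apply_le_dist _).trans_lt hb

/-- Points in a connected component of an open set are joined by smooth paths in general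
position. -/
theorem JoinedIn.exists_contDiff_of_isAvoidable {E : Type*} [NormedAddCommGroup E]
    [NormedSpace ℝ E] [FiniteDimensional ℝ E] {U : Set E} (hU : IsOpen U) {x y : E}
    (h : JoinedIn U x y) {Q : E → E → Prop}
    (hQ : ∀ γ : ℝ → E, ContDiff ℝ 2 γ → IsAvoidable γ Q) :
    ∃ γ : ℝ → E, ContDiff ℝ ∞ γ ∧ γ 0 = x ∧ γ 1 = y ∧ (∀ t ∈ Icc (0 : ℝ) 1, γ t ∈ U) ∧
      ∀ t ∈ Ioo (0 : ℝ) 1, ¬ Q (γ t) (deriv γ t) := by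
  obtain ⟨γ, hγ, h0, h1, hγU⟩ := h.exists_contDiff hU
  have hcompact : IsCompact (γ '' Icc 0 1) := isCompact_Icc.image (hγ 0).continuous
  obtain ⟨δ, hδ, hsub⟩ := hcompact.exists_thickening_subset_open hU (by
    rintro _ ⟨t, ht, rfl⟩; exact hγU t ht)
  obtain ⟨p, hp, hpQ⟩ := (hQ γ (hγ 2)).exists_perturb hδ
  refine ⟨perturb γ p, contDiff_perturb (hγ _) p, by simp [h0], by simp [h1], fun t ht => ?_, hpQ⟩
  exact hsub (Metric.mem_thickening_iff.2 ⟨γ t, mem_image_of_mem γ ht, hp t ht⟩)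

theorem deriv_fst_snd {E F : Type*} [NormedAddCommGroup E] [NormedSpace ℝ E]
    [NormedAddCommGroup F] [NormedSpace ℝ F] {γ : ℝ → E × F} {t : ℝ}
    (h : DifferentiableAt ℝ γ t) : deriv (fun t => (γ t).1) t = (deriv γ t).1 ∧
      deriv (fun t => (γ t).2) t = (deriv γ t).2 :=
  ⟨((hasFDerivAt_fst (𝕜 := ℝ) (p := γ t)).comp_hasDerivAt t h.hasDerivAt).deriv,
    ((hasFDerivAt_snd (𝕜 := ℝ) (p := γ t)).comp_hasDerivAt t h.hasDerivAt).deriv⟩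

theorem isAvoidable_not_generic (hm : 1 ≤ m) (hn : 1 ≤ n) (γ : ℝ → FormSpace m × FormSpace n)
    (hγ : ContDiff ℝ 2 γ) : IsAvoidable γ fun x y =>
      ¬ IsGenericForm (toForm m x.1) (toForm m y.1) ∨
      ¬ IsGenericForm (toForm n x.2) (toForm n y.2) ∨
      ¬ IsGenericPair (toForm m x.1) (toForm n x.2) := by
  have := formSpace_nontrivial m
  refine (isAvoidable_not_isGenericForm hγ hm
    ((toForm m).toLinearMap ∘ₗ LinearMap.fst ℝ _ _) ?_).or
    ((isAvoidable_not_isGenericForm hγ hn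
    ((toForm n).toLinearMap ∘ₗ LinearMap.snd ℝ _ _) ?_).or
    (isAvoidable_not_isGenericPair hγ hm hn
    ((toForm m).toLinearMap ∘ₗ LinearMap.fst ℝ _ _)
    ((toForm n).toLinearMap ∘ₗ LinearMap.snd ℝ _ _) fun F G => ?_))
  · exact (toForm m).surjective.comp Prod.fst_surjective
  · exact (toForm n).surjective.comp Prod.snd_surjective
  · exact ⟨((toForm m).symm F, (toForm n).symm G), by simp⟩

theorem IsNonsingularCurve.isRealNonsingular (hd : 1 ≤ d) {F : RealForm d} {hF : F ≠ 0}
    (h : IsNonsingularCurve (Projectivization.mk ℝ F hF)) : IsRealNonsingular F.1 := by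
  intro v hv hgrad
  refine h (fun i => (v i : ℂ)) ((isSingularPoint_mk hd F hF _).2
    ⟨fun h => hv ?_, gradAt_ofReal_eq_zero.2 hgrad⟩)
  ext i
  simpa using congrFun h i

theorem exists_eval_eq_zero {F : RealForm m} {hF : F ≠ 0} {G : RealForm n} {hG : G ≠ 0}
    (h : (realPoints (curveUnion (Projectivization.mk ℝ F hF)
      (Projectivization.mk ℝ G hG))).Nonempty) :
    ∃ p : Fin 3 → ℝ, p ≠ 0 ∧ (eval p F.1 = 0 ∨ eval p G.1 = 0) := by
  obtain ⟨p, hp⟩ := h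
  obtain ⟨α, hα, H⟩ := curveForm_curveUnion_mk F hF G hG
  refine ⟨p.rep, p.rep_nonzero, ?_⟩
  rw [realPoints, mem_ofPred_eq, H, smul_eval, eval_mul] at hp
  simpa [hα] using hp

theorem region_smul_of_pos (P : MvPolynomial (Fin 3) ℝ) {α : ℝ} (hα : 0 < α) :
    region (α • P) = region P := by
  ext p
  simp only [region, mem_ofPred_eq, smul_eval, mul_nonneg_iff_of_pos_left hα]

/-- A form of `B` whose product with a given form of `C` defines the chosen region. -/
theorem exists_form_region (B : PlaneCurve m) {G : RealForm n} (hG : G ≠ 0)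
    {W₀ : Set RealPlane} (hW₀ : IsRegionOf (curveUnion B (Projectivization.mk ℝ G hG)) W₀) :
    ∃ (F : RealForm m) (hF : F ≠ 0), B = Projectivization.mk ℝ F hF ∧
      W₀ = region (F.1 * G.1) := by
  obtain ⟨F, hF, rfl⟩ : ∃ (F : RealForm m) (hF : F ≠ 0), B = Projectivization.mk ℝ F hF :=
    ⟨B.rep, B.rep_nonzero, B.mk_rep.symm⟩
  obtain ⟨α, hα, H⟩ := curveForm_curveUnion_mk F hF G hG
  have hmk : Projectivization.mk ℝ F hF = Projectivization.mk ℝ (-F) (neg_ne_zero.2 hF) :=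
    (Projectivization.mk_eq_mk_iff' ..).2 ⟨-1, by simp⟩
  rw [IsRegionOf, H, ← neg_smul] at hW₀
  have hpos : ∀ β : ℝ, β ≠ 0 → W₀ = region (β • (F.1 * G.1)) →
      ∃ (F' : RealForm m) (hF' : F' ≠ 0), Projectivization.mk ℝ F hF =
        Projectivization.mk ℝ F' hF' ∧ W₀ = region (F'.1 * G.1) := by
    intro β hβ hW
    -- The forms F and -F define the same curve, so a negative factor is absorbed by F.
    rcases hβ.lt_or_gt with h | h
    · refine ⟨-F, neg_ne_zero.2 hF, hmk, ?_⟩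
      rw [hW, ← region_smul_of_pos ((-F).1 * G.1) (neg_pos.2 h)]
      simp
    · exact ⟨F, hF, rfl, by rw [hW, region_smul_of_pos _ h]⟩
  exact hW₀.elim (hpos α hα) (hpos (-α) (neg_ne_zero.2 hα))

end Deformation

theorem lemma3p4p2 (k m n : ℕ) (hk : 1 ≤ k) (hm : 1 ≤ m) (hn : 1 ≤ n) (hmn : m + n = 2 * k)
    (B₀ B₁ : PlaneCurve m) (C₀ C₁ : PlaneCurve n)
    (hB₀ : IsNonsingularCurve B₀) (hC₀ : IsNonsingularCurve C₀)
    (hB₁ : IsNonsingularCurve B₁) (hC₁ : IsNonsingularCurve C₁)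
    (h₀ : AreTransverse B₀ C₀) (h₁ : AreTransverse B₁ C₁)
    (hA₀ : (realPoints (curveUnion B₀ C₀)).Nonempty)
    (hA₁ : (realPoints (curveUnion B₁ C₁)).Nonempty)
    (W₀ : Set RealPlane) (hW₀ : IsRegionOf (curveUnion B₀ C₀) W₀) :
    ∃ (B : ℝ → PlaneCurve m) (C : ℝ → PlaneCurve n),
      B 0 = B₀ ∧ C 0 = C₀ ∧ B 1 = B₁ ∧ C 1 = C₁ ∧
      IsSimultaneousNodalDeformation B C ∧
      IsNiceFor (fun t => curveUnion (B t) (C t)) W₀ := by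
  have heven : Even (m + n) := ⟨k, by omega⟩
  obtain ⟨G₀, hG₀, rfl⟩ : ∃ (G : RealForm n) (hG : G ≠ 0), C₀ = Projectivization.mk ℝ G hG :=
    ⟨C₀.rep, C₀.rep_nonzero, C₀.mk_rep.symm⟩
  obtain ⟨G₁, hG₁, rfl⟩ : ∃ (G : RealForm n) (hG : G ≠ 0), C₁ = Projectivization.mk ℝ G hG :=
    ⟨C₁.rep, C₁.rep_nonzero, C₁.mk_rep.symm⟩
  obtain ⟨F₁, hF₁, rfl⟩ : ∃ (F : RealForm m) (hF : F ≠ 0), B₁ = Projectivization.mk ℝ F hF :=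
    ⟨B₁.rep, B₁.rep_nonzero, B₁.mk_rep.symm⟩
  -- The choice of the region is encoded in the sign of `F₀`; the signs of the other three forms are
  -- arbitrary.
  obtain ⟨F₀, hF₀, rfl, hW⟩ := exists_form_region B₀ hG₀ hW₀
  obtain ⟨x₀, rfl⟩ := (toForm m).surjective F₀
  obtain ⟨x₁, rfl⟩ := (toForm m).surjective F₁
  obtain ⟨y₀, rfl⟩ := (toForm n).surjective G₀
  obtain ⟨y₁, rfl⟩ := (toForm n).surjective G₁
  obtain ⟨p₀, hp₀, hp₀'⟩ := exists_eval_eq_zero hA₀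
  obtain ⟨p₁, hp₁, hp₁'⟩ := exists_eval_eq_zero hA₁
  have hjoin := joinedIn_safePairs heven hm hn (hB₀.isRealNonsingular hm)
    (hB₁.isRealNonsingular hm) (hC₀.isRealNonsingular hn) (hC₁.isRealNonsingular hn) hp₀ hp₁
    hp₀' hp₁'
  obtain ⟨γ, hγ, hγ0, hγ1, hγU, hγQ⟩ := hjoin.exists_contDiff_of_isAvoidable
    (isOpen_safePairs heven) (isAvoidable_not_generic hm hn)
  have hfst : ContDiff ℝ ∞ fun t => (γ t).1 := contDiff_fst.comp hγ
  have hsnd : ContDiff ℝ ∞ fun t => (γ t).2 := contDiff_snd.comp hγ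
  obtain ⟨B, hB⟩ := exists_represents (φ := fun t => toForm m (γ t).1) fun t ht h =>
    (hγU t ht).1.ne_zero (congrArg Subtype.val h)
  obtain ⟨C, hC⟩ := exists_represents (φ := fun t => toForm n (γ t).2) fun t ht h =>
    (hγU t ht).2.ne_zero (congrArg Subtype.val h)
  have e0 : (0 : ℝ) ∈ Icc (0 : ℝ) 1 := by simp
  have e1 : (1 : ℝ) ∈ Icc (0 : ℝ) 1 := by simp
  have hB0 : B 0 = Projectivization.mk ℝ (toForm m x₀) hF₀ := by
    rw [(hB 0 e0).2]; congr 1; simp [hγ0]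
  have hC0 : C 0 = Projectivization.mk ℝ (toForm n y₀) hG₀ := by
    rw [(hC 0 e0).2]; congr 1; simp [hγ0]
  have hB1 : B 1 = Projectivization.mk ℝ (toForm m x₁) hF₁ := by
    rw [(hB 1 e1).2]; congr 1; simp [hγ1]
  have hC1 : C 1 = Projectivization.mk ℝ (toForm n y₁) hG₁ := by
    rw [(hC 1 e1).2]; congr 1; simp [hγ1]
  refine ⟨B, C, hB0, hC0, hB1, hC1, ?_, ?_⟩
  · refine isSimultaneousNodalDeformation_of_isGenericPair hm hn heven hfst hsnd hB hC
      (hB0 ▸ hB₀) (hC0 ▸ hC₀) (hB1 ▸ hB₁) (hC1 ▸ hC₁) (by rwa [hB0, hC0]) (by rwa [hB1, hC1])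
      fun t ht => ?_
    have := hγQ t ht
    simp only [not_or, not_not] at this
    obtain ⟨hd1, hd2⟩ := deriv_fst_snd ((hγ.differentiable (by simp)).differentiableAt (x := t))
    rw [hd1, hd2]
    exact this
  · exact isNiceFor_of_safePairs hfst.continuous hsnd.continuous hB hC hγU (by rw [hγ0]; exact hW)
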